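/- Let $\mathbb K=\mathbb R$ or $\mathbb C$ and let $D\subset\mathbb K^3$ be a nonempty convex open set with coordinates $x_1,x_2,x_3$; subscripts on functions denote partial derivatives. Let $\lambda$ be an analytic function without zeros on $D$ (conformally flat metric $\lambda\,(dx_1^2+dx_2^2+dx_3^2)$), and write $$\mathcal H_V=\frac{p_1^2+p_2^2+p_3^2}{\lambda}+V,\qquad \{F,G\}=\sum_{j=1}^3\big(\partial_{x_j}F\,\partial_{p_j}G-\partial_{p_j}F\,\partial_{x_j}G\big).$$ *Nondegenerate potential.* Let $\mathcal V$ be the space of analytic solutions $V$ on $D$ of $$V_{22}=V_{11}+A^{22}V_1+B^{22}V_2+C^{22}V_3,\qquad V_{33}=V_{11}+A^{33}V_1+B^{33}V_2+C^{33}V_3,$$ $$V_{ij}=A^{ij}V_1+B^{ij}V_2+C^{ij}V_3\qquad (1\le i<j\le 3),$$ where the coefficients are analytic on $D$ and the integrability conditions hold identically, i.e. at every point of $D$ the values of $V,V_1,V_2,V_3,V_{11}$ can be prescribed arbitrarily for $V\in\mathcal V$. *Second order constants of the motion.* These are functions $\mathcal S_V=\sum_{k,j} a^{kj}(x)p_kp_j+W_V(x)$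 with an analytic symmetric tensor $a$ not depending on $V$ and with analytic $W_V$, such that $\{\mathcal H_V,\mathcal S_V\}=0$ for all $V\in\mathcal V$. The system is *superintegrable* if there are four of them whose quadratic forms $\sum a_{(h)}^{kj}p_kp_j$ ($h=1,\dots,4$) together with $(p_1^2+p_2^2+p_3^2)/\lambda$ are functionally independent. *Truly third order constants of the motion.* These are functions $$\mathcal K_V=\sum_{k,j,i}a^{kji}(x)p_kp_jp_i+\sum_{\ell}\Big(\sum_j f^{\ell,j}(x)V_j(x)\Big)p_\ell$$ with $a^{kji}$ symmetric in its indices, and $a^{kji},f^{\ell,j}$ analytic and not depending on $V$, such that $\{\mathcal H_V,\mathcal K_V\}=0$ for all $V\in\mathcal V$. *Stäckel transform of the isotropic oscillator.* The isotropic oscillator on an open set $D'\subset\mathbb K^3$ is the system with metric factor $1$ and potentials $\alpha(y_1^2+y_2^2+y_3^2)+\beta_1y_1+\beta_2y_2+\beta_3y_3+\gamma$. If $U$ is one of these potentials, without zeros on $D'$, the Stäckel transform by $U$ is the system on $D'$ with metric factor $U$ and potentials $V/U$. The system $(D,\lambda,\mathcal V)$ is a Stäckel transform of the isotropic oscillator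 if an injective analytic change of coordinates $\varphi$ from $D$ onto such a $D'$ pulls back the metric and the potentials of some such Stäckel transform to $\lambda\,(dx_1^2+dx_2^2+dx_3^2)$ and $\mathcal V$. **Theorem.** If the nondegenerate system $(D,\lambda,\mathcal V)$ is superintegrable and is not a Stäckel transform of the isotropic oscillator, then the vector space over $\mathbb K$ of truly third order constants of the motion (as functions of $V\in\mathcal V$, $x\in D$, $p\in\mathbb K^3$) has dimension $4$, and it is spanned by the Poisson brackets $\{\mathcal S_V,\mathcal S'_V\}$ of second order constants of the motion. -/

import Mathlib

noncomputable section

namespace Superintegrable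

variable {𝕜 : Type*} [RCLike 𝕜]

/-- Coordinate space (also used for the momenta); `𝕜` is `ℝ` or `ℂ`. -/
abbrev Pt (𝕜 : Type*) : Type _ := Fin 3 → 𝕜

/-- The partial derivative `∂ f / ∂ x_j` at `x`. -/
def pd (j : Fin 3) (f : Pt 𝕜 → 𝕜) (x : Pt 𝕜) : 𝕜 :=
  fderiv 𝕜 f x (Pi.single j 1)

/-- The Poisson bracket `∑ j, (∂_{x_j} F ∂_{p_j} G - ∂_{p_j} F ∂_{x_j} G)` of two functions of
position `x` and momentum `p`. -/
def poissonBracket (F G : Pt 𝕜 → Pt 𝕜 → 𝕜) (x p : Pt 𝕜) : 𝕜 :=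
  ∑ j, (pd j (fun y => F y p) x * pd j (fun q => G x q) p
    - pd j (fun q => F x q) p * pd j (fun y => G y p) x)

/-- The data of a Hamiltonian system with a family of potentials, in coordinates on `domain`:
the metric is `lam * (dx₁² + dx₂² + dx₃²)` and the Hamiltonians are
`(p₁² + p₂² + p₃²) / lam + V` with `V ∈ pot`.
Only the values of `lam` and of the potentials on `domain` matter. -/
structure System (𝕜 : Type*) [RCLike 𝕜] where
  domain : Set (Pt 𝕜)
  lam : Pt 𝕜 → 𝕜
  pot : Set (Pt 𝕜 → 𝕜)
  analytic_pot : ∀ V ∈ pot, AnalyticOnNhd 𝕜 V domain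

/-- The kinetic part `(p₁² + p₂² + p₃²) / lam` of the Hamiltonian. -/
def System.freeHamiltonian (S : System 𝕜) (x p : Pt 𝕜) : 𝕜 :=
  (∑ i, p i ^ 2) / S.lam x

/-- The Hamiltonian `(p₁² + p₂² + p₃²) / lam + V`. -/
def System.hamiltonian (S : System 𝕜) (V : Pt 𝕜 → 𝕜) (x p : Pt 𝕜) : 𝕜 :=
  S.freeHamiltonian x p + V x

/-- The coordinate domain is a nonempty convex open set and the conformal factor `lam` is analytic
and nowhere zero on it. -/
structure System.IsConformallyFlat (S : System 𝕜) : Prop where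
  isOpen : IsOpen S.domain
  convex : Convex ℝ S.domain
  nonempty : S.domain.Nonempty
  analytic_lam : AnalyticOnNhd 𝕜 S.lam S.domain
  lam_ne_zero : ∀ x ∈ S.domain, S.lam x ≠ 0

/-- The potentials of `S` are exactly the analytic solutions of the five equations
`V₂₂ = V₁₁ + A²² V₁ + B²² V₂ + C²² V₃`, `V₃₃ = V₁₁ + A³³ V₁ + B³³ V₂ + C³³ V₃`,
`V₁₂ = A¹² V₁ + B¹² V₂ + C¹² V₃`, and likewise for `V₁₃`, `V₂₃` (the indices are `0, 1, 2` below),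
with analytic coefficients, and the integrability conditions of these equations hold identically:
at every point the values of `V`, `V₁`, `V₂`, `V₃`, `V₁₁` can be prescribed arbitrarily. -/
def System.IsNondegenerate (S : System 𝕜) : Prop :=
  ∃ A B C : Fin 3 → Fin 3 → Pt 𝕜 → 𝕜,
    (∀ i j, AnalyticOnNhd 𝕜 (A i j) S.domain ∧ AnalyticOnNhd 𝕜 (B i j) S.domain ∧
      AnalyticOnNhd 𝕜 (C i j) S.domain) ∧
    (∀ V : Pt 𝕜 → 𝕜, V ∈ S.pot ↔
      AnalyticOnNhd 𝕜 V S.domain ∧ ∀ x ∈ S.domain,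
        (∀ i : Fin 3, i ≠ 0 → pd i (pd i V) x =
          pd 0 (pd 0 V) x + A i i x * pd 0 V x + B i i x * pd 1 V x + C i i x * pd 2 V x) ∧
        (∀ i j : Fin 3, i < j → pd i (pd j V) x =
          A i j x * pd 0 V x + B i j x * pd 1 V x + C i j x * pd 2 V x)) ∧
    (∀ x ∈ S.domain, ∀ (c : 𝕜) (g : Fin 3 → 𝕜) (h : 𝕜),
      ∃ V ∈ S.pot, V x = c ∧ (∀ i, pd i V x = g i) ∧ pd 0 (pd 0 V) x = h)

/-- The quadratic form `∑ a^{kj}(x) p_k p_j`. -/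
def quadForm (a : Pt 𝕜 → Fin 3 → Fin 3 → 𝕜) (x p : Pt 𝕜) : 𝕜 :=
  ∑ k, ∑ j, a x k j * p k * p j

/-- A second order constant of the motion `∑ a^{kj}(x) p_k p_j + W(x)`: the symmetric tensor `a`
does not depend on the potential, whereas `W = W_V` does. -/
structure System.IsSecondOrderConstant (S : System 𝕜)
    (a : Pt 𝕜 → Fin 3 → Fin 3 → 𝕜) (W : S.pot → Pt 𝕜 → 𝕜) : Prop where
  analytic_a : ∀ k j, AnalyticOnNhd 𝕜 (fun x => a x k j) S.domain
  symm : ∀ x ∈ S.domain, ∀ k j, a x k j = a x j k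
  analytic_W : ∀ V, AnalyticOnNhd 𝕜 (W V) S.domain
  bracket_eq_zero : ∀ V : S.pot, ∀ x ∈ S.domain, ∀ p,
    poissonBracket (S.hamiltonian V) (fun y q => quadForm a y q + W V y) x p = 0

/-- Functional independence of phase space functions over `D`: the differentials are linearly
independent at some point. (For analytic functions over a connected `D` this is the same as linear
independence on a dense open set.) -/
def FunctionallyIndependent {ι : Type*} (D : Set (Pt 𝕜)) (F : ι → Pt 𝕜 → Pt 𝕜 → 𝕜) : Prop :=
  ∃ x ∈ D, ∃ p : Pt 𝕜,
    LinearIndependent 𝕜 (fun i => fderiv 𝕜 (fun z : Pt 𝕜 × Pt 𝕜 => F i z.1 z.2) (x, p))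

/-- Second order superintegrability: in addition to the Hamiltonian there are four second order
constants of the motion, such that the five quadratic forms are functionally independent. -/
def System.IsSuperintegrable (S : System 𝕜) : Prop :=
  ∃ (a : Fin 4 → Pt 𝕜 → Fin 3 → Fin 3 → 𝕜) (W : Fin 4 → S.pot → Pt 𝕜 → 𝕜),
    (∀ h, S.IsSecondOrderConstant (a h) (W h)) ∧
    FunctionallyIndependent S.domain
      (Fin.cons S.freeHamiltonian (fun h => quadForm (a h)) : Fin 5 → Pt 𝕜 → Pt 𝕜 → 𝕜)

/-- The isotropic oscillator on a domain of flat space: `lam = 1` and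
`V = α (x₁² + x₂² + x₃²) + β₁ x₁ + β₂ x₂ + β₃ x₃ + γ`. -/
def isotropicOscillator (D : Set (Pt 𝕜)) : System 𝕜 where
  domain := D
  lam := fun _ => 1
  pot := {V | AnalyticOnNhd 𝕜 V D ∧ ∃ (α : 𝕜) (β : Fin 3 → 𝕜) (γ : 𝕜),
    ∀ x ∈ D, V x = α * ∑ i, x i ^ 2 + ∑ i, β i * x i + γ}
  analytic_pot := fun _ h => h.1

/-- The Stäckel transform of `S` by `U`: `lam` becomes `lam * U` and the potentials `V` become
`V / U`. It is meaningful when `U` is a potential of `S` without zeros on the domain. -/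
def System.stackelTransform (S : System 𝕜) (U : Pt 𝕜 → 𝕜) : System 𝕜 where
  domain := S.domain
  lam := fun x => S.lam x * U x
  pot := {V | AnalyticOnNhd 𝕜 V S.domain ∧ (fun x => V x * U x) ∈ S.pot}
  analytic_pot := fun _ h => h.1

/-- `φ` is an analytic change of coordinates that identifies `S` with `T`: it is injective, maps the
domain of `S` onto that of `T`, pulls the metric of `T` back to the metric of `S`, and pulls the
potentials of `T` back to the potentials of `S`. -/
structure System.IsEquivalence (S T : System 𝕜) (φ : Pt 𝕜 → Pt 𝕜) : Prop where
  analytic : AnalyticOnNhd 𝕜 φ S.domain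
  injOn : Set.InjOn φ S.domain
  image_eq : φ '' S.domain = T.domain
  metric : ∀ x ∈ S.domain, ∀ i j : Fin 3,
    T.lam (φ x) * ∑ k, pd i (fun y => φ y k) x * pd j (fun y => φ y k) x =
      if i = j then S.lam x else 0
  mem_pot_iff : ∀ V : Pt 𝕜 → 𝕜, V ∈ S.pot ↔ ∃ V' ∈ T.pot, ∀ x ∈ S.domain, V x = V' (φ x)

/-- Up to a change of coordinates, `S` is a Stäckel transform of the isotropic oscillator on some
open subset of flat space. -/
def System.IsStackelTransformOfOscillator (S : System 𝕜) : Prop :=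
  ∃ (D : Set (Pt 𝕜)) (U : Pt 𝕜 → 𝕜) (φ : Pt 𝕜 → Pt 𝕜),
    IsOpen D ∧ U ∈ (isotropicOscillator D).pot ∧ (∀ y ∈ D, U y ≠ 0) ∧
    S.IsEquivalence ((isotropicOscillator D).stackelTransform U) φ

/-- The cubic function `∑ a^{kji}(x) p_k p_j p_i + ∑ b^ℓ(x) p_ℓ` with
`b^ℓ = ∑ f^{ℓ,j}(x) V_j(x)`. -/
def cubic (a : Pt 𝕜 → Fin 3 → Fin 3 → Fin 3 → 𝕜) (f : Pt 𝕜 → Fin 3 → Fin 3 → 𝕜)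
    (V : Pt 𝕜 → 𝕜) (x p : Pt 𝕜) : 𝕜 :=
  (∑ k, ∑ j, ∑ i, a x k j i * p k * p j * p i) + ∑ l, (∑ j, f x l j * pd j V x) * p l

/-- `a` and `f` define a truly third order constant of the motion: `a` is symmetric, neither `a` nor
`f` depends on the potential, and the resulting cubic function Poisson commutes with the
Hamiltonian for every potential of the family. -/
structure System.IsThirdOrderConstant (S : System 𝕜)
    (a : Pt 𝕜 → Fin 3 → Fin 3 → Fin 3 → 𝕜) (f : Pt 𝕜 → Fin 3 → Fin 3 → 𝕜) : Prop where
  analytic_a : ∀ k j i, AnalyticOnNhd 𝕜 (fun x => a x k j i) S.domain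
  analytic_f : ∀ l j, AnalyticOnNhd 𝕜 (fun x => f x l j) S.domain
  symm : ∀ x ∈ S.domain, ∀ k j i, a x k j i = a x j k i ∧ a x k j i = a x k i j
  bracket_eq_zero : ∀ V : S.pot, ∀ x ∈ S.domain, ∀ p,
    poissonBracket (S.hamiltonian V) (cubic a f V) x p = 0

/-- Phase space functions over the domain of `S` that depend on the potential. -/
abbrev System.Family (S : System 𝕜) : Type _ := S.pot → S.domain → Pt 𝕜 → 𝕜

section helpers

theorem pd_add (j : Fin 3) {f g : Pt 𝕜 → 𝕜} {x : Pt 𝕜} (hf : DifferentiableAt 𝕜 f x)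
    (hg : DifferentiableAt 𝕜 g x) : pd j (fun y => f y + g y) x = pd j f x + pd j g x := by
  simp [pd, fderiv_fun_add hf hg]

theorem pd_const_mul (j : Fin 3) (c : 𝕜) {f : Pt 𝕜 → 𝕜} {x : Pt 𝕜}
    (hf : DifferentiableAt 𝕜 f x) : pd j (fun y => c * f y) x = c * pd j f x := by
  simp [pd, fderiv_const_mul hf]

theorem analyticAt_pd (j : Fin 3) {f : Pt 𝕜 → 𝕜} {x : Pt 𝕜} (hf : AnalyticAt 𝕜 f x) :
    AnalyticAt 𝕜 (pd j f) x :=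
  ((ContinuousLinearMap.apply 𝕜 𝕜 (Pi.single j (1 : 𝕜) : Pt 𝕜)).analyticAt _).comp hf.fderiv

theorem poissonBracket_add (F G K : Pt 𝕜 → Pt 𝕜 → 𝕜) (x p : Pt 𝕜)
    (hG : DifferentiableAt 𝕜 (fun y => G y p) x) (hG' : DifferentiableAt 𝕜 (fun q => G x q) p)
    (hK : DifferentiableAt 𝕜 (fun y => K y p) x) (hK' : DifferentiableAt 𝕜 (fun q => K x q) p) :
    poissonBracket F (fun y q => G y q + K y q) x p =
      poissonBracket F G x p + poissonBracket F K x p := by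
  simp only [poissonBracket, pd_add _ hG hK, pd_add _ hG' hK', ← Finset.sum_add_distrib]
  exact Finset.sum_congr rfl fun j _ => by ring

theorem poissonBracket_const_mul (c : 𝕜) (F G : Pt 𝕜 → Pt 𝕜 → 𝕜) (x p : Pt 𝕜)
    (hG : DifferentiableAt 𝕜 (fun y => G y p) x) (hG' : DifferentiableAt 𝕜 (fun q => G x q) p) :
    poissonBracket F (fun y q => c * G y q) x p = c * poissonBracket F G x p := by
  simp only [poissonBracket, pd_const_mul _ _ hG, pd_const_mul _ _ hG', Finset.mul_sum]
  exact Finset.sum_congr rfl fun j _ => by ring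

theorem differentiableAt_cubic_left {S : System 𝕜} {a : Pt 𝕜 → Fin 3 → Fin 3 → Fin 3 → 𝕜}
    {f : Pt 𝕜 → Fin 3 → Fin 3 → 𝕜} (h : S.IsThirdOrderConstant a f) (V : S.pot) {x : Pt 𝕜}
    (hx : x ∈ S.domain) (p : Pt 𝕜) : DifferentiableAt 𝕜 (fun y => cubic a f V y p) x := by
  have ha := fun k j i => (h.analytic_a k j i x hx).differentiableAt
  have hf := fun l j => (h.analytic_f l j x hx).differentiableAt
  have hV := fun j => (analyticAt_pd j (S.analytic_pot V V.2 x hx)).differentiableAt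
  unfold cubic
  fun_prop

theorem differentiableAt_cubic_right (a : Pt 𝕜 → Fin 3 → Fin 3 → Fin 3 → 𝕜)
    (f : Pt 𝕜 → Fin 3 → Fin 3 → 𝕜) (V : Pt 𝕜 → 𝕜) (x p : Pt 𝕜) :
    DifferentiableAt 𝕜 (fun q => cubic a f V x q) p := by
  unfold cubic
  fun_prop

theorem cubic_add (a a' : Pt 𝕜 → Fin 3 → Fin 3 → Fin 3 → 𝕜) (f f' : Pt 𝕜 → Fin 3 → Fin 3 → 𝕜)
    (V : Pt 𝕜 → 𝕜) : cubic (a + a') (f + f') V = fun x p => cubic a f V x p + cubic a' f' V x p := by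
  funext x p
  simp only [cubic, Pi.add_apply, add_mul, Finset.sum_add_distrib]
  ring

theorem cubic_smul (c : 𝕜) (a : Pt 𝕜 → Fin 3 → Fin 3 → Fin 3 → 𝕜)
    (f : Pt 𝕜 → Fin 3 → Fin 3 → 𝕜) (V : Pt 𝕜 → 𝕜) :
    cubic (c • a) (c • f) V = fun x p => c * cubic a f V x p := by
  funext x p
  simp only [cubic, Pi.smul_apply, smul_eq_mul, mul_add, Finset.mul_sum, Finset.sum_mul, mul_assoc]

theorem isThirdOrderConstant_zero (S : System 𝕜) : S.IsThirdOrderConstant 0 0 where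
  analytic_a := fun _ _ _ _ _ => analyticAt_const
  analytic_f := fun _ _ _ _ => analyticAt_const
  symm := by simp
  bracket_eq_zero := by
    intro V x _ p
    have h : cubic (0 : Pt 𝕜 → Fin 3 → Fin 3 → Fin 3 → 𝕜) 0 (V : Pt 𝕜 → 𝕜) = fun _ _ => 0 := by
      funext x p; simp [cubic]
    simp [h, poissonBracket, pd]

theorem System.IsThirdOrderConstant.add {S : System 𝕜} {a a' : Pt 𝕜 → Fin 3 → Fin 3 → Fin 3 → 𝕜}
    {f f' : Pt 𝕜 → Fin 3 → Fin 3 → 𝕜} (h : S.IsThirdOrderConstant a f)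
    (h' : S.IsThirdOrderConstant a' f') : S.IsThirdOrderConstant (a + a') (f + f') where
  analytic_a := fun k j i x hx => (h.analytic_a k j i x hx).add (h'.analytic_a k j i x hx)
  analytic_f := fun l j x hx => (h.analytic_f l j x hx).add (h'.analytic_f l j x hx)
  symm := fun x hx k j i => by
    have h1 := h.symm x hx k j i
    have h2 := h'.symm x hx k j i
    simp only [Pi.add_apply]
    exact ⟨by rw [h1.1, h2.1], by rw [h1.2, h2.2]⟩
  bracket_eq_zero := fun V x hx p => by
    rw [cubic_add, poissonBracket_add _ _ _ _ _ (differentiableAt_cubic_left h V hx p)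
      (differentiableAt_cubic_right _ _ _ _ _) (differentiableAt_cubic_left h' V hx p)
      (differentiableAt_cubic_right _ _ _ _ _), h.bracket_eq_zero V x hx p,
      h'.bracket_eq_zero V x hx p, add_zero]

theorem System.IsThirdOrderConstant.smul {S : System 𝕜} {a : Pt 𝕜 → Fin 3 → Fin 3 → Fin 3 → 𝕜}
    {f : Pt 𝕜 → Fin 3 → Fin 3 → 𝕜} (c : 𝕜) (h : S.IsThirdOrderConstant a f) :
    S.IsThirdOrderConstant (c • a) (c • f) where
  analytic_a := fun k j i x hx => analyticAt_const.mul (h.analytic_a k j i x hx)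
  analytic_f := fun l j x hx => analyticAt_const.mul (h.analytic_f l j x hx)
  symm := fun x hx k j i => by
    have h1 := h.symm x hx k j i
    simp only [Pi.smul_apply]
    exact ⟨by rw [h1.1], by rw [h1.2]⟩
  bracket_eq_zero := fun V x hx p => by
    rw [cubic_smul, poissonBracket_const_mul _ _ _ _ _ (differentiableAt_cubic_left h V hx p)
      (differentiableAt_cubic_right _ _ _ _ _), h.bracket_eq_zero V x hx p, mul_zero]

end helpers

/-- The vector space of truly third order constants of the motion, as phase space functions that
depend on the potential. -/
def System.thirdOrderConstants (S : System 𝕜) : Submodule 𝕜 S.Family where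
  carrier := {K | ∃ a f, S.IsThirdOrderConstant a f ∧ K = fun (V : S.pot) (x : S.domain) p => cubic a f V x p}
  zero_mem' := ⟨0, 0, isThirdOrderConstant_zero S, by funext V x p; simp [cubic]⟩
  add_mem' := by
    rintro _ _ ⟨a, f, h, rfl⟩ ⟨a', f', h', rfl⟩
    exact ⟨_, _, h.add h', by funext V x p; simp [cubic_add]⟩
  smul_mem' := by
    rintro c _ ⟨a, f, h, rfl⟩
    exact ⟨_, _, h.smul c, by funext V x p; simp [cubic_smul]⟩

/-- The Poisson brackets of two second order constants of the motion. -/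
def System.secondOrderBrackets (S : System 𝕜) : Set S.Family :=
  {K | ∃ a W a' W', S.IsSecondOrderConstant a W ∧ S.IsSecondOrderConstant a' W' ∧
    K = fun (V : S.pot) (x : S.domain) p => poissonBracket
      (fun y q => quadForm a y q + W V y)
      (fun y q => quadForm a' y q + W' V y) x p}

end Superintegrable

end

/-!
The potentials of a nondegenerate system satisfy `∂ᵢ∂ⱼ V = δᵢⱼ h + ∑ₖ Tᵢⱼₖ ∂ₖV` with a structure
tensor `T` (`System.IsNondegenerate.exists_structureTensor`), and `V`, `∂V`, `h` are arbitrary at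
a point. Comparing third derivatives shows that `T` is the sum of a totally symmetric trace-free
tensor with seven components `s` and of a trace with three components `u`
(`IsPotentialTensor.exists_eq`), and gives quadratic equations for `∂T` (`PotIntegrable`).

*Second order constants.* The tensor `a` of a second order constant is a Killing tensor, and the
closedness of `dW` for all potentials gives the derivatives of `b = λ a` that the Killing
equations leave free. So the second order constants correspond to the solutions of a total linear
system `∂b = M(b)` on symmetric tensors, with coefficients depending on `T` and on the logarithmic
gradient of `λ` (`System.IsTensorSolution`). The metric and the four given constants give five
solutions that are linearly independent at every point, in the six-dimensional space of symmetric
tensors. Hence the curvature of the system has rank at most one. The integrability conditions of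
the potentials impose linear relations on this curvature (`curvRelations`) that are incompatible
with rank one (`CurvRelations.eq_zero`), so the system is flat, and reduction of order provides
the missing solution: every symmetric tensor at a point is the value of a second order constant
(`System.IsSuperintegrable.exists_isTensorSolution`).

*Third order constants.* The bracket with the Hamiltonian forces the tensor `f` of a truly third
order constant to be skew, expresses the cubic part through `f`, and gives all derivatives of `f`
in terms of `f` and of the divergence of the vector dual to `f`. This is again a total linear
system, so that the constant is determined by four numbers at a point
(`System.ker_thirdOrderJet`). For the bracket of two second order constants, `f` is a multiple of
the commutator of their tensors. If `s ≠ 0` at a point, then the brackets, whose tensors are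
arbitrary there, attain a spanning set of values of these four numbers (`eq_zero_of_symComm`).
This proves the theorem in that case (`System.IsSuperintegrable.thirdOrderConstants_of_ne_zero`).

*The excluded case.* If `s` vanishes identically, then the integrability conditions and the
flatness of the system for second order constants become Riccati equations for two gradients. They
are the logarithmic gradients of quadratic functions `σ` and `h` with isotropic quadratic part,
`λ = C σ / h³`, and the potentials are the quotients of such quadratic functions by `σ`
(`System.IsSuperintegrable.exists_isoQuad`). Since `h` has zero discriminant, it is the
denominator of a special conformal transformation, which identifies the system with a Stäckel
transform of the isotropic oscillator (`System.IsSuperintegrable.isStackelTransformOfOscillator`).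
-/

noncomputable section

namespace Superintegrable

variable {𝕜 : Type*} [RCLike 𝕜]

/-! ### Partial derivatives -/

theorem pd_mul (j : Fin 3) {f g : Pt 𝕜 → 𝕜} {x : Pt 𝕜} (hf : DifferentiableAt 𝕜 f x)
    (hg : DifferentiableAt 𝕜 g x) :
    pd j (fun y => f y * g y) x = pd j f x * g x + f x * pd j g x := by
  simp only [pd, fderiv_fun_mul hf hg, add_apply, _root_.smul_apply, smul_eq_mul]
  ring

theorem pd_sub (j : Fin 3) {f g : Pt 𝕜 → 𝕜} {x : Pt 𝕜} (hf : DifferentiableAt 𝕜 f x)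
    (hg : DifferentiableAt 𝕜 g x) : pd j (fun y => f y - g y) x = pd j f x - pd j g x := by
  simp [pd, fderiv_fun_sub hf hg]

theorem pd_neg (j : Fin 3) (f : Pt 𝕜 → 𝕜) (x : Pt 𝕜) :
    pd j (fun y => - f y) x = - pd j f x := by
  simp [pd, fderiv_fun_neg]

theorem pd_const (j : Fin 3) (c : 𝕜) (x : Pt 𝕜) : pd j (fun _ => c) x = 0 := by
  simp [pd]

theorem pd_coord (j i : Fin 3) (x : Pt 𝕜) : pd j (fun y => y i) x = if i = j then 1 else 0 := by
  have h : HasFDerivAt (fun y : Pt 𝕜 => y i) (ContinuousLinearMap.proj (R := 𝕜) i) x :=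
    hasFDerivAt_apply i x
  simp [pd, h.fderiv, Pi.single_apply]

theorem pd_sum {ι : Type*} (s : Finset ι) (j : Fin 3) {f : ι → Pt 𝕜 → 𝕜} {x : Pt 𝕜}
    (hf : ∀ i ∈ s, DifferentiableAt 𝕜 (f i) x) :
    pd j (fun y => ∑ i ∈ s, f i y) x = ∑ i ∈ s, pd j (f i) x := by
  simp [pd, fderiv_fun_sum hf]

theorem pd_pow (j : Fin 3) (n : ℕ) {f : Pt 𝕜 → 𝕜} {x : Pt 𝕜} (hf : DifferentiableAt 𝕜 f x) :
    pd j (fun y => f y ^ n) x = n * f x ^ (n - 1) * pd j f x := by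
  simp only [pd, fderiv_fun_pow n hf, _root_.smul_apply, smul_eq_mul, nsmul_eq_mul]

theorem pd_inv (j : Fin 3) {f : Pt 𝕜 → 𝕜} {x : Pt 𝕜} (hf : DifferentiableAt 𝕜 f x)
    (h0 : f x ≠ 0) : pd j (fun y => (f y)⁻¹) x = - pd j f x / f x ^ 2 := by
  have h : HasFDerivAt (fun y => (f y)⁻¹) (-(f x ^ 2)⁻¹ • fderiv 𝕜 f x) x :=
    (hasDerivAt_inv h0).comp_hasFDerivAt x hf.hasFDerivAt
  simp only [pd, h.fderiv, _root_.smul_apply, smul_eq_mul]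
  field_simp

theorem pd_congr (j : Fin 3) {f g : Pt 𝕜 → 𝕜} {D : Set (Pt 𝕜)} (hD : IsOpen D)
    (h : ∀ y ∈ D, f y = g y) {x : Pt 𝕜} (hx : x ∈ D) : pd j f x = pd j g x := by
  have : f =ᶠ[nhds x] g := by filter_upwards [hD.mem_nhds hx] with y hy using h y hy
  simp [pd, this.fderiv_eq]

theorem pd_comm (i j : Fin 3) {f : Pt 𝕜 → 𝕜} {x : Pt 𝕜} (hf : AnalyticAt 𝕜 f x) :
    pd i (pd j f) x = pd j (pd i f) x := by
  have hs : IsSymmSndFDerivAt 𝕜 f x := hf.contDiffAt.isSymmSndFDerivAt_of_omega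
  have key : ∀ k l : Fin 3, pd k (pd l f) x =
      fderiv 𝕜 (fderiv 𝕜 f) x (Pi.single k 1) (Pi.single l 1) := by
    intro k l
    have hd := hf.fderiv.differentiableAt
    have : HasFDerivAt (fun y => fderiv 𝕜 f y (Pi.single l (1 : 𝕜)))
        ((ContinuousLinearMap.apply 𝕜 𝕜 (Pi.single l (1 : 𝕜) : Pt 𝕜)).comp
          (fderiv 𝕜 (fderiv 𝕜 f) x)) x :=
      (ContinuousLinearMap.apply 𝕜 𝕜 (Pi.single l (1 : 𝕜) : Pt 𝕜)).hasFDerivAt.comp x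
        hd.hasFDerivAt
    change fderiv 𝕜 (fun y => fderiv 𝕜 f y (Pi.single l 1)) x (Pi.single k 1) = _
    rw [this.fderiv]
    rfl
  rw [key, key, hs]

theorem fderiv_eq_sum_pd (f : Pt 𝕜 → 𝕜) (x v : Pt 𝕜) :
    fderiv 𝕜 f x v = ∑ i, v i * pd i f x := by
  conv_lhs => rw [pi_eq_sum_univ' v]
  simp only [map_sum, map_smul, smul_eq_mul, pd]

theorem analyticOnNhd_pd (j : Fin 3) {f : Pt 𝕜 → 𝕜} {D : Set (Pt 𝕜)}
    (hf : AnalyticOnNhd 𝕜 f D) : AnalyticOnNhd 𝕜 (pd j f) D :=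
  fun x hx => analyticAt_pd j (hf x hx)

/-! ### Uniqueness for total linear systems -/

/-- A solution of a homogeneous linear total system `∂ᵢ y = Φᵢ y` on a convex set vanishes as soon
as it vanishes at one point: restrict to segments and apply Grönwall's inequality. -/
theorem eq_zero_of_linear_system {ι : Type*} [Fintype ι] [DecidableEq ι] {D : Set (Pt 𝕜)}
    (hD : IsOpen D) (hc : Convex ℝ D) (Φ : Fin 3 → Pt 𝕜 → (ι → 𝕜) →ₗ[𝕜] (ι → 𝕜))
    (hΦ : ∀ i v a, ContinuousOn (fun x => Φ i x v a) D) (y : Pt 𝕜 → ι → 𝕜)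
    (hy : ∀ a, DifferentiableOn 𝕜 (fun x => y x a) D)
    (h : ∀ x ∈ D, ∀ i a, pd i (fun z => y z a) x = Φ i x (y x) a)
    {x₀ : Pt 𝕜} (hx₀ : x₀ ∈ D) (h0 : y x₀ = 0) : ∀ x ∈ D, y x = 0 := by
  intro x hx
  set γ : ℝ → Pt 𝕜 := fun r => x₀ + r • (x - x₀) with hγ
  have hγD : ∀ r ∈ Set.Icc (0 : ℝ) 1, γ r ∈ D := by
    intro r hr
    exact hc.add_smul_sub_mem hx₀ hx hr
  have hγc : Continuous γ := by fun_prop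
  let B : ℝ → ℝ := fun r => ∑ a, ∑ i, ∑ c, ‖x i - x₀ i‖ * ‖Φ i (γ r) (Pi.single c 1) a‖
  have hB : ContinuousOn B (Set.Icc 0 1) := by
    refine continuousOn_finsetSum _ fun a _ => continuousOn_finsetSum _ fun i _ =>
      continuousOn_finsetSum _ fun c _ => ?_
    exact continuousOn_const.mul
      ((hΦ i (Pi.single c 1) a).comp hγc.continuousOn (fun r hr => hγD r hr)).norm
  obtain ⟨K, hK⟩ := isCompact_Icc.exists_bound_of_continuousOn hB
  have hγ' : ∀ r : ℝ, HasDerivAt γ (x - x₀) r := fun r => by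
    refine HasDerivAt.congr_deriv (((hasDerivAt_id r).smul_const (x - x₀)).const_add x₀) ?_
    simp
  have hder : ∀ r ∈ Set.Icc (0 : ℝ) 1, HasDerivAt (fun r => y (γ r))
      (fun a => ∑ i, (x i - x₀ i) * Φ i (γ r) (y (γ r)) a) r := by
    intro r hr
    rw [hasDerivAt_pi]
    intro a
    have hd : DifferentiableAt 𝕜 (fun z => y z a) (γ r) :=
      (hy a).differentiableAt (hD.mem_nhds (hγD r hr))
    have := (hd.hasFDerivAt.restrictScalars ℝ).comp_hasDerivAt r (hγ' r)
    refine HasDerivAt.congr_deriv (f := fun r => y (γ r) a) this ?_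
    simp only [ContinuousLinearMap.coe_restrictScalars', fderiv_eq_sum_pd, Pi.sub_apply]
    exact Finset.sum_congr rfl fun i _ => by rw [h _ (hγD r hr)]
  have hg := norm_le_gronwallBound_of_norm_deriv_right_le (f := fun r => y (γ r)) (δ := 0)
    (K := K) (ε := 0) (a := 0) (b := 1)
    (f' := fun r => fun a => ∑ i, (x i - x₀ i) * Φ i (γ r) (y (γ r)) a)
    (fun r hr => (hder r hr).continuousAt.continuousWithinAt)
    (fun r hr => (hder r ⟨hr.1, hr.2.le⟩).hasDerivWithinAt)
    (by simp [hγ, h0]) ?_ 1 (by simp)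
  · simpa [hγ, gronwallBound_ε0_δ0] using hg
  · intro r hr
    have hr' : r ∈ Set.Icc (0 : ℝ) 1 := ⟨hr.1, hr.2.le⟩
    have hBK : B r ≤ K := (le_abs_self _).trans (hK r hr')
    rw [add_zero]
    have hB0 : ∀ a, 0 ≤ ∑ i, ∑ c, ‖x i - x₀ i‖ * ‖Φ i (γ r) (Pi.single c 1) a‖ := fun a => by
      positivity
    refine (pi_norm_le_iff_of_nonneg (mul_nonneg ((Finset.sum_nonneg fun a _ => hB0 a).trans hBK)
      (norm_nonneg _))).2 fun a => ?_
    have hlin : ∀ i, Φ i (γ r) (y (γ r)) a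
        = ∑ c, y (γ r) c * Φ i (γ r) (Pi.single c 1) a := by
      intro i
      conv_lhs => rw [pi_eq_sum_univ' (y (γ r))]
      simp [Finset.sum_apply]
    calc ‖∑ i, (x i - x₀ i) * Φ i (γ r) (y (γ r)) a‖
        ≤ ∑ i, ∑ c, (‖x i - x₀ i‖ * ‖Φ i (γ r) (Pi.single c 1) a‖) * ‖y (γ r)‖ := by
          refine (norm_sum_le _ _).trans (Finset.sum_le_sum fun i _ => ?_)
          rw [hlin, norm_mul, ← Finset.sum_mul, ← Finset.mul_sum, mul_assoc]
          refine mul_le_mul_of_nonneg_left ?_ (norm_nonneg _)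
          rw [Finset.sum_mul]
          refine (norm_sum_le _ _).trans (Finset.sum_le_sum fun c _ => ?_)
          rw [norm_mul, mul_comm]
          exact mul_le_mul_of_nonneg_left (norm_le_pi_norm _ c) (norm_nonneg _)
      _ = (∑ i, ∑ c, ‖x i - x₀ i‖ * ‖Φ i (γ r) (Pi.single c 1) a‖) * ‖y (γ r)‖ := by
          simp only [Finset.sum_mul]
      _ ≤ B r * ‖y (γ r)‖ := mul_le_mul_of_nonneg_right
          (Finset.single_le_sum (f := fun a => ∑ i, ∑ c,
            ‖x i - x₀ i‖ * ‖Φ i (γ r) (Pi.single c 1) a‖) (fun a _ => hB0 a)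
            (Finset.mem_univ a)) (norm_nonneg _)
      _ ≤ K * ‖y (γ r)‖ := mul_le_mul_of_nonneg_right hBK (norm_nonneg _)

/-! ### Analytic primitives of closed one-forms -/

/-- A function whose derivative is analytic is analytic: the power series of the derivative is
integrated term by term along rays. -/
theorem analyticAt_of_hasFDerivAt {f : Pt 𝕜 → 𝕜} {ω : Pt 𝕜 → Pt 𝕜 →L[𝕜] 𝕜} {x : Pt 𝕜}
    (hω : AnalyticAt 𝕜 ω x) (h : ∀ᶠ y in nhds x, HasFDerivAt f (ω y) y) : AnalyticAt 𝕜 f x := by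
  obtain ⟨p, r₁, hp₁⟩ := hω
  obtain ⟨r₂, hr₂, h₂⟩ := EMetric.mem_nhds_iff.1 h
  set r := min r₁ r₂ with hr
  have hp : HasFPowerSeriesOnBall ω p x r := hp₁.mono (lt_min hp₁.r_pos hr₂) (min_le_left _ _)
  have hf : ∀ y ∈ Metric.eball x r, HasFDerivAt f (ω y) y := fun y hy =>
    h₂ (Metric.eball_subset_eball (min_le_right _ _) hy)
  let q : FormalMultilinearSeries 𝕜 (Pt 𝕜) 𝕜 := fun n => match n with
    | 0 => ContinuousMultilinearMap.constOfIsEmpty 𝕜 _ (f x)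
    | n + 1 => ((n : 𝕜) + 1)⁻¹ • (p n).uncurryRight
  have hq : ∀ (n : ℕ) (y : Pt 𝕜), q (n + 1) (fun _ => y) =
      ((n : 𝕜) + 1)⁻¹ * p n (fun _ => y) y := by
    intro n y
    simp only [q, _root_.smul_apply, smul_eq_mul,
      ContinuousMultilinearMap.uncurryRight_apply]
    rfl
  have hqn : ∀ n, ‖q (n + 1)‖ ≤ ‖p n‖ := by
    intro n
    simp only [q]
    rw [norm_smul, ContinuousMultilinearMap.uncurryRight_norm]
    refine mul_le_of_le_one_left (norm_nonneg (p n)) ?_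
    rw [norm_inv]
    refine inv_le_one_of_one_le₀ ?_
    have : ((n : 𝕜) + 1) = ((n + 1 : ℕ) : 𝕜) := by push_cast; ring
    rw [this, RCLike.norm_natCast]
    exact_mod_cast Nat.succ_pos n
  refine ⟨q, r, ?_, hp.r_pos, ?_⟩
  · refine ENNReal.le_of_forall_nnreal_lt fun s hs => ?_
    obtain ⟨C, hC, hpC⟩ := p.norm_mul_pow_le_of_lt_radius (hs.trans_le hp.r_le)
    refine q.le_radius_of_bound (C * s + ‖q 0‖) fun n => ?_
    rcases n with _ | n
    · simp only [pow_zero, mul_one]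
      have : 0 ≤ C * s := by positivity
      linarith
    · calc ‖q (n + 1)‖ * (s : ℝ) ^ (n + 1) ≤ ‖p n‖ * (s : ℝ) ^ (n + 1) := by gcongr; exact hqn n
        _ = ‖p n‖ * (s : ℝ) ^ n * s := by ring
        _ ≤ C * s := by gcongr; exact hpC n
        _ ≤ C * s + ‖q 0‖ := by linarith [norm_nonneg (q 0)]
  · intro y hy
    have hyn : ‖y‖ₑ < r := by simpa [edist_zero_right] using hy
    have hsy : ∀ s ∈ Set.Icc (0 : ℝ) 1, x + s • y ∈ Metric.eball x r := by
      intro s hs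
      simp only [Metric.mem_eball, edist_eq_enorm_sub, add_sub_cancel_left]
      refine lt_of_le_of_lt ?_ hyn
      rw [enorm_smul]
      refine mul_le_of_le_one_left zero_le ?_
      rw [← enorm_one (G := ℝ)]
      rw [enorm_le_iff_norm_le]
      simpa [abs_of_nonneg hs.1] using hs.2
    let c : ℕ → 𝕜 := fun n => p n (fun _ => y) y
    have hcs : Summable fun n => ‖c n‖ := by
      have h1 := p.summable_norm_apply (x := y)
        (by simpa [edist_zero_right] using hyn.trans_le hp.r_le)
      refine Summable.of_nonneg_of_le (fun _ => norm_nonneg _) (fun n => ?_) (h1.mul_right ‖y‖)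
      exact (p n fun _ => y).le_opNorm y
    have hsum : ∀ s ∈ Set.Icc (0 : ℝ) 1,
        HasSum (fun n => s ^ n • c n) (ω (x + s • y) y) := by
      intro s hs
      have hsy' : s • y ∈ Metric.eball (0 : Pt 𝕜) r := by
        have := hsy s hs
        simpa [edist_eq_enorm_sub] using this
      have h1 := (hp.hasSum hsy').mapL (ContinuousLinearMap.apply 𝕜 𝕜 y)
      suffices e : (fun n => s ^ n • c n) =
          fun n => (ContinuousLinearMap.apply 𝕜 𝕜 y) (p n fun _ => s • y) by rw [e]; exact h1
      funext n
      have : (fun _ : Fin n => s • y) = fun _ => (s : 𝕜) • y := by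
        funext _; exact (RCLike.real_smul_eq_coe_smul (K := 𝕜) s y)
      simp only [ContinuousLinearMap.apply_apply, this]
      rw [(p n).map_smul_univ (fun _ => (s : 𝕜)) (fun _ => y)]
      simp [c, RCLike.real_smul_eq_coe_mul]
    let F : ℕ → C(ℝ, 𝕜) := fun n => ⟨fun s => s ^ n • c n, by fun_prop⟩
    have hF : Summable fun n =>
        ‖(F n).restrict (⟨Set.uIcc 0 1, isCompact_uIcc⟩ : TopologicalSpace.Compacts ℝ)‖ := by
      refine Summable.of_nonneg_of_le (fun _ => norm_nonneg _) (fun n => ?_) hcs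
      refine (ContinuousMap.norm_le _ (norm_nonneg _)).2 ?_
      rintro ⟨s, hs⟩
      have hs' : s ∈ Set.Icc (0 : ℝ) 1 := by simpa [Set.uIcc_of_le] using hs
      simp only [F, ContinuousMap.restrict_apply, ContinuousMap.coe_mk, norm_smul]
      refine mul_le_of_le_one_left (norm_nonneg _) ?_
      simpa [abs_of_nonneg hs'.1] using pow_le_one₀ hs'.1 hs'.2
    have hint := intervalIntegral.hasSum_intervalIntegral_of_summable_norm hF
    have hFTC : ∫ s in (0 : ℝ)..1, ∑' n, F n s = f (x + y) - f x := by
      have h1 : ∫ s in (0 : ℝ)..1, ∑' n, F n s = ∫ s in (0 : ℝ)..1, ω (x + s • y) y := by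
        refine intervalIntegral.integral_congr fun s hs => ?_
        exact (hsum s (by simpa [Set.uIcc_of_le] using hs)).tsum_eq
      have hder : ∀ s ∈ Set.uIcc (0 : ℝ) 1,
          HasDerivAt (fun s : ℝ => f (x + s • y)) (ω (x + s • y) y) s := by
        intro s hs
        have hs' : s ∈ Set.Icc (0 : ℝ) 1 := by simpa [Set.uIcc_of_le] using hs
        have hγ : HasDerivAt (fun s : ℝ => x + s • y) y s := by
          refine HasDerivAt.congr_deriv (((hasDerivAt_id s).smul_const y).const_add x) ?_
          simp
        exact ((hf _ (hsy s hs')).restrictScalars ℝ).comp_hasDerivAt s hγ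
      rw [h1, intervalIntegral.integral_eq_sub_of_hasDerivAt hder]
      · simp
      · refine ContinuousOn.intervalIntegrable fun s hs => ?_
        have hs' : s ∈ Set.Icc (0 : ℝ) 1 := by simpa [Set.uIcc_of_le] using hs
        have hc : ContinuousAt ω (x + s • y) :=
          (hp.analyticAt_of_mem (hsy s hs')).continuousAt
        have hγ : ContinuousAt (fun s : ℝ => x + s • y) s := by fun_prop
        have : ContinuousAt (fun s : ℝ => ω (x + s • y)) s :=
          ContinuousAt.comp (f := fun s : ℝ => x + s • y) (g := ω) hc hγ
        exact (this.clm_apply continuousAt_const).continuousWithinAt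
    rw [hFTC] at hint
    have hint' : HasSum (fun n => q (n + 1) fun _ => y) (f (x + y) - f x) := by
      suffices e : (fun n => q (n + 1) fun _ => y) = fun n => ∫ s in (0 : ℝ)..1, F n s by
        rw [e]; exact hint
      funext n
      rw [hq]
      simp only [F, ContinuousMap.coe_mk, intervalIntegral.integral_smul_const, integral_pow]
      simp [RCLike.real_smul_eq_coe_mul, c]
    rw [← hasSum_nat_add_iff' 1]
    simpa [q] using hint'

/-- Poincaré lemma for analytic one-forms on a convex open set. -/
theorem exists_analytic_primitive {D : Set (Pt 𝕜)} (hD : IsOpen D) (hc : Convex ℝ D)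
    {ω : Fin 3 → Pt 𝕜 → 𝕜} (hω : ∀ i, AnalyticOnNhd 𝕜 (ω i) D)
    (hclosed : ∀ x ∈ D, ∀ i j, pd i (ω j) x = pd j (ω i) x) :
    ∃ f : Pt 𝕜 → 𝕜, AnalyticOnNhd 𝕜 f D ∧ ∀ x ∈ D, ∀ i, pd i f x = ω i x := by
  let Ω : Pt 𝕜 → Pt 𝕜 →L[𝕜] 𝕜 := fun x => ∑ i, ω i x • ContinuousLinearMap.proj (R := 𝕜) i
  have hΩ : AnalyticOnNhd 𝕜 Ω D := by
    intro x hx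
    refine Finset.analyticAt_fun_sum _ fun i _ => ?_
    exact (hω i x hx).smul analyticAt_const
  have hΩv : ∀ x v, Ω x v = ∑ i, ω i x * v i := by
    intro x v
    simp [Ω]
  have hdΩ : ∀ x ∈ D, ∀ u v, fderiv 𝕜 Ω x u v = ∑ j, (∑ i, u i * pd i (ω j) x) * v j := by
    intro x hx u v
    have h1 : HasFDerivAt (fun y => Ω y v) ((fderiv 𝕜 Ω x).flip v) x := by
      simpa using (hΩ x hx).differentiableAt.hasFDerivAt.clm_apply (hasFDerivAt_const v x)
    have h2 : fderiv 𝕜 Ω x u v = fderiv 𝕜 (fun y => Ω y v) x u := by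
      rw [h1.fderiv]; rfl
    have h3 : (fun y => Ω y v) = fun y => ∑ j, ω j y * v j := funext fun y => hΩv y v
    rw [h2, h3, fderiv_fun_sum fun j _ => ((hω j x hx).differentiableAt.mul_const (v j))]
    simp only [_root_.sum_apply]
    refine Finset.sum_congr rfl fun j _ => ?_
    rw [fderiv_mul_const (hω j x hx).differentiableAt, _root_.smul_apply, fderiv_eq_sum_pd,
      smul_eq_mul, mul_comm]
  obtain ⟨f, hf⟩ := hc.exists_forall_hasFDerivWithinAt_of_hasFDerivWithinAt_symmetric
    (ω := Ω) (dω := fun x => (fderiv 𝕜 Ω x).restrictScalars ℝ)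
    (fun x hx => ((hΩ x hx).differentiableAt.hasFDerivAt.restrictScalars ℝ).hasFDerivWithinAt)
    (fun x hx u _ v _ => by
      simp only [ContinuousLinearMap.coe_restrictScalars']
      rw [hdΩ x hx, hdΩ x hx]
      simp only [Finset.sum_mul]
      rw [Finset.sum_comm]
      refine Finset.sum_congr rfl fun i _ => Finset.sum_congr rfl fun j _ => ?_
      rw [hclosed x hx]; ring)
  have hf' : ∀ x ∈ D, HasFDerivAt f (Ω x) x := fun x hx => (hf x hx).hasFDerivAt (hD.mem_nhds hx)
  refine ⟨f, fun x hx => analyticAt_of_hasFDerivAt (hΩ x hx) ?_, fun x hx i => ?_⟩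
  · filter_upwards [hD.mem_nhds hx] with y hy using hf' y hy
  · rw [pd, (hf' x hx).fderiv, hΩv]
    simp [Pi.single_apply]

section

/-! ### Flat linear systems with a hyperplane of known solutions -/

section flat

variable {ι : Type*}

/-- `y` is an analytic solution on `U` of the total linear system `∂ᵢ y = Φᵢ y`. -/
def IsSolution (Φ : Fin 3 → Pt 𝕜 → (ι → 𝕜) →ₗ[𝕜] (ι → 𝕜)) (U : Set (Pt 𝕜))
    (y : Pt 𝕜 → ι → 𝕜) : Prop :=
  (∀ a, AnalyticOnNhd 𝕜 (fun x => y x a) U) ∧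
    ∀ x ∈ U, ∀ i a, pd i (fun z => y z a) x = Φ i x (y x) a

/-- The system `∂ᵢ y = Φᵢ y` has a solution on `U` through every initial value in every point. -/
def IsFull (Φ : Fin 3 → Pt 𝕜 → (ι → 𝕜) →ₗ[𝕜] (ι → 𝕜)) (U : Set (Pt 𝕜)) : Prop :=
  ∀ x ∈ U, ∀ v, ∃ y, IsSolution Φ U y ∧ y x = v

variable {Φ : Fin 3 → Pt 𝕜 → (ι → 𝕜) →ₗ[𝕜] (ι → 𝕜)} {U U' D : Set (Pt 𝕜)}
  {y y' : Pt 𝕜 → ι → 𝕜}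

theorem IsSolution.mono (h : IsSolution Φ U y) (hU : U' ⊆ U) : IsSolution Φ U' y :=
  ⟨fun a => (h.1 a).mono hU, fun x hx => h.2 x (hU hx)⟩

theorem IsFull.mono (h : IsFull Φ U) (hU : U' ⊆ U) : IsFull Φ U' := fun x hx v =>
  let ⟨y, hy, hv⟩ := h x (hU hx) v
  ⟨y, hy.mono hU, hv⟩

theorem IsSolution.congr (hU : IsOpen U) (h : IsSolution Φ U y) (he : ∀ x ∈ U, y' x = y x) :
    IsSolution Φ U y' := by
  refine ⟨fun a x hx => (h.1 a x hx).congr ?_, fun x hx i a => ?_⟩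
  · filter_upwards [hU.mem_nhds hx] with z hz
    rw [he z hz]
  · rw [he x hx, ← h.2 x hx i a]
    exact pd_congr i hU (fun z hz => by rw [he z hz]) hx

theorem IsSolution.add (h : IsSolution Φ U y) (h' : IsSolution Φ U y') :
    IsSolution Φ U (fun x => y x + y' x) := by
  refine ⟨fun a x hx => (h.1 a x hx).add (h'.1 a x hx), fun x hx i a => ?_⟩
  have := pd_add i (h.1 a x hx).differentiableAt (h'.1 a x hx).differentiableAt
  simp only [Pi.add_apply, map_add, ← h.2 x hx, ← h'.2 x hx]
  exact this

theorem IsSolution.const_smul (c : 𝕜) (h : IsSolution Φ U y) :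
    IsSolution Φ U (fun x => c • y x) := by
  refine ⟨fun a x hx => analyticAt_const.mul (h.1 a x hx), fun x hx i a => ?_⟩
  have := pd_const_mul i c (h.1 a x hx).differentiableAt
  simp only [Pi.smul_apply, map_smul, smul_eq_mul, ← h.2 x hx]
  exact this

theorem isSolution_zero : IsSolution Φ U (fun _ => 0) := by
  refine ⟨fun a x hx => analyticAt_const, fun x hx i a => ?_⟩
  simp [pd]

theorem IsSolution.sum {κ : Type*} (s : Finset κ) {Y : κ → Pt 𝕜 → ι → 𝕜}
    (h : ∀ k ∈ s, IsSolution Φ U (Y k)) : IsSolution Φ U (fun x => ∑ k ∈ s, Y k x) := by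
  classical
  induction s using Finset.induction_on with
  | empty => simpa using isSolution_zero
  | insert k s hk ih =>
    simp only [Finset.sum_insert hk]
    exact (h k (Finset.mem_insert_self _ _)).add
      (ih fun j hj => h j (Finset.mem_insert_of_mem hj))

variable [Fintype ι] [DecidableEq ι]

theorem IsSolution.eqOn (hU : IsOpen U) (hc : Convex ℝ U)
    (hΦ : ∀ i v a, ContinuousOn (fun x => Φ i x v a) U) (h : IsSolution Φ U y)
    (h' : IsSolution Φ U y') {x₀ : Pt 𝕜} (hx₀ : x₀ ∈ U) (h0 : y x₀ = y' x₀) :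
    ∀ x ∈ U, y x = y' x := by
  have hs := h.add (h'.const_smul (-1))
  intro x hx
  have := eq_zero_of_linear_system hU hc Φ hΦ _ (fun a => (hs.1 a).differentiableOn)
    hs.2 hx₀ (by simp [h0]) x hx
  simpa [← sub_eq_add_neg, sub_eq_zero] using this

theorem IsFull.union (hU : IsOpen U) (hU' : IsOpen U') (hc : Convex ℝ U) (hc' : Convex ℝ U')
    (hΦ : ∀ i v a, ContinuousOn (fun x => Φ i x v a) U) (h : IsFull Φ U) (h' : IsFull Φ U')
    {z : Pt 𝕜} (hz : z ∈ U) (hz' : z ∈ U') : IsFull Φ (U ∪ U') := by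
  classical
  have main : ∀ y₁ y₂, IsSolution Φ U y₁ → IsSolution Φ U' y₂ → y₁ z = y₂ z →
      ∃ y, IsSolution Φ (U ∪ U') y ∧ (∀ x ∈ U, y x = y₁ x) ∧ ∀ x ∈ U', y x = y₂ x := by
    intro y₁ y₂ h₁ h₂ he
    have heq : ∀ x ∈ U ∩ U', y₁ x = y₂ x :=
      (h₁.mono Set.inter_subset_left).eqOn (hU.inter hU') (hc.inter hc')
        (fun i v a => (hΦ i v a).mono Set.inter_subset_left) (h₂.mono Set.inter_subset_right)
        ⟨hz, hz'⟩ he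
    let y : Pt 𝕜 → ι → 𝕜 := fun x => if x ∈ U then y₁ x else y₂ x
    have hy₁ : ∀ x ∈ U, y x = y₁ x := fun x hx => by simp [y, hx]
    have hy₂ : ∀ x ∈ U', y x = y₂ x := fun x hx => by
      by_cases hxU : x ∈ U
      · rw [hy₁ x hxU, heq x ⟨hxU, hx⟩]
      · simp [y, hxU]
    have s₁ := h₁.congr hU hy₁
    have s₂ := h₂.congr hU' hy₂
    exact ⟨y, ⟨fun a x hx => hx.elim (s₁.1 a x) (s₂.1 a x),
      fun x hx => hx.elim (s₁.2 x) (s₂.2 x)⟩, hy₁, hy₂⟩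
  intro x hx v
  rcases hx with hx | hx
  · obtain ⟨y₁, h₁, rfl⟩ := h x hx v
    obtain ⟨y₂, h₂, he⟩ := h' z hz' (y₁ z)
    obtain ⟨y, hy, e₁, -⟩ := main y₁ y₂ h₁ h₂ he.symm
    exact ⟨y, hy, e₁ x hx⟩
  · obtain ⟨y₂, h₂, rfl⟩ := h' x hx v
    obtain ⟨y₁, h₁, he⟩ := h z hz (y₂ z)
    obtain ⟨y, hy, -, e₂⟩ := main y₁ y₂ h₁ h₂ he
    exact ⟨y, hy, e₂ x hx⟩

/-- Continuation along a segment: local solvability yields solvability on a convex neighbourhood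
of a segment. -/
theorem exists_isFull_segment (hD : IsOpen D) (hc : Convex ℝ D)
    (hΦ : ∀ i v a, ContinuousOn (fun x => Φ i x v a) D)
    (hloc : ∀ x ∈ D, ∃ U, IsOpen U ∧ x ∈ U ∧ IsFull Φ U) {x₀ x₁ : Pt 𝕜} (hx₀ : x₀ ∈ D)
    (hx₁ : x₁ ∈ D) :
    ∃ U, IsOpen U ∧ Convex ℝ U ∧ U ⊆ D ∧ x₀ ∈ U ∧ x₁ ∈ U ∧ IsFull Φ U := by
  choose! N hNo hxN hNF using hloc
  have hsD : segment ℝ x₀ x₁ ⊆ D := hc.segment_subset hx₀ hx₁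
  have hcomp : IsCompact (segment ℝ x₀ x₁) := by
    rw [segment_eq_image_lineMap]
    exact isCompact_Icc.image (by fun_prop)
  obtain ⟨δ, hδ, hball⟩ := lebesgue_number_lemma_of_metric (c := fun x : D => N x ∩ D) hcomp
    (fun x => (hNo x x.2).inter hD)
    (fun x hx => Set.mem_iUnion.2 ⟨⟨x, hsD hx⟩, hxN x (hsD hx), hsD hx⟩)
  have hballF : ∀ x ∈ segment ℝ x₀ x₁, IsFull Φ (Metric.ball x δ) ∧ Metric.ball x δ ⊆ D := by
    intro x hx
    obtain ⟨z, hz⟩ := hball x hx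
    exact ⟨(hNF z z.2).mono (hz.trans Set.inter_subset_left), hz.trans Set.inter_subset_right⟩
  obtain ⟨n, hn⟩ := exists_nat_gt (dist x₀ x₁ / δ)
  have hn0 : (0 : ℝ) < n := lt_of_le_of_lt (by positivity) hn
  set γ : ℝ → Pt 𝕜 := fun r => AffineMap.lineMap x₀ x₁ r with hγ
  have hγs : ∀ k : ℕ, k ≤ n → γ (k / n) ∈ segment ℝ x₀ x₁ := by
    intro k hk
    rw [segment_eq_image_lineMap]
    exact ⟨_, ⟨by positivity, (div_le_one hn0).2 (by exact_mod_cast hk)⟩, rfl⟩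
  have hγI : ∀ r, IsCompact (γ '' Set.Icc 0 r) ∧ Convex ℝ (γ '' Set.Icc 0 r) := fun r =>
    ⟨isCompact_Icc.image (by fun_prop), (convex_Icc 0 r).affine_image _⟩
  have key : ∀ k : ℕ, k ≤ n → ∃ U, IsOpen U ∧ Convex ℝ U ∧ U ⊆ D ∧
      γ '' Set.Icc 0 (k / n : ℝ) ⊆ U ∧ IsFull Φ U := by
    intro k
    induction k with
    | zero =>
      intro _
      obtain ⟨h1, h2⟩ := hballF x₀ (left_mem_segment ℝ _ _)
      refine ⟨Metric.ball x₀ δ, Metric.isOpen_ball, convex_ball _ _, h2, ?_, h1⟩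
      simp [hγ, hδ]
    | succ k ih =>
      intro hk
      obtain ⟨U, hUo, hUc, hUD, hsU, hUF⟩ := ih (by omega)
      obtain ⟨h1, h2⟩ := hballF _ (hγs k (by omega))
      have hpU : γ (k / n) ∈ U := hsU ⟨_, ⟨by positivity, le_rfl⟩, rfl⟩
      have hF : IsFull Φ (U ∪ Metric.ball (γ (k / n)) δ) :=
        hUF.union hUo Metric.isOpen_ball hUc (convex_ball _ _)
          (fun i v a => (hΦ i v a).mono hUD) h1 hpU (Metric.mem_ball_self hδ)
      have hseg : γ '' Set.Icc 0 ((k + 1 : ℕ) / n : ℝ) ⊆ U ∪ Metric.ball (γ (k / n)) δ := by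
        rintro _ ⟨t, ht, rfl⟩
        rcases le_total t (k / n) with htk | htk
        · exact Or.inl (hsU ⟨t, ⟨ht.1, htk⟩, rfl⟩)
        · refine Or.inr ?_
          rw [Metric.mem_ball, hγ, dist_lineMap_lineMap, Real.dist_eq,
            abs_of_nonneg (sub_nonneg.2 htk)]
          have h3 : t - k / n ≤ 1 / n := by
            have := ht.2
            push_cast at this
            rw [add_div] at this
            linarith
          refine lt_of_le_of_lt (mul_le_mul_of_nonneg_right h3 dist_nonneg) ?_
          rw [div_mul_eq_mul_div, one_mul, div_lt_iff₀ hn0]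
          rw [div_lt_iff₀ hδ] at hn
          linarith
      obtain ⟨ε, hε, hthick⟩ := (hγI ((k + 1 : ℕ) / n)).1.exists_thickening_subset_open
        (hUo.union Metric.isOpen_ball) hseg
      exact ⟨Metric.thickening ε (γ '' Set.Icc 0 ((k + 1 : ℕ) / n : ℝ)), Metric.isOpen_thickening,
        (hγI _).2.thickening _, hthick.trans (Set.union_subset hUD h2),
        Metric.self_subset_thickening hε _, hF.mono hthick⟩
  obtain ⟨U, h1, h2, h3, h4, h5⟩ := key n le_rfl
  rw [div_self hn0.ne'] at h4
  exact ⟨U, h1, h2, h3, h4 ⟨0, by simp, by simp [hγ]⟩, h4 ⟨1, by simp, by simp [hγ]⟩, h5⟩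

/-- On a convex open set, local solvability of a total linear system implies global
solvability. -/
theorem isFull_of_local (hD : IsOpen D) (hc : Convex ℝ D)
    (hΦ : ∀ i v a, ContinuousOn (fun x => Φ i x v a) D)
    (hloc : ∀ x ∈ D, ∃ U, IsOpen U ∧ x ∈ U ∧ IsFull Φ U) : IsFull Φ D := by
  intro x₀ hx₀ v
  have h : ∀ x ∈ D, ∃ (U : Set (Pt 𝕜)) (y : Pt 𝕜 → ι → 𝕜), IsOpen U ∧ Convex ℝ U ∧ U ⊆ D ∧
      x₀ ∈ U ∧ x ∈ U ∧ IsSolution Φ U y ∧ y x₀ = v := by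
    intro x hx
    obtain ⟨U, h1, h2, h3, h4, h5, h6⟩ := exists_isFull_segment hD hc hΦ hloc hx₀ hx
    obtain ⟨y, hy, hv⟩ := h6 x₀ h4 v
    exact ⟨U, y, h1, h2, h3, h4, h5, hy, hv⟩
  choose! U Y hUo hUc hUD h0U hxU hY hYv using h
  have hloc' : ∀ x ∈ D, ∀ z ∈ U x, Y z z = Y x z := by
    intro x hx z hz
    have hzD := hUD x hx hz
    exact ((hY z hzD).mono Set.inter_subset_left).eqOn ((hUo z hzD).inter (hUo x hx))
      ((hUc z hzD).inter (hUc x hx))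
      (fun i v a => (hΦ i v a).mono (Set.inter_subset_left.trans (hUD z hzD)))
      ((hY x hx).mono Set.inter_subset_right) ⟨h0U z hzD, h0U x hx⟩
      ((hYv z hzD).trans (hYv x hx).symm) z ⟨hxU z hzD, hz⟩
  have hsol : ∀ x ∈ D, IsSolution Φ (U x) (fun z => Y z z) := fun x hx =>
    (hY x hx).congr (hUo x hx) (hloc' x hx)
  exact ⟨fun z => Y z z, ⟨fun a x hx => (hsol x hx).1 a x (hxU x hx),
    fun x hx => (hsol x hx).2 x (hxU x hx)⟩, hYv x₀ hx₀⟩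

end flat

end

section

section flat

theorem analyticAt_det {κ : Type*} [Fintype κ] [DecidableEq κ] {M : Pt 𝕜 → Matrix κ κ 𝕜}
    {x : Pt 𝕜} (hM : ∀ i j, AnalyticAt 𝕜 (fun z => M z i j) x) :
    AnalyticAt 𝕜 (fun z => (M z).det) x := by
  simp only [Matrix.det_apply, Units.smul_def, zsmul_eq_mul]
  exact Finset.analyticAt_fun_sum _ fun σ _ =>
    analyticAt_const.mul (Finset.analyticAt_fun_prod _ fun i _ => hM _ _)

variable {ι κ : Type*} [Fintype ι] [Fintype κ] [DecidableEq κ]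
  {Φ : Fin 3 → Pt 𝕜 → (ι → 𝕜) →ₗ[𝕜] (ι → 𝕜)} {D : Set (Pt 𝕜)}

/-- Reduction of order for a flat total linear system: if the values of known solutions span a
hyperplane, then the remaining solution is found by two quadratures. With a constant vector `n`
transversal to the known solutions `Y k`, write `Φᵢ n = μᵢ n + ∑ ν k i • Y k`; flatness makes
`μ` closed, and makes `E • ν k` closed for `E = exp ∫ μ`. If `d k` is a primitive of `E • ν k`,
then `E • n + ∑ d k • Y k` is a new solution. -/
theorem exists_isFull_of_hyperplane (e : Option κ ≃ ι) (hD : IsOpen D)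
    (hΦ : ∀ i v a, AnalyticOnNhd 𝕜 (fun x => Φ i x v a) D)
    (hflat : ∀ x ∈ D, ∀ i l v a, pd l (fun z => Φ i z v a) x + Φ i x (Φ l x v) a =
      pd i (fun z => Φ l z v a) x + Φ l x (Φ i x v) a)
    {Y : κ → Pt 𝕜 → ι → 𝕜} (hY : ∀ k, IsSolution Φ D (Y k)) {x₁ : Pt 𝕜} (hx₁ : x₁ ∈ D)
    (hind : LinearIndependent 𝕜 (fun k => Y k x₁)) :
    ∃ U, IsOpen U ∧ x₁ ∈ U ∧ IsFull Φ U := by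
  obtain ⟨n, hn⟩ : ∃ n, n ∉ Submodule.span 𝕜 (Set.range fun k => Y k x₁) := by
    by_contra! hcon
    have htop : Submodule.span 𝕜 (Set.range fun k => Y k x₁) = ⊤ :=
      Submodule.eq_top_iff'.2 hcon
    have h1 := finrank_span_eq_card hind
    rw [htop, finrank_top, Module.finrank_fintype_fun_eq_card, ← Fintype.card_congr e,
      Fintype.card_option] at h1
    omega
  let Z : Pt 𝕜 → Option κ → ι → 𝕜 := fun x c => c.elim n fun k => Y k x
  let A : Pt 𝕜 → Matrix (Option κ) (Option κ) 𝕜 := fun x => Matrix.of fun a c => Z x c (e a)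
  have hZa : ∀ x ∈ D, ∀ c a, AnalyticAt 𝕜 (fun z => Z z c a) x := by
    intro x hx c a
    cases c with
    | none => exact analyticAt_const
    | some k => exact (hY k).1 a x hx
  have hdetA : ∀ x ∈ D, AnalyticAt 𝕜 (fun z => (A z).det) x := fun x hx =>
    analyticAt_det fun a c => hZa x hx c (e a)
  have hdet₁ : (A x₁).det ≠ 0 := by
    have h1 : LinearIndependent 𝕜 (fun c => Z x₁ c) := by
      have : (fun c => Z x₁ c) = fun o => Option.casesOn' o n fun k => Y k x₁ := by
        funext o; cases o <;> rfl
      rw [this, linearIndependent_option']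
      exact ⟨hind, hn⟩
    have h2 := h1.map' (LinearEquiv.funCongrLeft 𝕜 𝕜 e).toLinearMap (LinearEquiv.ker _)
    have h3 : LinearIndependent 𝕜 (A x₁).col := h2
    exact ((Matrix.isUnit_iff_isUnit_det _).1
      (Matrix.linearIndependent_cols_iff_isUnit.1 h3)).ne_zero
  obtain ⟨r, hr, hball⟩ : ∃ r > 0, ∀ x ∈ Metric.ball x₁ r, x ∈ D ∧ (A x).det ≠ 0 := by
    have h1 : ∀ᶠ x in nhds x₁, x ∈ D ∧ (A x).det ≠ 0 :=
      (hD.eventually_mem hx₁).and ((hdetA x₁ hx₁).continuousAt.eventually_ne hdet₁)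
    exact Metric.eventually_nhds_iff_ball.1 h1
  set U := Metric.ball x₁ r with hU
  have hUo : IsOpen U := Metric.isOpen_ball
  have hUc : Convex ℝ U := convex_ball _ _
  have hUD : U ⊆ D := fun x hx => (hball x hx).1
  -- coordinates with respect to the frame `Z`, by Cramer's rule
  let w : Pt 𝕜 → (ι → 𝕜) → Option κ → 𝕜 := fun x v c =>
    ((A x).det)⁻¹ * (A x).cramer (fun a => v (e a)) c
  have hw : ∀ x ∈ U, ∀ v a, ∑ c, w x v c * Z x c a = v a := by
    intro x hx v a
    have h1 := congrFun (Matrix.mulVec_cramer (A x) fun a => v (e a)) (e.symm a)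
    simp only [Matrix.mulVec, dotProduct, A, Matrix.of_apply, Equiv.apply_symm_apply,
      Pi.smul_apply, smul_eq_mul] at h1
    have h2 : ∑ c, w x v c * Z x c a = ((A x).det)⁻¹ *
        ∑ c, Z x c a * (A x).cramer (fun a => v (e a)) c := by
      rw [Finset.mul_sum]
      exact Finset.sum_congr rfl fun c _ => by simp only [w]; ring
    rw [h2]
    erw [h1]
    rw [← mul_assoc, inv_mul_cancel₀ (hball x hx).2, one_mul]
  have hindU : ∀ x ∈ U, ∀ q : Option κ → 𝕜, (∀ a, ∑ c, q c * Z x c a = 0) → q = 0 := by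
    intro x hx q hq
    refine Matrix.eq_zero_of_mulVec_eq_zero (hball x hx).2 (funext fun a => ?_)
    simp only [Matrix.mulVec, dotProduct, A, Matrix.of_apply, Pi.zero_apply]
    rw [← hq (e a)]
    exact Finset.sum_congr rfl fun c _ => mul_comm _ _
  let W : Fin 3 → Option κ → Pt 𝕜 → 𝕜 := fun i c x => w x (Φ i x n) c
  have hWa : ∀ i c, AnalyticOnNhd 𝕜 (W i c) U := by
    intro i c x hx
    refine ((hdetA x (hUD hx)).inv (hball x hx).2).mul ?_
    simp only [Matrix.cramer_apply]
    refine analyticAt_det fun a c' => ?_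
    by_cases hc : c' = c
    · subst hc
      simpa [Matrix.updateCol_apply] using hΦ i n (e a) x (hUD hx)
    · simpa [Matrix.updateCol_apply, hc, A] using hZa x (hUD hx) c' (e a)
  have hWd : ∀ x ∈ U, ∀ i c, DifferentiableAt 𝕜 (W i c) x := fun x hx i c =>
    (hWa i c x hx).differentiableAt
  have hWΦ : ∀ x ∈ U, ∀ i, Φ i x n = W i none x • n + ∑ k, W i (some k) x • Y k x := by
    intro x hx i
    funext a
    rw [← hw x hx (Φ i x n) a, Fintype.sum_option]
    simp [Z, W]
  -- the structure equations
  have hstruct : ∀ x ∈ U, ∀ i l,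
      pd l (W i none) x = pd i (W l none) x ∧ ∀ k,
      pd l (W i (some k)) x + W l none x * W i (some k) x =
        pd i (W l (some k)) x + W i none x * W l (some k) x := by
    intro x hx i l
    have hder : ∀ i l a, pd l (fun z => Φ i z n a) x = pd l (W i none) x * n a +
        ∑ k, (pd l (W i (some k)) x * Y k x a + W i (some k) x * Φ l x (Y k x) a) := by
      intro i l a
      have h1 : pd l (fun z => Φ i z n a) x =
          pd l (fun z => W i none z * n a + ∑ k, W i (some k) z * Y k z a) x := by
        refine pd_congr l hUo (fun z hz => ?_) hx
        conv_lhs => rw [hWΦ z hz i]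
        simp
      have hYd : ∀ k, DifferentiableAt 𝕜 (fun z => Y k z a) x := fun k =>
        ((hY k).1 a x (hUD hx)).differentiableAt
      rw [h1, pd_add l ((hWd x hx _ _).mul_const _)
        (DifferentiableAt.fun_sum fun k _ => (hWd x hx _ _).fun_mul (hYd k)),
        pd_mul l (hWd x hx _ _) (differentiableAt_const _), pd_const,
        pd_sum _ _ fun k _ => (hWd x hx _ _).fun_mul (hYd k)]
      simp only [mul_zero, add_zero]
      congr 1
      refine Finset.sum_congr rfl fun k _ => ?_
      rw [pd_mul l (hWd x hx _ _) (hYd k), (hY k).2 x (hUD hx)]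
    have hΦΦ : ∀ i l a, Φ i x (Φ l x n) a = W l none x * Φ i x n a +
        ∑ k, W l (some k) x * Φ i x (Y k x) a := by
      intro i l a
      conv_lhs => rw [hWΦ x hx l]
      simp
    have hΦa : ∀ i a, Φ i x n a = W i none x * n a + ∑ k, W i (some k) x * Y k x a := by
      intro i a
      conv_lhs => rw [hWΦ x hx i]
      simp
    have hq := hindU x hx (fun c => c.elim (pd l (W i none) x - pd i (W l none) x) fun k =>
      pd l (W i (some k)) x + W l none x * W i (some k) x -
        (pd i (W l (some k)) x + W i none x * W l (some k) x)) ?_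
    · refine ⟨sub_eq_zero.1 (congrFun hq none), fun k => sub_eq_zero.1 (congrFun hq (some k))⟩
    · intro a
      have h1 := hflat x (hUD hx) i l n a
      rw [hder, hder, hΦΦ, hΦΦ, hΦa, hΦa] at h1
      rw [Fintype.sum_option]
      simp only [Option.elim_none, Option.elim_some, Z, sub_mul, add_mul, Finset.sum_sub_distrib,
        Finset.sum_add_distrib, mul_assoc]
      simp only [Finset.sum_add_distrib, mul_add, Finset.mul_sum] at h1
      linear_combination h1
  obtain ⟨g, hga, hg⟩ := exists_analytic_primitive hUo hUc (fun i => hWa i none)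
    (fun x hx i j => (hstruct x hx j i).1)
  let E : Pt 𝕜 → 𝕜 := fun x => NormedSpace.exp (g x)
  have hEa : AnalyticOnNhd 𝕜 E U := fun x hx =>
    (NormedSpace.exp_analytic (𝕂 := 𝕜) (g x)).comp (hga x hx)
  have hE0 : ∀ x, E x ≠ 0 := fun x => (NormedSpace.isUnit_exp (g x)).ne_zero
  have hE : ∀ x ∈ U, ∀ i, pd i E x = E x * W i none x := by
    intro x hx i
    have h1 : HasFDerivAt E (NormedSpace.exp (g x) • fderiv 𝕜 g x) x :=
      (hasDerivAt_exp (𝕂 := 𝕜)).comp_hasFDerivAt x (hga x hx).differentiableAt.hasFDerivAt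
    rw [pd, h1.fderiv, _root_.smul_apply, smul_eq_mul]
    change E x * pd i g x = _
    rw [hg x hx]
  have hclosed : ∀ k, ∀ x ∈ U, ∀ i j, pd i (fun z => E z * W j (some k) z) x =
      pd j (fun z => E z * W i (some k) z) x := by
    intro k x hx i j
    rw [pd_mul i (hEa x hx).differentiableAt (hWd x hx _ _),
      pd_mul j (hEa x hx).differentiableAt (hWd x hx _ _), hE x hx, hE x hx]
    linear_combination E x * (hstruct x hx j i).2 k
  choose d hda hd using fun k => exists_analytic_primitive hUo hUc
    (fun i => (fun x hx => (hEa x hx).fun_mul (hWa i (some k) x hx) :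
      AnalyticOnNhd 𝕜 (fun z => E z * W i (some k) z) U)) (hclosed k)
  have hsol : IsSolution Φ U (fun x => E x • n + ∑ k, d k x • Y k x) := by
    refine ⟨fun a x hx => ?_, fun x hx i a => ?_⟩
    · simp only [Pi.add_apply, Pi.smul_apply, Finset.sum_apply, smul_eq_mul]
      exact ((hEa x hx).mul analyticAt_const).add (Finset.analyticAt_fun_sum _ fun k _ =>
        (hda k x hx).mul ((hY k).1 a x (hUD hx)))
    · have hYd : ∀ k, DifferentiableAt 𝕜 (fun z => Y k z a) x := fun k =>
        ((hY k).1 a x (hUD hx)).differentiableAt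
      have hdd : ∀ k, DifferentiableAt 𝕜 (d k) x := fun k => (hda k x hx).differentiableAt
      simp only [Pi.add_apply, Pi.smul_apply, Finset.sum_apply, smul_eq_mul, map_add, map_smul,
        map_sum]
      rw [pd_add i ((hEa x hx).differentiableAt.mul_const _)
        (DifferentiableAt.fun_sum fun k _ => (hdd k).fun_mul (hYd k)),
        pd_mul i (hEa x hx).differentiableAt (differentiableAt_const _), pd_const, hE x hx,
        pd_sum _ _ fun k _ => (hdd k).fun_mul (hYd k)]
      conv_rhs => rw [hWΦ x hx i]
      simp only [pd_mul i (hdd _) (hYd _), hd _ x hx, (hY _).2 x (hUD hx), Pi.add_apply,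
        Pi.smul_apply, Finset.sum_apply, smul_eq_mul, Finset.sum_add_distrib, mul_add,
        Finset.mul_sum, mul_assoc]
      ring
  refine ⟨U, hUo, Metric.mem_ball_self hr, fun x hx v => ?_⟩
  let c := w x v
  refine ⟨fun z => (c none / E x) • (E z • n + ∑ k, d k z • Y k z) +
    ∑ k, (c (some k) - c none / E x * d k x) • Y k z,
    (hsol.const_smul _).add (IsSolution.sum _ fun k _ => ((hY k).mono hUD).const_smul _), ?_⟩
  funext a
  have h1 := hw x hx v a
  rw [Fintype.sum_option] at h1
  simp only [Z, Option.elim_none, Option.elim_some] at h1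
  rw [← h1]
  simp only [Pi.add_apply, Pi.smul_apply, Finset.sum_apply, smul_eq_mul, sub_mul,
    Finset.sum_sub_distrib, mul_add, Finset.mul_sum, mul_assoc]
  have := hE0 x
  simp only [c]
  field_simp
  ring

end flat

end

section

/-! ### The Jacobi identity for the Poisson bracket -/

/-- Partial derivative of a phase space function in a position coordinate. -/
def pdx (j : Fin 3) (F : Pt 𝕜 → Pt 𝕜 → 𝕜) (x p : Pt 𝕜) : 𝕜 := pd j (fun y => F y p) x

/-- Partial derivative of a phase space function in a momentum coordinate. -/
def pdp (j : Fin 3) (F : Pt 𝕜 → Pt 𝕜 → 𝕜) (x p : Pt 𝕜) : 𝕜 := pd j (fun q => F x q) p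

/-- Joint analyticity of a phase space function over `D`. -/
def PhaseAnalytic (D : Set (Pt 𝕜)) (F : Pt 𝕜 → Pt 𝕜 → 𝕜) : Prop :=
  ∀ x ∈ D, ∀ p, AnalyticAt 𝕜 (fun z : Pt 𝕜 × Pt 𝕜 => F z.1 z.2) (x, p)

variable {D : Set (Pt 𝕜)} {F G H : Pt 𝕜 → Pt 𝕜 → 𝕜}

theorem hasFDerivAt_slice_left {f : Pt 𝕜 × Pt 𝕜 → 𝕜} {x p : Pt 𝕜}
    (hf : DifferentiableAt 𝕜 f (x, p)) :
    HasFDerivAt (fun y => f (y, p))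
      ((fderiv 𝕜 f (x, p)).comp (ContinuousLinearMap.inl 𝕜 (Pt 𝕜) (Pt 𝕜))) x :=
  hf.hasFDerivAt.comp x (hasFDerivAt_prodMk_left x p)

theorem hasFDerivAt_slice_right {f : Pt 𝕜 × Pt 𝕜 → 𝕜} {x p : Pt 𝕜}
    (hf : DifferentiableAt 𝕜 f (x, p)) :
    HasFDerivAt (fun q => f (x, q))
      ((fderiv 𝕜 f (x, p)).comp (ContinuousLinearMap.inr 𝕜 (Pt 𝕜) (Pt 𝕜))) p :=
  hf.hasFDerivAt.comp p (hasFDerivAt_prodMk_right x p)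

theorem PhaseAnalytic.diffx (hF : PhaseAnalytic D F) {x : Pt 𝕜} (hx : x ∈ D) (p : Pt 𝕜) :
    DifferentiableAt 𝕜 (fun y => F y p) x :=
  (hasFDerivAt_slice_left (f := fun z => F z.1 z.2)
    (hF x hx p).differentiableAt).differentiableAt

theorem PhaseAnalytic.diffp (hF : PhaseAnalytic D F) {x : Pt 𝕜} (hx : x ∈ D) (p : Pt 𝕜) :
    DifferentiableAt 𝕜 (fun q => F x q) p :=
  (hasFDerivAt_slice_right (f := fun z => F z.1 z.2)
    (hF x hx p).differentiableAt).differentiableAt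

theorem PhaseAnalytic.pdx_eq (hF : PhaseAnalytic D F) (j : Fin 3) {x : Pt 𝕜} (hx : x ∈ D)
    (p : Pt 𝕜) : pdx j F x p =
      fderiv 𝕜 (fun z : Pt 𝕜 × Pt 𝕜 => F z.1 z.2) (x, p) (Pi.single j 1, 0) := by
  rw [pdx, pd, (hasFDerivAt_slice_left (f := fun z => F z.1 z.2)
    (hF x hx p).differentiableAt).fderiv]
  simp

theorem PhaseAnalytic.pdp_eq (hF : PhaseAnalytic D F) (j : Fin 3) {x : Pt 𝕜} (hx : x ∈ D)
    (p : Pt 𝕜) : pdp j F x p =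
      fderiv 𝕜 (fun z : Pt 𝕜 × Pt 𝕜 => F z.1 z.2) (x, p) (0, Pi.single j 1) := by
  rw [pdp, pd, (hasFDerivAt_slice_right (f := fun z => F z.1 z.2)
    (hF x hx p).differentiableAt).fderiv]
  simp

theorem eventually_fst_mem (hD : IsOpen D) {x : Pt 𝕜} (hx : x ∈ D) (p : Pt 𝕜) :
    ∀ᶠ z : Pt 𝕜 × Pt 𝕜 in nhds (x, p), z.1 ∈ D :=
  (hD.preimage continuous_fst).mem_nhds hx

theorem PhaseAnalytic.pdx (hD : IsOpen D) (hF : PhaseAnalytic D F) (j : Fin 3) :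
    PhaseAnalytic D (pdx j F) := by
  intro x hx p
  refine AnalyticAt.congr (((ContinuousLinearMap.apply 𝕜 𝕜
    ((Pi.single j (1 : 𝕜), 0) : Pt 𝕜 × Pt 𝕜)).analyticAt _).comp (hF x hx p).fderiv) ?_
  filter_upwards [eventually_fst_mem hD hx p] with z hz
  exact (hF.pdx_eq j hz z.2).symm

theorem PhaseAnalytic.pdp (hD : IsOpen D) (hF : PhaseAnalytic D F) (j : Fin 3) :
    PhaseAnalytic D (pdp j F) := by
  intro x hx p
  refine AnalyticAt.congr (((ContinuousLinearMap.apply 𝕜 𝕜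
    ((0, Pi.single j (1 : 𝕜)) : Pt 𝕜 × Pt 𝕜)).analyticAt _).comp (hF x hx p).fderiv) ?_
  filter_upwards [eventually_fst_mem hD hx p] with z hz
  exact (hF.pdp_eq j hz z.2).symm

theorem PhaseAnalytic.fderiv_fderiv (hD : IsOpen D) (hF : PhaseAnalytic D F)
    {x : Pt 𝕜} (hx : x ∈ D) (p : Pt 𝕜) (v : Pt 𝕜 × Pt 𝕜)
    (h : ∀ y ∈ D, ∀ q, G y q = fderiv 𝕜 (fun z : Pt 𝕜 × Pt 𝕜 => F z.1 z.2) (y, q) v) :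
    fderiv 𝕜 (fun z : Pt 𝕜 × Pt 𝕜 => G z.1 z.2) (x, p) =
      (fderiv 𝕜 (fderiv 𝕜 fun z : Pt 𝕜 × Pt 𝕜 => F z.1 z.2) (x, p)).flip v := by
  have he : (fun z : Pt 𝕜 × Pt 𝕜 => G z.1 z.2) =ᶠ[nhds (x, p)]
      fun z => fderiv 𝕜 (fun z : Pt 𝕜 × Pt 𝕜 => F z.1 z.2) z v := by
    filter_upwards [eventually_fst_mem hD hx p] with z hz using h z.1 hz z.2
  rw [he.fderiv_eq]
  have := (hF x hx p).fderiv.differentiableAt.hasFDerivAt.clm_apply (hasFDerivAt_const v (x, p))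
  rw [this.fderiv]
  simp

theorem PhaseAnalytic.comm (hD : IsOpen D) (hF : PhaseAnalytic D F) {x : Pt 𝕜} (hx : x ∈ D)
    (p : Pt 𝕜) (i j : Fin 3) :
    Superintegrable.pdx i (Superintegrable.pdx j F) x p =
        Superintegrable.pdx j (Superintegrable.pdx i F) x p ∧
      Superintegrable.pdp i (Superintegrable.pdp j F) x p =
        Superintegrable.pdp j (Superintegrable.pdp i F) x p ∧
      Superintegrable.pdp i (Superintegrable.pdx j F) x p =
        Superintegrable.pdx j (Superintegrable.pdp i F) x p := by
  have hs : IsSymmSndFDerivAt 𝕜 (fun z : Pt 𝕜 × Pt 𝕜 => F z.1 z.2) (x, p) :=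
    (hF x hx p).contDiffAt.isSymmSndFDerivAt_of_omega
  have ex := fun k => hF.fderiv_fderiv hD hx p _
    (fun y hy q => hF.pdx_eq k hy q)
  have ep := fun k => hF.fderiv_fderiv hD hx p _
    (fun y hy q => hF.pdp_eq k hy q)
  refine ⟨?_, ?_, ?_⟩
  · rw [(hF.pdx hD j).pdx_eq i hx p, (hF.pdx hD i).pdx_eq j hx p, ex, ex]
    exact hs _ _
  · rw [(hF.pdp hD j).pdp_eq i hx p, (hF.pdp hD i).pdp_eq j hx p, ep, ep]
    exact hs _ _
  · rw [(hF.pdx hD j).pdp_eq i hx p, (hF.pdp hD i).pdx_eq j hx p, ex, ep]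
    exact hs _ _

theorem poissonBracket_eq (F G : Pt 𝕜 → Pt 𝕜 → 𝕜) :
    poissonBracket F G = fun x p => ∑ j, (pdx j F x p * pdp j G x p - pdp j F x p * pdx j G x p) :=
  rfl

theorem pdx_poissonBracket (hD : IsOpen D) (hF : PhaseAnalytic D F) (hG : PhaseAnalytic D G)
    {x : Pt 𝕜} (hx : x ∈ D) (p : Pt 𝕜) (i : Fin 3) :
    pdx i (poissonBracket F G) x p = ∑ j, (pdx i (pdx j F) x p * pdp j G x p +
      pdx j F x p * pdx i (pdp j G) x p - (pdx i (pdp j F) x p * pdx j G x p +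
        pdp j F x p * pdx i (pdx j G) x p)) := by
  have hxF := fun j => (hF.pdx hD j).diffx hx p
  have hpF := fun j => (hF.pdp hD j).diffx hx p
  have hxG := fun j => (hG.pdx hD j).diffx hx p
  have hpG := fun j => (hG.pdp hD j).diffx hx p
  rw [poissonBracket_eq]
  change pd i (fun y => ∑ j, (pdx j F y p * pdp j G y p - pdp j F y p * pdx j G y p)) x = _
  rw [pd_sum _ _ fun j _ => ((hxF j).fun_mul (hpG j)).fun_sub ((hpF j).fun_mul (hxG j))]
  refine Finset.sum_congr rfl fun j _ => ?_
  rw [pd_sub _ ((hxF j).fun_mul (hpG j)) ((hpF j).fun_mul (hxG j)), pd_mul _ (hxF j) (hpG j),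
    pd_mul _ (hpF j) (hxG j)]
  rfl

theorem pdp_poissonBracket (hD : IsOpen D) (hF : PhaseAnalytic D F) (hG : PhaseAnalytic D G)
    {x : Pt 𝕜} (hx : x ∈ D) (p : Pt 𝕜) (i : Fin 3) :
    pdp i (poissonBracket F G) x p = ∑ j, (pdp i (pdx j F) x p * pdp j G x p +
      pdx j F x p * pdp i (pdp j G) x p - (pdp i (pdp j F) x p * pdx j G x p +
        pdp j F x p * pdp i (pdx j G) x p)) := by
  have hxF := fun j => (hF.pdx hD j).diffp hx p
  have hpF := fun j => (hF.pdp hD j).diffp hx p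
  have hxG := fun j => (hG.pdx hD j).diffp hx p
  have hpG := fun j => (hG.pdp hD j).diffp hx p
  rw [poissonBracket_eq]
  change pd i (fun q => ∑ j, (pdx j F x q * pdp j G x q - pdp j F x q * pdx j G x q)) p = _
  rw [pd_sum _ _ fun j _ => ((hxF j).fun_mul (hpG j)).fun_sub ((hpF j).fun_mul (hxG j))]
  refine Finset.sum_congr rfl fun j _ => ?_
  rw [pd_sub _ ((hxF j).fun_mul (hpG j)) ((hpF j).fun_mul (hxG j)), pd_mul _ (hxF j) (hpG j),
    pd_mul _ (hpF j) (hxG j)]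
  rfl

theorem poissonBracket_jacobi (hD : IsOpen D) (hF : PhaseAnalytic D F) (hG : PhaseAnalytic D G)
    (hH : PhaseAnalytic D H) {x : Pt 𝕜} (hx : x ∈ D) (p : Pt 𝕜) :
    poissonBracket F (poissonBracket G H) x p + poissonBracket G (poissonBracket H F) x p +
      poissonBracket H (poissonBracket F G) x p = 0 := by
  have hGH := poissonBracket_eq F (poissonBracket G H)
  have hHF := poissonBracket_eq G (poissonBracket H F)
  have hFG := poissonBracket_eq H (poissonBracket F G)
  rw [hGH, hHF, hFG]
  simp only [pdx_poissonBracket hD hG hH hx, pdx_poissonBracket hD hH hF hx,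
    pdx_poissonBracket hD hF hG hx, pdp_poissonBracket hD hG hH hx,
    pdp_poissonBracket hD hH hF hx, pdp_poissonBracket hD hF hG hx,
    fun i j => (hF.comm hD hx p i j).2.2, fun i j => (hG.comm hD hx p i j).2.2,
    fun i j => (hH.comm hD hx p i j).2.2, Finset.mul_sum, ← Finset.sum_sub_distrib]
  -- symmetrise the double sums over the two bracket indices
  have swap : ∀ f : Fin 3 → Fin 3 → 𝕜, (∑ i, ∑ j, (f i j + f j i)) = 0 → ∑ i, ∑ j, f i j = 0 := by
    intro f hf
    have h1 : ∑ i, ∑ j, f j i = ∑ i, ∑ j, f i j := Finset.sum_comm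
    simp only [Finset.sum_add_distrib, h1] at hf
    exact add_self_eq_zero.1 hf
  simp only [← Finset.sum_add_distrib]
  refine swap _ (Finset.sum_eq_zero fun i _ => Finset.sum_eq_zero fun j _ => ?_)
  rw [(hF.comm hD hx p j i).1, (hG.comm hD hx p j i).1, (hH.comm hD hx p j i).1,
    (hF.comm hD hx p j i).2.1, (hG.comm hD hx p j i).2.1, (hH.comm hD hx p j i).2.1]
  ring

/-- Poisson's theorem: the bracket of two constants of the motion is a constant of the motion. -/
theorem poissonBracket_poissonBracket_eq_zero (hD : IsOpen D) (hF : PhaseAnalytic D F)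
    (hG : PhaseAnalytic D G) (hH : PhaseAnalytic D H)
    (h1 : ∀ x ∈ D, ∀ p, poissonBracket F G x p = 0)
    (h2 : ∀ x ∈ D, ∀ p, poissonBracket F H x p = 0) {x : Pt 𝕜} (hx : x ∈ D) (p : Pt 𝕜) :
    poissonBracket F (poissonBracket G H) x p = 0 := by
  have zero : ∀ K M : Pt 𝕜 → Pt 𝕜 → 𝕜, (∀ x ∈ D, ∀ p, M x p = 0) →
      poissonBracket K M x p = 0 := by
    intro K M hM
    refine Finset.sum_eq_zero fun j _ => ?_
    have e1 : pd j (fun y => M y p) x = 0 := by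
      rw [pd_congr j (g := fun _ => 0) hD (fun y hy => hM y hy p) hx, pd_const]
    have e2 : pd j (fun q => M x q) p = 0 := by
      rw [funext (hM x hx), pd_const]
    rw [e1, e2]; ring
  have hanti : ∀ x ∈ D, ∀ p, poissonBracket H F x p = 0 := by
    intro x hx p
    rw [← neg_eq_zero, ← h2 x hx p, poissonBracket, poissonBracket, ← Finset.sum_neg_distrib]
    exact Finset.sum_congr rfl fun j _ => by ring
  have := poissonBracket_jacobi hD hF hG hH hx p
  rw [zero G _ hanti, zero H _ h1] at this
  simpa using this

end

section

/-! ### The structure tensor of a nondegenerate potential -/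

/-- `T` is the structure tensor of `S`: it is symmetric and trace-free in its first two indices,
and the potentials are the solutions of `∂ᵢ∂ⱼ V = δᵢⱼ h + ∑ₖ Tᵢⱼₖ ∂ₖ V`, in which `V`, `∂V` and `h`
can be prescribed at every point. -/
structure System.IsStructureTensor (S : System 𝕜) (T : Fin 3 → Fin 3 → Fin 3 → Pt 𝕜 → 𝕜) :
    Prop where
  analytic : ∀ i j k, AnalyticOnNhd 𝕜 (T i j k) S.domain
  symm : ∀ i j k x, T i j k x = T j i k x
  trace : ∀ k x, ∑ i, T i i k x = 0
  mem_pot_iff : ∀ V : Pt 𝕜 → 𝕜, V ∈ S.pot ↔ AnalyticOnNhd 𝕜 V S.domain ∧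
    ∀ x ∈ S.domain, ∃ h, ∀ i j, pd i (pd j V) x =
      (if i = j then h else 0) + ∑ k, T i j k x * pd k V x
  exists_jet : ∀ x ∈ S.domain, ∀ (c : 𝕜) (g : Fin 3 → 𝕜) (h : 𝕜), ∃ V ∈ S.pot, V x = c ∧
    (∀ i, pd i V x = g i) ∧
    ∀ i j, pd i (pd j V) x = (if i = j then h else 0) + ∑ k, T i j k x * g k

/-- The five equations for the second derivatives of the potentials fix the Hessian up to a multiple
of the identity as a linear function of the gradient. -/
theorem System.IsNondegenerate.exists_structureTensor {S : System 𝕜} (hS : S.IsNondegenerate) :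
    ∃ T, S.IsStructureTensor T := by
  obtain ⟨A, B, C, han, hpot, hjet⟩ := hS
  let X : Fin 3 → Fin 3 → Fin 3 → Pt 𝕜 → 𝕜 := fun i j k => ![A i j, B i j, C i j] k
  have hX : ∀ i j k, AnalyticOnNhd 𝕜 (X i j k) S.domain := by
    intro i j k
    fin_cases k
    exacts [(han i j).1, (han i j).2.1, (han i j).2.2]
  -- `V₀₀` is traded for a third of the Laplacian, which makes the tensor trace-free
  let T : Fin 3 → Fin 3 → Fin 3 → Pt 𝕜 → 𝕜 := fun i j k x =>
    if i = j then (if i = 0 then 0 else X i i k x) - (X 1 1 k x + X 2 2 k x) / 3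
    else X (min i j) (max i j) k x
  have hT : ∀ x (g : Fin 3 → 𝕜) (M : Fin 3 → Fin 3 → 𝕜) (h₀ : 𝕜), (∀ i j, M i j = M j i) →
      M 0 0 = h₀ →
      (∀ i : Fin 3, i ≠ 0 → M i i = h₀ + A i i x * g 0 + B i i x * g 1 + C i i x * g 2) →
      (∀ i j : Fin 3, i < j → M i j = A i j x * g 0 + B i j x * g 1 + C i j x * g 2) →
      ∀ i j, M i j = (if i = j then h₀ + ∑ k, (X 1 1 k x + X 2 2 k x) / 3 * g k else 0) +
        ∑ k, T i j k x * g k := by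
    intro x g M h₀ hsym h00 hd ho i j
    have h1 := hd 1 (by decide)
    have h2 := hd 2 (by decide)
    have h3 := ho 0 1 (by decide)
    have h4 := ho 0 2 (by decide)
    have h5 := ho 1 2 (by decide)
    have h6 := hsym 1 0
    have h7 := hsym 2 0
    have h8 := hsym 2 1
    fin_cases i <;> fin_cases j <;>
      simp [T, X, Fin.sum_univ_three, h00, h1, h2, h3, h4, h5, h6, h7, h8] <;> ring
  refine ⟨T, ⟨?_, ?_, ?_, ?_, ?_⟩⟩
  · intro i j k x hx
    simp only [T]
    split_ifs with h1 h2
    · exact analyticAt_const.fun_sub (((hX _ _ _ x hx).fun_add (hX _ _ _ x hx)).fun_div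
        analyticAt_const (by norm_num))
    · exact (hX _ _ _ x hx).fun_sub (((hX _ _ _ x hx).fun_add (hX _ _ _ x hx)).fun_div
        analyticAt_const (by norm_num))
    · exact hX _ _ _ x hx
  · intro i j k x
    by_cases h : i = j
    · rw [h]
    · simp only [T, if_neg h, if_neg (Ne.symm h), min_comm, max_comm]
  · intro k x
    simp [T, Fin.sum_univ_three]
    ring
  · intro V
    rw [hpot]
    refine and_congr_right fun hV => forall₂_congr fun x hx => ⟨fun h => ?_, ?_⟩
    · exact ⟨_, hT x (fun k => pd k V x) (fun i j => pd i (pd j V) x) _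
        (fun i j => pd_comm i j (hV x hx)) rfl h.1 h.2⟩
    · rintro ⟨h, hh⟩
      have h00 := hh 0 0
      refine ⟨fun i hi => ?_, fun i j hij => ?_⟩
      · have hii := hh i i
        fin_cases i
        · exact absurd rfl hi
        all_goals
          simp [T, X, Fin.sum_univ_three] at h00 hii ⊢
          linear_combination hii - h00
      · have hij' := hh i j
        simp only [T, if_neg hij.ne, min_eq_left hij.le, max_eq_right hij.le, zero_add,
          Fin.sum_univ_three] at hij'
        simpa [X] using hij'
  · intro x hx c g h
    obtain ⟨V, hV, hc, hg, h00⟩ := hjet x hx c g (h - ∑ k, (X 1 1 k x + X 2 2 k x) / 3 * g k)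
    refine ⟨V, hV, hc, hg, fun i j => ?_⟩
    obtain ⟨hVa, hVe⟩ := (hpot V).1 hV
    have := hT x g (fun i j => pd i (pd j V) x) _ (fun i j => pd_comm i j (hVa x hx)) h00
      (by simpa only [h00, hg] using (hVe x hx).1) (by simpa only [hg] using (hVe x hx).2) i j
    rw [this, sub_add_cancel]

namespace System.IsStructureTensor

variable {S : System 𝕜} {T : Fin 3 → Fin 3 → Fin 3 → Pt 𝕜 → 𝕜}

/-- The coefficients of `∂V` in the third derivatives of a potential `V`. -/
def jetCoeff (T : Fin 3 → Fin 3 → Fin 3 → Pt 𝕜 → 𝕜) (i j m k : Fin 3) (x : Pt 𝕜) : 𝕜 :=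
  pd k (T i j m) x + ∑ l, T i j l x * T l k m x

theorem pd_pd_pd (hT : S.IsStructureTensor T) (hD : IsOpen S.domain) {V : Pt 𝕜 → 𝕜}
    (hV : V ∈ S.pot) {x : Pt 𝕜} (hx : x ∈ S.domain) {h : 𝕜}
    (hh : ∀ i j, pd i (pd j V) x = (if i = j then h else 0) + ∑ k, T i j k x * pd k V x) :
    ∃ η : Fin 3 → 𝕜, ∀ i j k, pd k (pd i (pd j V)) x = (if i = j then η k else 0) +
      T i j k x * h + ∑ m, jetCoeff T i j m k x * pd m V x := by
  obtain ⟨hVa, hVe⟩ := (hT.mem_pot_iff V).1 hV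
  choose! H hH using hVe
  have hHeq : ∀ y ∈ S.domain, H y = (∑ i, pd i (pd i V) y) / 3 := by
    intro y hy
    have h0 := hT.trace 0 y
    have h1 := hT.trace 1 y
    have h2 := hT.trace 2 y
    simp only [Fin.sum_univ_three] at h0 h1 h2
    simp only [Fin.sum_univ_three, hH y hy, if_true]
    linear_combination -(pd 0 V y / 3) * h0 - (pd 1 V y / 3) * h1 - (pd 2 V y / 3) * h2
  have hHd : DifferentiableAt 𝕜 H x := by
    have h1 : DifferentiableAt 𝕜 (fun y => (∑ i, pd i (pd i V) y) / 3) x := by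
      have := fun i => (analyticAt_pd i (analyticAt_pd i (hVa x hx))).differentiableAt
      fun_prop
    refine h1.congr_of_eventuallyEq ?_
    filter_upwards [hD.mem_nhds hx] with y hy using hHeq y hy
  have hTd := fun i j k => (hT.analytic i j k x hx).differentiableAt
  have hVd := fun k => (analyticAt_pd k (hVa x hx)).differentiableAt
  refine ⟨fun k => pd k H x, fun i j k => ?_⟩
  have hprod : ∀ m ∈ Finset.univ, DifferentiableAt 𝕜 (fun y => T i j m y * pd m V y) x :=
    fun m _ => (hTd i j m).fun_mul (hVd m)
  have e1 : pd k (pd i (pd j V)) x =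
      pd k (fun y => (if i = j then H y else 0) + ∑ m, T i j m y * pd m V y) x :=
    pd_congr k hD (fun y hy => hH y hy i j) hx
  have e2 : DifferentiableAt 𝕜 (fun y => if i = j then H y else 0) x := by
    split_ifs
    exacts [hHd, differentiableAt_const _]
  have e3 : pd k (fun y => if i = j then H y else 0) x = if i = j then pd k H x else 0 := by
    split_ifs
    exacts [rfl, pd_const _ _ _]
  rw [e1, pd_add k e2 (DifferentiableAt.fun_sum hprod), e3, pd_sum _ _ hprod, add_assoc]
  congr 1
  simp only [fun m => pd_mul k (hTd i j m) (hVd m)]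
  have e4 : ∀ m, pd k (pd m V) x = (if k = m then h else 0) + ∑ l, T k m l x * pd l V x :=
    fun m => hh k m
  simp only [e4, jetCoeff, Fin.sum_univ_three]
  fin_cases k <;> simp [hT.symm 1 0, hT.symm 2 0, hT.symm 2 1] <;> ring

/-- The integrability conditions of the potential equations: the part of `T` antisymmetric in the
last two indices is a pure trace, and so is the corresponding part of its derivative. -/
theorem integrability (hT : S.IsStructureTensor T) (hD : IsOpen S.domain) {x : Pt 𝕜}
    (hx : x ∈ S.domain) (i j k : Fin 3) :
    ((if i = j then (∑ l, T l k l x) / 2 else 0) + T i j k x =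
      (if i = k then (∑ l, T l j l x) / 2 else 0) + T i k j x) ∧
    ∀ m, (if i = j then (∑ l, jetCoeff T l k m l x) / 2 else 0) + jetCoeff T i j m k x =
      (if i = k then (∑ l, jetCoeff T l j m l x) / 2 else 0) + jetCoeff T i k m j x := by
  have hcomm : ∀ V ∈ S.pot, ∀ i j k, pd k (pd i (pd j V)) x = pd j (pd i (pd k V)) x := by
    intro V hV i j k
    have hVa := ((hT.mem_pot_iff V).1 hV).1
    rw [pd_comm k i (analyticAt_pd j (hVa x hx)), pd_comm j i (analyticAt_pd k (hVa x hx))]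
    exact pd_congr i hD (fun y hy => pd_comm k j (hVa y hy)) hx
  have main : ∀ (g : Fin 3 → 𝕜) (h : 𝕜) (i j k : Fin 3),
      (if i = j then ∑ l, (T l k l x * h + ∑ m, jetCoeff T l k m l x * g m) else 0) / 2 +
        (T i j k x * h + ∑ m, jetCoeff T i j m k x * g m) =
      (if i = k then ∑ l, (T l j l x * h + ∑ m, jetCoeff T l j m l x * g m) else 0) / 2 +
        (T i k j x * h + ∑ m, jetCoeff T i k m j x * g m) := by
    intro g h
    obtain ⟨V, hV, -, hg, hh⟩ := hT.exists_jet x hx 0 g h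
    obtain ⟨η, hη⟩ := hT.pd_pd_pd hD hV hx (h := h) (by simpa only [hg] using hh)
    simp only [hg] at hη
    have hs : ∀ i j k, (if i = j then η k else 0) + T i j k x * h +
        ∑ m, jetCoeff T i j m k x * g m = (if i = k then η j else 0) + T i k j x * h +
        ∑ m, jetCoeff T i k m j x * g m := by
      intro i j k
      rw [← hη, ← hη]
      exact hcomm V hV i j k
    -- tracing the Laplacian part against the other derivatives determines `η`
    have htr : ∀ k, ∑ i, T i i k x * h + ∑ i, ∑ m, jetCoeff T i i m k x * g m = 0 := by
      intro k
      have h1 : ∑ i, (pd k (pd i (pd i V)) x) = 3 * η k := by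
        have htrT : ∀ m, ∑ i, jetCoeff T i i m k x = 0 := by
          intro m
          have d0 : ∑ i, pd k (T i i m) x = 0 := by
            rw [← pd_sum Finset.univ k fun i _ => (hT.analytic i i m x hx).differentiableAt,
              funext (hT.trace m), pd_const]
          simp only [jetCoeff, Finset.sum_add_distrib, d0, zero_add]
          rw [Finset.sum_comm]
          simp only [← Finset.sum_mul, hT.trace, zero_mul, Finset.sum_const_zero]
        simp only [hη, Finset.sum_add_distrib, if_true, ← Finset.sum_mul, hT.trace]
        rw [Finset.sum_comm]
        simp only [← Finset.sum_mul, htrT]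
        simp
      simp only [hη, Finset.sum_add_distrib, if_true] at h1
      simp only [Finset.sum_const, Finset.card_univ, Fintype.card_fin, nsmul_eq_mul] at h1
      push_cast at h1
      linear_combination h1
    have hη' : ∀ k, η k = (∑ l, (T l k l x * h + ∑ m, jetCoeff T l k m l x * g m)) / 2 := by
      intro k
      have e0 := hs 0 0 k
      have e1 := hs 1 1 k
      have e2 := hs 2 2 k
      have e3 := htr k
      simp only [if_true] at e0 e1 e2
      rw [Fin.sum_univ_three] at e3
      simp only [Fin.sum_univ_three (f := fun i => ∑ m, jetCoeff T i i m k x * g m)] at e3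
      rw [Fin.sum_univ_three]
      have e4 : (if (0 : Fin 3) = k then η 0 else 0) + (if (1 : Fin 3) = k then η 1 else 0) +
          (if (2 : Fin 3) = k then η 2 else 0) = η k := by fin_cases k <;> simp
      linear_combination (e0 + e1 + e2 - e3 + e4) / 2
    intro i j k
    have := hs i j k
    simp only [ite_div, zero_div, ← hη']
    linear_combination this
  refine ⟨?_, fun m => ?_⟩
  · have := main 0 1 i j k
    simp only [Pi.zero_apply, mul_zero, Finset.sum_const_zero, add_zero, mul_one, ite_div,
      zero_div] at this
    exact this
  · have := main (Pi.single m 1) 0 i j k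
    simp only [mul_zero, zero_add, Pi.single_apply, mul_ite, mul_one, Finset.sum_ite_eq',
      Finset.mem_univ, if_true, ite_div, zero_div] at this
    exact this

end System.IsStructureTensor

end

/-! ### The algebra of structure tensors -/

/-- The totally symmetric trace-free tensor with the components
`S₀₀₁, S₀₀₂, S₀₁₁, S₁₁₂, S₀₂₂, S₁₂₂, S₀₁₂`. -/
def harmonicCubic (s : Fin 7 → 𝕜) : Fin 3 → Fin 3 → Fin 3 → 𝕜 :=
  ![![![-(s 2 + s 4), s 0, s 1], ![s 0, s 2, s 6], ![s 1, s 6, s 4]],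
    ![![s 0, s 2, s 6], ![s 2, -(s 0 + s 5), s 3], ![s 6, s 3, s 5]],
    ![![s 1, s 6, s 4], ![s 6, s 3, s 5], ![s 4, s 5, -(s 1 + s 3)]]]

/-- The general value of a structure tensor: a totally symmetric trace-free tensor plus
`3 (δᵢₖ uⱼ + δⱼₖ uᵢ) - 2 δᵢⱼ uₖ`. -/
def structT (s : Fin 7 → 𝕜) (u : Fin 3 → 𝕜) (i j k : Fin 3) : 𝕜 :=
  harmonicCubic s i j k + 3 * ((if i = k then u j else 0) + (if j = k then u i else 0))
    - 2 * (if i = j then u k else 0)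

/-- The pointwise linear equations satisfied by a structure tensor and by its derivatives. The
equation `mixed` is the coefficient of `h` in the symmetry of the third derivatives of
`∂ᵢ∂ⱼ V = δᵢⱼ h + ∑ₖ Tᵢⱼₖ ∂ₖ V`. -/
structure IsPotentialTensor (τ : Fin 3 → Fin 3 → Fin 3 → 𝕜) : Prop where
  symm : ∀ i j k, τ i j k = τ j i k
  trace : ∀ k, ∑ i, τ i i k = 0
  mixed : ∀ i j k, (if i = j then (∑ l, τ l k l) / 2 else 0) + τ i j k =
    (if i = k then (∑ l, τ l j l) / 2 else 0) + τ i k j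

/-- The integrability conditions of first order leave ten parameters of a structure tensor: a
totally symmetric trace-free tensor and a vector. -/
theorem IsPotentialTensor.exists_eq {τ : Fin 3 → Fin 3 → Fin 3 → 𝕜} (h : IsPotentialTensor τ) :
    ∃ s u, τ = structT s u := by
  have hs := h.symm
  have ht := h.trace
  have hm := h.mixed
  refine ⟨![τ 0 0 1 + 2 * ((∑ l, τ l 1 l) / 10), τ 0 0 2 + 2 * ((∑ l, τ l 2 l) / 10),
    τ 1 1 0 + 2 * ((∑ l, τ l 0 l) / 10), τ 1 1 2 + 2 * ((∑ l, τ l 2 l) / 10),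
    τ 2 2 0 + 2 * ((∑ l, τ l 0 l) / 10), τ 2 2 1 + 2 * ((∑ l, τ l 1 l) / 10), τ 0 1 2],
    fun k => (∑ l, τ l k l) / 10, ?_⟩
  have t0 := ht 0
  have t1 := ht 1
  have t2 := ht 2
  have e1 := hm 0 1 2
  have e2 := hm 1 0 2
  have e3 := hm 0 0 1
  have e4 := hm 0 0 2
  have e5 := hm 1 1 0
  have e6 := hm 1 1 2
  have e7 := hm 2 2 0
  have e8 := hm 2 2 1
  simp [Fin.sum_univ_three, hs 1 0, hs 2 0, hs 2 1] at t0 t1 t2 e1 e2 e3 e4 e5 e6 e7 e8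
  funext i j k
  fin_cases i <;> fin_cases j <;> fin_cases k <;>
    simp [structT, harmonicCubic, Fin.sum_univ_three, hs 1 0, hs 2 0, hs 2 1] <;> grind

/-- The coefficients of the total system `∂ᵢ bⱼₖ = M(b)ᵢⱼₖ` satisfied by a second order constant
`∑ bʲᵏ pⱼ pₖ / λ + W`: `τ` is the structure tensor and `L` the logarithmic gradient of `λ`. -/
def connM (τ : Fin 3 → Fin 3 → Fin 3 → 𝕜) (L : Fin 3 → 𝕜) (b : Fin 3 → Fin 3 → 𝕜)
    (i j k : Fin 3) : 𝕜 :=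
  (L i * b j k + L j * b i k + L k * b i j - (if j = k then ∑ m, b i m * L m else 0)
    - (if i = k then ∑ m, b j m * L m else 0) - (if i = j then ∑ m, b k m * L m else 0)
    - ∑ m, (b j m * τ m i k + b k m * τ m i j - b i m * (τ m j k + τ m k j))) / 3

/-- The curvature of the total system `∂ᵢ bⱼₖ = M(b)ᵢⱼₖ`, in terms of the values `τ`, `L` of its
coefficients and of their derivatives `dτ`, `dL`. -/
def curv (τ : Fin 3 → Fin 3 → Fin 3 → 𝕜) (L : Fin 3 → 𝕜)
    (dτ : Fin 3 → Fin 3 → Fin 3 → Fin 3 → 𝕜) (dL : Fin 3 → Fin 3 → 𝕜)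
    (b : Fin 3 → Fin 3 → 𝕜) (l i j k : Fin 3) : 𝕜 :=
  connM (dτ l) (dL l) b i j k - connM (dτ i) (dL i) b l j k
    + connM τ L (connM τ L b l) i j k - connM τ L (connM τ L b i) l j k

/-- The symmetric matrix with entries `1` at the places `(b, c)` and `(c, b)`. -/
def symUnit (b c : Fin 3) (j k : Fin 3) : 𝕜 := if (j = b ∧ k = c) ∨ (j = c ∧ k = b) then 1 else 0

/-- The integrability conditions of the potential equations at a point, of second order: the
coefficients of the gradient in the symmetry of the third derivatives of a potential. -/
def PotIntegrable (τ : Fin 3 → Fin 3 → Fin 3 → 𝕜) (dτ : Fin 3 → Fin 3 → Fin 3 → Fin 3 → 𝕜) :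
    Prop :=
  ∀ i j k m, (if i = j then (∑ l, (dτ l l k m + ∑ n, τ l k n * τ n l m)) / 2 else 0) +
      (dτ k i j m + ∑ n, τ i j n * τ n k m) =
    (if i = k then (∑ l, (dτ l l j m + ∑ n, τ l j n * τ n l m)) / 2 else 0) +
      (dτ j i k m + ∑ n, τ i k n * τ n j m)

/-! ### The components of the total system

`connM (structT s u) L b` written out for each triple of indices, so that the identities between
components of the curvature become polynomial identities. -/

theorem connM_structT_000 (s : Fin 7 → 𝕜) (u L : Fin 3 → 𝕜) (b : Fin 3 → Fin 3 → 𝕜) :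
    connM (structT s u) L b 0 0 0 = (b 0 1 * (-3 * L 1) + b 0 2 * (-3 * L 2)) / 3 := by
  simp [connM, structT, harmonicCubic, Fin.sum_univ_three]
  ring

theorem connM_structT_001 (s : Fin 7 → 𝕜) (u L : Fin 3 → 𝕜) (b : Fin 3 → Fin 3 → 𝕜) :
    connM (structT s u) L b 0 0 1 =
      (b 0 0 * (s 0 + 3 * u 1 + L 1) + b 0 1 * (s 2 - 2 * u 0 + 2 * L 0) + b 0 2 * (s 6) +
        b 1 0 * (s 2 + s 4 - 4 * u 0 - L 0) + b 1 1 * (-s 0 - 3 * u 1 - L 1) +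
        b 1 2 * (-s 1 - 3 * u 2 - L 2)) / 3 := by
  simp [connM, structT, harmonicCubic, Fin.sum_univ_three]
  ring

theorem connM_structT_002 (s : Fin 7 → 𝕜) (u L : Fin 3 → 𝕜) (b : Fin 3 → Fin 3 → 𝕜) :
    connM (structT s u) L b 0 0 2 =
      (b 0 0 * (s 1 + 3 * u 2 + L 2) + b 0 1 * (s 6) + b 0 2 * (s 4 - 2 * u 0 + 2 * L 0) +
        b 2 0 * (s 2 + s 4 - 4 * u 0 - L 0) + b 2 1 * (-s 0 - 3 * u 1 - L 1) +
        b 2 2 * (-s 1 - 3 * u 2 - L 2)) / 3 := by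
  simp [connM, structT, harmonicCubic, Fin.sum_univ_three]
  ring

theorem connM_structT_010 (s : Fin 7 → 𝕜) (u L : Fin 3 → 𝕜) (b : Fin 3 → Fin 3 → 𝕜) :
    connM (structT s u) L b 0 1 0 =
      (b 0 0 * (s 0 + 3 * u 1 + L 1) + b 0 1 * (s 2 - 2 * u 0 + L 0) + b 0 2 * (s 6) +
        b 1 0 * (s 2 + s 4 - 4 * u 0) + b 1 1 * (-s 0 - 3 * u 1 - L 1) +
        b 1 2 * (-s 1 - 3 * u 2 - L 2)) / 3 := by
  simp [connM, structT, harmonicCubic, Fin.sum_univ_three]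
  ring

theorem connM_structT_011 (s : Fin 7 → 𝕜) (u L : Fin 3 → 𝕜) (b : Fin 3 → Fin 3 → 𝕜) :
    connM (structT s u) L b 0 1 1 =
      (b 0 0 * (2 * s 2 + 6 * u 0 - L 0) + b 0 1 * (-2 * s 0 - 2 * s 5 + 8 * u 1 + L 1) +
        b 0 2 * (2 * s 3 + 6 * u 2 - L 2) + b 1 0 * (-2 * s 0 + 4 * u 1) +
        b 1 1 * (-2 * s 2 - 6 * u 0 + L 0) + b 1 2 * (-2 * s 6)) / 3 := by
  simp [connM, structT, harmonicCubic, Fin.sum_univ_three]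
  ring

theorem connM_structT_012 (s : Fin 7 → 𝕜) (u L : Fin 3 → 𝕜) (b : Fin 3 → Fin 3 → 𝕜) :
    connM (structT s u) L b 0 1 2 =
      (b 0 0 * (2 * s 6) + b 0 1 * (2 * s 3 + u 2 + L 2) + b 0 2 * (2 * s 5 + u 1 + L 1) +
        b 1 0 * (-s 1 + 2 * u 2) + b 1 1 * (-s 6) + b 1 2 * (-s 4 - 3 * u 0 + L 0) +
        b 2 0 * (-s 0 + 2 * u 1) + b 2 1 * (-s 2 - 3 * u 0) + b 2 2 * (-s 6)) / 3 := by
  simp [connM, structT, harmonicCubic, Fin.sum_univ_three]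
  ring

theorem connM_structT_020 (s : Fin 7 → 𝕜) (u L : Fin 3 → 𝕜) (b : Fin 3 → Fin 3 → 𝕜) :
    connM (structT s u) L b 0 2 0 =
      (b 0 0 * (s 1 + 3 * u 2 + L 2) + b 0 1 * (s 6) + b 0 2 * (s 4 - 2 * u 0 + L 0) +
        b 2 0 * (s 2 + s 4 - 4 * u 0) + b 2 1 * (-s 0 - 3 * u 1 - L 1) +
        b 2 2 * (-s 1 - 3 * u 2 - L 2)) / 3 := by
  simp [connM, structT, harmonicCubic, Fin.sum_univ_three]
  ring

theorem connM_structT_021 (s : Fin 7 → 𝕜) (u L : Fin 3 → 𝕜) (b : Fin 3 → Fin 3 → 𝕜) :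
    connM (structT s u) L b 0 2 1 =
      (b 0 0 * (2 * s 6) + b 0 1 * (2 * s 3 + u 2 + L 2) + b 0 2 * (2 * s 5 + u 1 + L 1) +
        b 1 0 * (-s 1 + 2 * u 2) + b 1 1 * (-s 6) + b 1 2 * (-s 4 - 3 * u 0) +
        b 2 0 * (-s 0 + 2 * u 1) + b 2 1 * (-s 2 - 3 * u 0 + L 0) + b 2 2 * (-s 6)) / 3 := by
  simp [connM, structT, harmonicCubic, Fin.sum_univ_three]
  ring

theorem connM_structT_022 (s : Fin 7 → 𝕜) (u L : Fin 3 → 𝕜) (b : Fin 3 → Fin 3 → 𝕜) :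
    connM (structT s u) L b 0 2 2 =
      (b 0 0 * (2 * s 4 + 6 * u 0 - L 0) + b 0 1 * (2 * s 5 + 6 * u 1 - L 1) +
        b 0 2 * (-2 * s 1 - 2 * s 3 + 8 * u 2 + L 2) + b 2 0 * (-2 * s 1 + 4 * u 2) +
        b 2 1 * (-2 * s 6) + b 2 2 * (-2 * s 4 - 6 * u 0 + L 0)) / 3 := by
  simp [connM, structT, harmonicCubic, Fin.sum_univ_three]
  ring

theorem connM_structT_100 (s : Fin 7 → 𝕜) (u L : Fin 3 → 𝕜) (b : Fin 3 → Fin 3 → 𝕜) :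
    connM (structT s u) L b 1 0 0 =
      (b 0 0 * (-2 * s 0 - 6 * u 1 + L 1) + b 0 1 * (-2 * s 2 + 4 * u 0) + b 0 2 * (-2 * s 6) +
        b 1 0 * (-2 * s 2 - 2 * s 4 + 8 * u 0 + L 0) + b 1 1 * (2 * s 0 + 6 * u 1 - L 1) +
        b 1 2 * (2 * s 1 + 6 * u 2 - L 2)) / 3 := by
  simp [connM, structT, harmonicCubic, Fin.sum_univ_three]
  ring

theorem connM_structT_101 (s : Fin 7 → 𝕜) (u L : Fin 3 → 𝕜) (b : Fin 3 → Fin 3 → 𝕜) :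
    connM (structT s u) L b 1 0 1 =
      (b 0 0 * (-s 2 - 3 * u 0 - L 0) + b 0 1 * (s 0 + s 5 - 4 * u 1) +
        b 0 2 * (-s 3 - 3 * u 2 - L 2) + b 1 0 * (s 0 - 2 * u 1 + L 1) +
        b 1 1 * (s 2 + 3 * u 0 + L 0) + b 1 2 * (s 6)) / 3 := by
  simp [connM, structT, harmonicCubic, Fin.sum_univ_three]
  ring

theorem connM_structT_102 (s : Fin 7 → 𝕜) (u L : Fin 3 → 𝕜) (b : Fin 3 → Fin 3 → 𝕜) :
    connM (structT s u) L b 1 0 2 =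
      (b 0 0 * (-s 6) + b 0 1 * (-s 3 + 2 * u 2) + b 0 2 * (-s 5 - 3 * u 1 + L 1) +
        b 1 0 * (2 * s 1 + u 2 + L 2) + b 1 1 * (2 * s 6) + b 1 2 * (2 * s 4 + u 0 + L 0) +
        b 2 0 * (-s 0 - 3 * u 1) + b 2 1 * (-s 2 + 2 * u 0) + b 2 2 * (-s 6)) / 3 := by
  simp [connM, structT, harmonicCubic, Fin.sum_univ_three]
  ring

theorem connM_structT_110 (s : Fin 7 → 𝕜) (u L : Fin 3 → 𝕜) (b : Fin 3 → Fin 3 → 𝕜) :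
    connM (structT s u) L b 1 1 0 =
      (b 0 0 * (-s 2 - 3 * u 0 - L 0) + b 0 1 * (s 0 + s 5 - 4 * u 1 - L 1) +
        b 0 2 * (-s 3 - 3 * u 2 - L 2) + b 1 0 * (s 0 - 2 * u 1 + 2 * L 1) +
        b 1 1 * (s 2 + 3 * u 0 + L 0) + b 1 2 * (s 6)) / 3 := by
  simp [connM, structT, harmonicCubic, Fin.sum_univ_three]
  ring

theorem connM_structT_111 (s : Fin 7 → 𝕜) (u L : Fin 3 → 𝕜) (b : Fin 3 → Fin 3 → 𝕜) :
    connM (structT s u) L b 1 1 1 = (b 1 0 * (-3 * L 0) + b 1 2 * (-3 * L 2)) / 3 := by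
  simp [connM, structT, harmonicCubic, Fin.sum_univ_three]
  ring

theorem connM_structT_112 (s : Fin 7 → 𝕜) (u L : Fin 3 → 𝕜) (b : Fin 3 → Fin 3 → 𝕜) :
    connM (structT s u) L b 1 1 2 =
      (b 1 0 * (s 6) + b 1 1 * (s 3 + 3 * u 2 + L 2) + b 1 2 * (s 5 - 2 * u 1 + 2 * L 1) +
        b 2 0 * (-s 2 - 3 * u 0 - L 0) + b 2 1 * (s 0 + s 5 - 4 * u 1 - L 1) +
        b 2 2 * (-s 3 - 3 * u 2 - L 2)) / 3 := by
  simp [connM, structT, harmonicCubic, Fin.sum_univ_three]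
  ring

theorem connM_structT_120 (s : Fin 7 → 𝕜) (u L : Fin 3 → 𝕜) (b : Fin 3 → Fin 3 → 𝕜) :
    connM (structT s u) L b 1 2 0 =
      (b 0 0 * (-s 6) + b 0 1 * (-s 3 + 2 * u 2) + b 0 2 * (-s 5 - 3 * u 1) +
        b 1 0 * (2 * s 1 + u 2 + L 2) + b 1 1 * (2 * s 6) + b 1 2 * (2 * s 4 + u 0 + L 0) +
        b 2 0 * (-s 0 - 3 * u 1 + L 1) + b 2 1 * (-s 2 + 2 * u 0) + b 2 2 * (-s 6)) / 3 := by
  simp [connM, structT, harmonicCubic, Fin.sum_univ_three]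
  ring

theorem connM_structT_121 (s : Fin 7 → 𝕜) (u L : Fin 3 → 𝕜) (b : Fin 3 → Fin 3 → 𝕜) :
    connM (structT s u) L b 1 2 1 =
      (b 1 0 * (s 6) + b 1 1 * (s 3 + 3 * u 2 + L 2) + b 1 2 * (s 5 - 2 * u 1 + L 1) +
        b 2 0 * (-s 2 - 3 * u 0 - L 0) + b 2 1 * (s 0 + s 5 - 4 * u 1) +
        b 2 2 * (-s 3 - 3 * u 2 - L 2)) / 3 := by
  simp [connM, structT, harmonicCubic, Fin.sum_univ_three]
  ring

theorem connM_structT_122 (s : Fin 7 → 𝕜) (u L : Fin 3 → 𝕜) (b : Fin 3 → Fin 3 → 𝕜) :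
    connM (structT s u) L b 1 2 2 =
      (b 1 0 * (2 * s 4 + 6 * u 0 - L 0) + b 1 1 * (2 * s 5 + 6 * u 1 - L 1) +
        b 1 2 * (-2 * s 1 - 2 * s 3 + 8 * u 2 + L 2) + b 2 0 * (-2 * s 6) +
        b 2 1 * (-2 * s 3 + 4 * u 2) + b 2 2 * (-2 * s 5 - 6 * u 1 + L 1)) / 3 := by
  simp [connM, structT, harmonicCubic, Fin.sum_univ_three]
  ring

theorem connM_structT_200 (s : Fin 7 → 𝕜) (u L : Fin 3 → 𝕜) (b : Fin 3 → Fin 3 → 𝕜) :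
    connM (structT s u) L b 2 0 0 =
      (b 0 0 * (-2 * s 1 - 6 * u 2 + L 2) + b 0 1 * (-2 * s 6) + b 0 2 * (-2 * s 4 + 4 * u 0) +
        b 2 0 * (-2 * s 2 - 2 * s 4 + 8 * u 0 + L 0) + b 2 1 * (2 * s 0 + 6 * u 1 - L 1) +
        b 2 2 * (2 * s 1 + 6 * u 2 - L 2)) / 3 := by
  simp [connM, structT, harmonicCubic, Fin.sum_univ_three]
  ring

theorem connM_structT_201 (s : Fin 7 → 𝕜) (u L : Fin 3 → 𝕜) (b : Fin 3 → Fin 3 → 𝕜) :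
    connM (structT s u) L b 2 0 1 =
      (b 0 0 * (-s 6) + b 0 1 * (-s 3 - 3 * u 2 + L 2) + b 0 2 * (-s 5 + 2 * u 1) +
        b 1 0 * (-s 1 - 3 * u 2) + b 1 1 * (-s 6) + b 1 2 * (-s 4 + 2 * u 0) +
        b 2 0 * (2 * s 0 + u 1 + L 1) + b 2 1 * (2 * s 2 + u 0 + L 0) + b 2 2 * (2 * s 6)) / 3 := by
  simp [connM, structT, harmonicCubic, Fin.sum_univ_three]
  ring

theorem connM_structT_202 (s : Fin 7 → 𝕜) (u L : Fin 3 → 𝕜) (b : Fin 3 → Fin 3 → 𝕜) :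
    connM (structT s u) L b 2 0 2 =
      (b 0 0 * (-s 4 - 3 * u 0 - L 0) + b 0 1 * (-s 5 - 3 * u 1 - L 1) +
        b 0 2 * (s 1 + s 3 - 4 * u 2) + b 2 0 * (s 1 - 2 * u 2 + L 2) + b 2 1 * (s 6) +
        b 2 2 * (s 4 + 3 * u 0 + L 0)) / 3 := by
  simp [connM, structT, harmonicCubic, Fin.sum_univ_three]
  ring

theorem connM_structT_210 (s : Fin 7 → 𝕜) (u L : Fin 3 → 𝕜) (b : Fin 3 → Fin 3 → 𝕜) :
    connM (structT s u) L b 2 1 0 =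
      (b 0 0 * (-s 6) + b 0 1 * (-s 3 - 3 * u 2) + b 0 2 * (-s 5 + 2 * u 1) +
        b 1 0 * (-s 1 - 3 * u 2 + L 2) + b 1 1 * (-s 6) + b 1 2 * (-s 4 + 2 * u 0) +
        b 2 0 * (2 * s 0 + u 1 + L 1) + b 2 1 * (2 * s 2 + u 0 + L 0) + b 2 2 * (2 * s 6)) / 3 := by
  simp [connM, structT, harmonicCubic, Fin.sum_univ_three]
  ring

theorem connM_structT_211 (s : Fin 7 → 𝕜) (u L : Fin 3 → 𝕜) (b : Fin 3 → Fin 3 → 𝕜) :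
    connM (structT s u) L b 2 1 1 =
      (b 1 0 * (-2 * s 6) + b 1 1 * (-2 * s 3 - 6 * u 2 + L 2) + b 1 2 * (-2 * s 5 + 4 * u 1) +
        b 2 0 * (2 * s 2 + 6 * u 0 - L 0) + b 2 1 * (-2 * s 0 - 2 * s 5 + 8 * u 1 + L 1) +
        b 2 2 * (2 * s 3 + 6 * u 2 - L 2)) / 3 := by
  simp [connM, structT, harmonicCubic, Fin.sum_univ_three]
  ring

theorem connM_structT_212 (s : Fin 7 → 𝕜) (u L : Fin 3 → 𝕜) (b : Fin 3 → Fin 3 → 𝕜) :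
    connM (structT s u) L b 2 1 2 =
      (b 1 0 * (-s 4 - 3 * u 0 - L 0) + b 1 1 * (-s 5 - 3 * u 1 - L 1) +
        b 1 2 * (s 1 + s 3 - 4 * u 2) + b 2 0 * (s 6) + b 2 1 * (s 3 - 2 * u 2 + L 2) +
        b 2 2 * (s 5 + 3 * u 1 + L 1)) / 3 := by
  simp [connM, structT, harmonicCubic, Fin.sum_univ_three]
  ring

theorem connM_structT_220 (s : Fin 7 → 𝕜) (u L : Fin 3 → 𝕜) (b : Fin 3 → Fin 3 → 𝕜) :
    connM (structT s u) L b 2 2 0 =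
      (b 0 0 * (-s 4 - 3 * u 0 - L 0) + b 0 1 * (-s 5 - 3 * u 1 - L 1) +
        b 0 2 * (s 1 + s 3 - 4 * u 2 - L 2) + b 2 0 * (s 1 - 2 * u 2 + 2 * L 2) + b 2 1 * (s 6) +
        b 2 2 * (s 4 + 3 * u 0 + L 0)) / 3 := by
  simp [connM, structT, harmonicCubic, Fin.sum_univ_three]
  ring

theorem connM_structT_221 (s : Fin 7 → 𝕜) (u L : Fin 3 → 𝕜) (b : Fin 3 → Fin 3 → 𝕜) :
    connM (structT s u) L b 2 2 1 =
      (b 1 0 * (-s 4 - 3 * u 0 - L 0) + b 1 1 * (-s 5 - 3 * u 1 - L 1) +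
        b 1 2 * (s 1 + s 3 - 4 * u 2 - L 2) + b 2 0 * (s 6) + b 2 1 * (s 3 - 2 * u 2 + 2 * L 2) +
        b 2 2 * (s 5 + 3 * u 1 + L 1)) / 3 := by
  simp [connM, structT, harmonicCubic, Fin.sum_univ_three]
  ring

theorem connM_structT_222 (s : Fin 7 → 𝕜) (u L : Fin 3 → 𝕜) (b : Fin 3 → Fin 3 → 𝕜) :
    connM (structT s u) L b 2 2 2 = (b 2 0 * (-3 * L 0) + b 2 1 * (-3 * L 1)) / 3 := by
  simp [connM, structT, harmonicCubic, Fin.sum_univ_three]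
  ring

/-! ### Vanishing of the curvature

The entry `R b c l i j k` stands for the component `l i j k` of the curvature of the total system on
the symmetric matrix `symUnit b c`. -/

/-- Linear relations between the entries of a curvature tensor, for an ordered triple of indices.
The name of each field lists the indices of one entry of the relation. -/
structure CurvRelations (R : Fin 3 → Fin 3 → Fin 3 → Fin 3 → Fin 3 → Fin 3 → 𝕜) (x y z : Fin 3) :
    Prop where
  xx_zyxx : R x x z y x x = 0
  xx_zyyy : R x x z y y y = 0
  xx_zyyz : R x x z y y z = 0
  yy_yxxx : R x x y x x x + R y y y x x x = 0
  yz_zxxx : R x x y x x x + R y z z x x x = 0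
  yy_yxxy : R x x y x x y + R y y y x x y = 0
  xx_zxxy : -R x x y x x z + R x x z x x y = 0
  yz_yxxy : R x x y x x z + R y z y x x y = 0
  xy_zxxy : -R x x y x y z + R x y z x x y = 0
  yz_zxyz : R x x y x y z + R y z z x y z = 0
  yy_yxzz : R x x y x z z + R y y y x z z = 0
  zz_yxyz : R x x z y x y + R z z y x y z = 0
  xz_yxxx : -R x y z x x x + R x z y x x x = 0
  xy_yxxy : R x x y x x x - R x x y x y y + R x y y x x y = 0
  xz_zyxx : R x x y x x x + 2 * R x x z y x z + R x z z y x x = 0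
  xy_zyxy : 4 * R x y z y x y - 3 * R x x y x x z - R x y z x x x = 0
  yy_zxxy : 4 * R y y z x x y - R x y z x x x + R x x y x x z = 0
  yy_zyxx : 2 * R y y z y x x - R x x y x x z - R x y z x x x = 0
  xy_zyxx : R x y z y x x - R x x y x y z + R x y y x x z = 0
  xy_zyxz : R x y z y x z - R x y z x y z + R x y y x z z = 0
  xy_yxzz : R x y y x z z - R x z z x y y + R y z z y x x = 0
  yz_zxxy : R x x y x x y + R x x z x x z + R y z y x x z + R y z z x x y = 0
  yz_yxxz : R x x y x x y + 3 * R x x z x x z - R x y y x x x + R x z z x x x +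
    4 * R y z y x x z = 0

/-- A curvature tensor that satisfies the linear relations vanishes if it has rank at most one as a
linear map on symmetric matrices. The minors `hm` and the linear relations between the factors show,
for one type of entry after another, that the square of the entry vanishes. -/
theorem CurvRelations.eq_zero {R : Fin 3 → Fin 3 → Fin 3 → Fin 3 → Fin 3 → Fin 3 → 𝕜}
    (hR : ∀ x y z, x ≠ y → x ≠ z → y ≠ z → CurvRelations R x y z)
    (hb : ∀ b c l i j k, R b c l i j k = R c b l i j k)
    (hj : ∀ b c l i j k, R b c l i j k = R b c l i k j)
    (ha : ∀ b c l i j k, R b c l i j k = -R b c i l j k)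
    (hm : ∀ b c l i j k b' c' l' i' j' k',
      R b c l i j k * R b' c' l' i' j' k' = R b c l' i' j' k' * R b' c' l i j k)
    (b c l i j k : Fin 3) : R b c l i j k = 0 := by
  have xx_yxxx : ∀ x y z, x ≠ y → x ≠ z → y ≠ z → R x x y x x x = 0 := by
    intro x y z hxy hxz hyz
    have h1 := (hR x y z hxy hxz hyz).yy_yxxx
    have h2 := (hR x y z hxy hxz hyz).yz_zxxx
    have h3 := (hR y x z hxy.symm hyz hxz).xx_zyyy
    have h4 := hm y y y x x x y z z x x x
    clear * - h1 h2 h3 h4 hb hj ha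
    grind
  have xx_zyxy : ∀ x y z, x ≠ y → x ≠ z → y ≠ z → R x x z y x y = 0 := by
    intro x y z hxy hxz hyz
    have h1 := (hR x z y hxz hxy hyz.symm).xz_zyxx
    have h2 := xx_yxxx x z y hxz hxy hyz.symm
    have h3 := (hR x y z hxy hxz hyz).xx_zyxx
    have h4 := hm x x z y x y x y z y x x
    clear * - h1 h2 h3 h4 hb hj ha
    grind
  have xx_yxxz : ∀ x y z, x ≠ y → x ≠ z → y ≠ z → R x x y x x z = 0 := by
    intro x y z hxy hxz hyz
    have h1 := (hR x y z hxy hxz hyz).yy_zxxy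
    have h2 := xx_zyxy y x z hxy.symm hyz hxz
    have h3 := xx_yxxx x z y hxz hxy hyz.symm
    have h4 := hm x x y x x z x y z x x x
    clear * - h1 h2 h3 h4 hb hj ha
    grind
  have xy_zyxx : ∀ x y z, x ≠ y → x ≠ z → y ≠ z → R x y z y x x = 0 := by
    intro x y z hxy hxz hyz
    have h1 := (hR x z y hxz hxy hyz.symm).xz_zyxx
    have h2 := xx_yxxx x z y hxz hxy hyz.symm
    have h3 := xx_zyxy x y z hxy hxz hyz
    clear * - h1 h2 h3 hb hj ha
    grind
  have xx_zyyz : ∀ x y z, x ≠ y → x ≠ z → y ≠ z → R x x z y y z = 0 := by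
    intro x y z hxy hxz hyz
    have h1 := (hR x y z hxy hxz hyz).xx_zyyz
    clear * - h1 hb hj ha
    grind
  have xy_zxyy : ∀ x y z, x ≠ y → x ≠ z → y ≠ z → R x y z x y y = 0 := by
    intro x y z hxy hxz hyz
    have h1 := (hR y z x hyz hxy.symm hxz.symm).xz_zyxx
    have h2 := xx_yxxx y z x hyz hxy.symm hxz.symm
    have h3 := xx_zyxy y x z hxy.symm hyz hxz
    clear * - h1 h2 h3 hb hj ha
    grind
  have xy_yxzz : ∀ x y z, x ≠ y → x ≠ z → y ≠ z → R x y y x z z = 0 := by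
    intro x y z hxy hxz hyz
    have h1 := (hR x y z hxy hxz hyz).xy_yxzz
    have h2 := (hR y z x hyz hxy.symm hxz.symm).xz_zyxx
    have h3 := xx_yxxx y z x hyz hxy.symm hxz.symm
    have h4 := xx_zyxy y x z hxy.symm hyz hxz
    have h5 := (hR x z y hxz hxy hyz.symm).xz_zyxx
    have h6 := xx_yxxx x z y hxz hxy hyz.symm
    have h7 := xx_zyxy x y z hxy hxz hyz
    have h8 := hm x y y x z z x z z x y y
    have h9 := hm x y y x z z y z z y x x
    clear * - h1 h2 h3 h4 h5 h6 h7 h8 h9 hb hj ha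
    grind
  have xx_yxxy : ∀ x y z, x ≠ y → x ≠ z → y ≠ z → R x x y x x y = 0 := by
    intro x y z hxy hxz hyz
    have h1 := (hR x z y hxz hxy hyz.symm).yy_yxxy
    have h2 := (hR y z x hyz hxy.symm hxz.symm).xy_zyxz
    have h3 := (hR x y z hxy hxz hyz).yz_zxxy
    have h4 := (hR x y z hxy hxz hyz).xx_zxxy
    have h5 := xx_yxxz x y z hxy hxz hyz
    have h6 := (hR x y z hxy hxz hyz).yz_yxxy
    have h7 := (hR x y z hxy hxz hyz).xx_zyxx
    have h8 := (hR z x y hxz.symm hyz.symm hxy).xx_zyyz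
    have h9 := hm x x y x x y y z z x x y
    have h10 := hm x x y x x y y z z y x x
    have h11 := hm x x y x x y z z z x x z
    clear * - h1 h2 h3 h4 h5 h6 h7 h8 h9 h10 h11 hb hj ha
    grind
  have xy_yxxx : ∀ x y z, x ≠ y → x ≠ z → y ≠ z → R x y y x x x = 0 := by
    intro x y z hxy hxz hyz
    have h1 := (hR y z x hyz hxy.symm hxz.symm).xy_zyxz
    have h2 := (hR x y z hxy hxz hyz).xy_yxzz
    have h3 := (hR x y z hxy hxz hyz).yz_zxxy
    have h4 := (hR x y z hxy hxz hyz).yz_yxxz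
    have h5 := xy_yxzz x y z hxy hxz hyz
    have h6 := xy_yxzz x z y hxz hxy hyz.symm
    have h7 := xx_yxxy x y z hxy hxz hyz
    have h8 := (hR x y z hxy hxz hyz).yy_zxxy
    have h9 := xx_zyxy y x z hxy.symm hyz hxz
    have h10 := xx_yxxz x y z hxy hxz hyz
    have h11 := (hR x z y hxz hxy hyz.symm).yz_zxxx
    have h12 := xx_yxxx x z y hxz hxy hyz.symm
    have h13 := hm x y y x x x x z z x x x
    have h14 := hm x y y x x x y z y x x z
    clear * - h1 h2 h3 h4 h5 h6 h7 h8 h9 h10 h11 h12 h13 h14 hb hj ha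
    grind
  have xx_yxyy : ∀ x y z, x ≠ y → x ≠ z → y ≠ z → R x x y x y y = 0 := by
    intro x y z hxy hxz hyz
    have h1 := (hR y x z hxy.symm hyz hxz).yy_yxxx
    have h2 := xx_yxxx y x z hxy.symm hyz hxz
    clear * - h1 h2 hb hj ha
    grind
  have xx_yxyz : ∀ x y z, x ≠ y → x ≠ z → y ≠ z → R x x y x y z = 0 := by
    intro x y z hxy hxz hyz
    have h1 := (hR x y z hxy hxz hyz).xy_zxxy
    have h2 := (hR y x z hxy.symm hyz hxz).xy_zyxy
    have h3 := (hR y x z hxy.symm hyz hxz).yy_zxxy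
    have h4 := xx_zyxy x y z hxy hxz hyz
    have h5 := xx_yxxz y x z hxy.symm hyz hxz
    clear * - h1 h2 h3 h4 h5 hb hj ha
    grind
  have xx_yxzz : ∀ x y z, x ≠ y → x ≠ z → y ≠ z → R x x y x z z = 0 := by
    intro x y z hxy hxz hyz
    have h1 := (hR z x y hxz.symm hyz.symm hxy).yy_zxxy
    have h2 := (hR z x y hxz.symm hyz.symm hxy).yy_zyxx
    have h3 := xx_zyxy x z y hxz hxy hyz.symm
    have h4 := xx_yxxz z x y hxz.symm hyz.symm hxy
    clear * - h1 h2 h3 h4 hb hj ha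
    grind
  have zz_yxxx : ∀ x y z, x ≠ y → x ≠ z → y ≠ z → R z z y x x x = 0 := by
    intro x y z hxy hxz hyz
    have h1 := (hR z x y hxz.symm hyz.symm hxy).xx_zyyy
    clear * - h1 hb hj ha
    grind
  have zz_yxxy : ∀ x y z, x ≠ y → x ≠ z → y ≠ z → R z z y x x y = 0 := by
    intro x y z hxy hxz hyz
    have h1 := (hR z x y hxz.symm hyz.symm hxy).xx_zyyz
    clear * - h1 hb hj ha
    grind
  have zz_yxxz : ∀ x y z, x ≠ y → x ≠ z → y ≠ z → R z z y x x z = 0 := by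
    intro x y z hxy hxz hyz
    have h1 := (hR y x z hxy.symm hyz hxz).zz_yxyz
    have h2 := xx_zyxy y x z hxy.symm hyz hxz
    clear * - h1 h2 hb hj ha
    grind
  have zz_yxzz : ∀ x y z, x ≠ y → x ≠ z → y ≠ z → R z z y x z z = 0 := by
    intro x y z hxy hxz hyz
    have h1 := (hR z x y hxz.symm hyz.symm hxy).xx_zyxx
    clear * - h1 hb hj ha
    grind
  have xy_yxxy : ∀ x y z, x ≠ y → x ≠ z → y ≠ z → R x y y x x y = 0 := by
    intro x y z hxy hxz hyz
    have h1 := (hR y x z hxy.symm hyz hxz).yy_yxxx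
    have h2 := (hR x y z hxy hxz hyz).xy_yxxy
    have h3 := xx_yxxx x y z hxy hxz hyz
    have h4 := xx_yxxx y x z hxy.symm hyz hxz
    clear * - h1 h2 h3 h4 hb hj ha
    grind
  have xy_yxxz : ∀ x y z, x ≠ y → x ≠ z → y ≠ z → R x y y x x z = 0 := by
    intro x y z hxy hxz hyz
    have h1 := (hR x y z hxy hxz hyz).xy_zxxy
    have h2 := (hR x z y hxz hxy hyz.symm).xz_zyxx
    have h3 := (hR y x z hxy.symm hyz hxz).xy_zyxy
    have h4 := (hR y x z hxy.symm hyz hxz).yy_zxxy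
    have h5 := (hR x y z hxy hxz hyz).xy_zyxx
    have h6 := xx_yxxx x z y hxz hxy hyz.symm
    have h7 := xx_zyxy x y z hxy hxz hyz
    have h8 := xx_yxxz y x z hxy.symm hyz hxz
    clear * - h1 h2 h3 h4 h5 h6 h7 h8 hb hj ha
    grind
  have xz_yxxx : ∀ x y z, x ≠ y → x ≠ z → y ≠ z → R x z y x x x = 0 := by
    intro x y z hxy hxz hyz
    have h1 := (hR x y z hxy hxz hyz).xz_yxxx
    have h2 := (hR x y z hxy hxz hyz).yy_zxxy
    have h3 := xx_zyxy y x z hxy.symm hyz hxz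
    have h4 := xx_yxxz x y z hxy hxz hyz
    clear * - h1 h2 h3 h4 hb hj ha
    grind
  have xz_yxxy : ∀ x y z, x ≠ y → x ≠ z → y ≠ z → R x z y x x y = 0 := by
    intro x y z hxy hxz hyz
    have h1 := (hR y x z hxy.symm hyz hxz).yz_yxxy
    have h2 := xx_yxxz y x z hxy.symm hyz hxz
    clear * - h1 h2 hb hj ha
    grind
  have xz_yxxz : ∀ x y z, x ≠ y → x ≠ z → y ≠ z → R x z y x x z = 0 := by
    intro x y z hxy hxz hyz
    have h1 := (hR z x y hxz.symm hyz.symm hxy).xy_zyxy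
    have h2 := (hR z x y hxz.symm hyz.symm hxy).yy_zxxy
    have h3 := xx_zyxy x z y hxz hxy hyz.symm
    have h4 := xx_yxxz z x y hxz.symm hyz.symm hxy
    clear * - h1 h2 h3 h4 hb hj ha
    grind
  have xz_yxyy : ∀ x y z, x ≠ y → x ≠ z → y ≠ z → R x z y x y y = 0 := by
    intro x y z hxy hxz hyz
    have h1 := (hR y z x hyz hxy.symm hxz.symm).yz_zxxx
    have h2 := xx_yxxx y z x hyz hxy.symm hxz.symm
    clear * - h1 h2 hb hj ha
    grind
  have xz_yxyz : ∀ x y z, x ≠ y → x ≠ z → y ≠ z → R x z y x y z = 0 := by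
    intro x y z hxy hxz hyz
    have h1 := (hR x y z hxy hxz hyz).yy_yxxy
    have h2 := (hR x z y hxz hxy hyz.symm).xy_zyxz
    have h3 := (hR y x z hxy.symm hyz hxz).yz_zxxy
    have h4 := xy_yxzz x z y hxz hxy hyz.symm
    have h5 := xx_yxxy x y z hxy hxz hyz
    have h6 := xx_yxxy y z x hyz hxy.symm hxz.symm
    clear * - h1 h2 h3 h4 h5 h6 hb hj ha
    grind
  have xz_yxzz : ∀ x y z, x ≠ y → x ≠ z → y ≠ z → R x z y x z z = 0 := by
    intro x y z hxy hxz hyz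
    have h1 := (hR y x z hxy.symm hyz hxz).zz_yxyz
    have h2 := (hR z y x hyz.symm hxz.symm hxy.symm).xz_zyxx
    have h3 := xx_yxxx z y x hyz.symm hxz.symm hxy.symm
    have h4 := xx_zyxy y x z hxy.symm hyz hxz
    clear * - h1 h2 h3 h4 hb hj ha
    grind
  -- up to the symmetries of `R` every entry with `l ≠ i` is of one of the types above
  by_cases hli : l = i
  · subst hli
    have := ha b c l l j k
    exact self_eq_neg.mp this
  obtain ⟨z, hz⟩ : ∃ z, l ≠ z ∧ i ≠ z ∧ ∀ b, b = l ∨ b = i ∨ b = z := by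
    clear * - hli
    revert l i
    decide
  obtain ⟨hlz, hiz, h3⟩ := hz
  have hs : ∀ b c j k, R b c l i j k = 0 ∨ R b c i l j k = 0 →
      R b c l i j k = 0 ∧ R c b l i j k = 0 ∧ R b c l i k j = 0 ∧ R c b l i k j = 0 := by
    intro b c j k h
    have h0 : R b c l i j k = 0 := h.elim id fun h => by rw [ha, h, neg_zero]
    exact ⟨h0, by rw [← hb, h0], by rw [← hj, h0], by rw [← hb, ← hj, h0]⟩
  have f0 := hs i i i i (Or.inl (xx_yxxx i l z (Ne.symm hli) hiz hlz))
  have f1 := hs l l l l (Or.inr (xx_yxxx l i z hli hlz hiz))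
  have f2 := hs i i i z (Or.inl (xx_yxxz i l z (Ne.symm hli) hiz hlz))
  have f3 := hs l l l z (Or.inr (xx_yxxz l i z hli hlz hiz))
  have f4 := hs i l z z (Or.inl (xy_yxzz i l z (Ne.symm hli) hiz hlz))
  have f5 := hs l i z z (Or.inr (xy_yxzz l i z hli hlz hiz))
  have f6 := hs i i i l (Or.inl (xx_yxxy i l z (Ne.symm hli) hiz hlz))
  have f7 := hs l l l i (Or.inr (xx_yxxy l i z hli hlz hiz))
  have f8 := hs i l i i (Or.inl (xy_yxxx i l z (Ne.symm hli) hiz hlz))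
  have f9 := hs l i l l (Or.inr (xy_yxxx l i z hli hlz hiz))
  have f10 := hs i i l l (Or.inl (xx_yxyy i l z (Ne.symm hli) hiz hlz))
  have f11 := hs l l i i (Or.inr (xx_yxyy l i z hli hlz hiz))
  have f12 := hs i i l z (Or.inl (xx_yxyz i l z (Ne.symm hli) hiz hlz))
  have f13 := hs l l i z (Or.inr (xx_yxyz l i z hli hlz hiz))
  have f14 := hs i i z z (Or.inl (xx_yxzz i l z (Ne.symm hli) hiz hlz))
  have f15 := hs l l z z (Or.inr (xx_yxzz l i z hli hlz hiz))
  have f16 := hs z z i i (Or.inl (zz_yxxx i l z (Ne.symm hli) hiz hlz))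
  have f17 := hs z z l l (Or.inr (zz_yxxx l i z hli hlz hiz))
  have f18 := hs z z i l (Or.inl (zz_yxxy i l z (Ne.symm hli) hiz hlz))
  have f19 := hs z z l i (Or.inr (zz_yxxy l i z hli hlz hiz))
  have f20 := hs z z i z (Or.inl (zz_yxxz i l z (Ne.symm hli) hiz hlz))
  have f21 := hs z z l z (Or.inr (zz_yxxz l i z hli hlz hiz))
  have f22 := hs z z z z (Or.inl (zz_yxzz i l z (Ne.symm hli) hiz hlz))
  have f23 := hs z z z z (Or.inr (zz_yxzz l i z hli hlz hiz))
  have f24 := hs i l i l (Or.inl (xy_yxxy i l z (Ne.symm hli) hiz hlz))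
  have f25 := hs l i l i (Or.inr (xy_yxxy l i z hli hlz hiz))
  have f26 := hs i l i z (Or.inl (xy_yxxz i l z (Ne.symm hli) hiz hlz))
  have f27 := hs l i l z (Or.inr (xy_yxxz l i z hli hlz hiz))
  have f28 := hs i z i i (Or.inl (xz_yxxx i l z (Ne.symm hli) hiz hlz))
  have f29 := hs l z l l (Or.inr (xz_yxxx l i z hli hlz hiz))
  have f30 := hs i z i l (Or.inl (xz_yxxy i l z (Ne.symm hli) hiz hlz))
  have f31 := hs l z l i (Or.inr (xz_yxxy l i z hli hlz hiz))
  have f32 := hs i z i z (Or.inl (xz_yxxz i l z (Ne.symm hli) hiz hlz))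
  have f33 := hs l z l z (Or.inr (xz_yxxz l i z hli hlz hiz))
  have f34 := hs i z l l (Or.inl (xz_yxyy i l z (Ne.symm hli) hiz hlz))
  have f35 := hs l z i i (Or.inr (xz_yxyy l i z hli hlz hiz))
  have f36 := hs i z l z (Or.inl (xz_yxyz i l z (Ne.symm hli) hiz hlz))
  have f37 := hs l z i z (Or.inr (xz_yxyz l i z hli hlz hiz))
  have f38 := hs i z z z (Or.inl (xz_yxzz i l z (Ne.symm hli) hiz hlz))
  have f39 := hs l z z z (Or.inr (xz_yxzz l i z hli hlz hiz))
  clear hR hm hb hj ha hs xx_yxxx xx_zyxy xx_yxxz xy_zyxx xx_zyyz xy_zxyy xy_yxzz xx_yxxy xy_yxxx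
    xx_yxyy xx_yxyz xx_yxzz zz_yxxx zz_yxxy zz_yxxz zz_yxzz xy_yxxy xy_yxxz xz_yxxx xz_yxxy xz_yxxz
    xz_yxyy xz_yxyz xz_yxzz
  rcases h3 b with rfl | rfl | rfl <;> rcases h3 c with rfl | rfl | rfl <;>
    rcases h3 j with rfl | rfl | rfl <;> rcases h3 k with rfl | rfl | rfl <;> simp only [*]

set_option maxHeartbeats 1000000 in
/-- For the standard order of the coordinates, each of the relations is a combination of the
integrability conditions of the potential equations. -/
theorem curvRelations_structT {s : Fin 7 → 𝕜} {u L : Fin 3 → 𝕜} {ds : Fin 3 → Fin 7 → 𝕜}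
    {du dL : Fin 3 → Fin 3 → 𝕜} (hdL : ∀ i j, dL i j = dL j i)
    (hE : PotIntegrable (structT s u) (fun l => structT (ds l) (du l))) :
    CurvRelations (fun b c => curv (structT s u) L (fun l => structT (ds l) (du l)) dL
      (symUnit b c)) 0 1 2 := by
  have e0010 := hE 0 0 1 0
  have e0011 := hE 0 0 1 1
  have e0020 := hE 0 0 2 0
  have e0021 := hE 0 0 2 1
  have e0022 := hE 0 0 2 2
  have e0120 := hE 0 1 2 0
  have e0121 := hE 0 1 2 1
  have e0122 := hE 0 1 2 2
  have e1010 := hE 1 0 1 0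
  have e1011 := hE 1 0 1 1
  have e1012 := hE 1 0 1 2
  have e1020 := hE 1 0 2 0
  have e1021 := hE 1 0 2 1
  have e1022 := hE 1 0 2 2
  simp only [Fin.sum_univ_three, structT, harmonicCubic, Matrix.cons_val, Fin.reduceEq, ↓reduceIte,
    add_zero, zero_add, mul_zero, sub_zero]
    at e0010 e0011 e0020 e0021 e0022 e0120 e0121 e0122 e1010 e1011 e1012 e1020 e1021 e1022
  constructor <;>
    simp only [curv,
      connM_structT_000, connM_structT_001, connM_structT_002, connM_structT_010,
      connM_structT_011, connM_structT_012, connM_structT_020, connM_structT_021,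
      connM_structT_022, connM_structT_100, connM_structT_101, connM_structT_102,
      connM_structT_110, connM_structT_111, connM_structT_112, connM_structT_120,
      connM_structT_121, connM_structT_122, connM_structT_200, connM_structT_201,
      connM_structT_202, connM_structT_210, connM_structT_211, connM_structT_212,
      connM_structT_220, connM_structT_221, connM_structT_222] <;>
    simp only [symUnit, Fin.reduceEq, and_self, and_true, and_false, or_self, or_true,
      or_false, ↓reduceIte, zero_mul, one_mul, add_zero, zero_add, zero_div, sub_zero,
      hdL 1 0, hdL 2 0, hdL 2 1]
  · linear_combination -(2/3) * e0120
  · ring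
  · ring
  · ring
  · ring
  · ring
  · linear_combination (1/3) * e0120
  · ring
  · linear_combination (1/3) * e0121 - (1/3) * e1021 - (2/3) * e0020
  · linear_combination -(1/3) * e0121 + (2/3) * e1012
  · linear_combination -(2/3) * e0122 + (2/3) * e1022
  · linear_combination -(1/3) * e1021
  · ring
  · linear_combination (1/3) * e0122 - (1/3) * e1022 - (2/3) * e0010 - (2/3) * e1011
  · linear_combination -(2/3) * e0122 - (4/3) * e0010
  · linear_combination -(1/3) * e0120 + (1/3) * e1020 + (8/3) * e0021
  · linear_combination -(1/3) * e0120 - e1020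
  · linear_combination (1/3) * e0120 + e1020
  · linear_combination (1/3) * e0121 - (1/3) * e1021 + (4/3) * e0020
  · linear_combination 2 * e0022
  · linear_combination -(2/3) * e0011 + (2/3) * e0022 - (2/3) * e1010
  · ring
  · linear_combination -2 * e1010

/-- The total system is equivariant under permutations of the coordinates. -/
theorem connM_perm (σ : Equiv.Perm (Fin 3)) (τ : Fin 3 → Fin 3 → Fin 3 → 𝕜) (L : Fin 3 → 𝕜)
    (b : Fin 3 → Fin 3 → 𝕜) (i j k : Fin 3) :
    connM (fun i j k => τ (σ i) (σ j) (σ k)) (fun i => L (σ i)) (fun i j => b (σ i) (σ j)) i j k =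
      connM τ L b (σ i) (σ j) (σ k) := by
  simp only [connM, σ.injective.eq_iff]
  rw [← Equiv.sum_comp σ (fun m => b (σ i) m * L m), ← Equiv.sum_comp σ (fun m => b (σ j) m * L m),
    ← Equiv.sum_comp σ (fun m => b (σ k) m * L m),
    ← Equiv.sum_comp σ (fun m => b (σ j) m * τ m (σ i) (σ k) +
      b (σ k) m * τ m (σ i) (σ j) - b (σ i) m * (τ m (σ j) (σ k) + τ m (σ k) (σ j)))]

theorem curv_perm (σ : Equiv.Perm (Fin 3)) (τ : Fin 3 → Fin 3 → Fin 3 → 𝕜) (L : Fin 3 → 𝕜)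
    (dτ : Fin 3 → Fin 3 → Fin 3 → Fin 3 → 𝕜) (dL : Fin 3 → Fin 3 → 𝕜) (b : Fin 3 → Fin 3 → 𝕜)
    (l i j k : Fin 3) :
    curv (fun i j k => τ (σ i) (σ j) (σ k)) (fun i => L (σ i))
      (fun l i j k => dτ (σ l) (σ i) (σ j) (σ k)) (fun l i => dL (σ l) (σ i))
      (fun i j => b (σ i) (σ j)) l i j k = curv τ L dτ dL b (σ l) (σ i) (σ j) (σ k) := by
  have h (l : Fin 3) : connM (fun i j k => τ (σ i) (σ j) (σ k)) (fun i => L (σ i))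
      (fun i j => b (σ i) (σ j)) l = fun j k => connM τ L b (σ l) (σ j) (σ k) := by
    funext j k
    exact connM_perm ..
  simp only [curv, h]
  rw [connM_perm σ (dτ (σ l)) (dL (σ l)), connM_perm σ (dτ (σ i)) (dL (σ i)),
    connM_perm σ τ L (connM τ L b (σ l)), connM_perm σ τ L (connM τ L b (σ i))]

theorem symUnit_perm (σ : Equiv.Perm (Fin 3)) (b c j k : Fin 3) :
    symUnit (𝕜 := 𝕜) (σ b) (σ c) (σ j) (σ k) = symUnit b c j k := by
  simp only [symUnit, σ.injective.eq_iff]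

theorem IsPotentialTensor.perm (σ : Equiv.Perm (Fin 3)) {τ : Fin 3 → Fin 3 → Fin 3 → 𝕜}
    (h : IsPotentialTensor τ) : IsPotentialTensor (fun i j k => τ (σ i) (σ j) (σ k)) where
  symm i j k := h.symm _ _ _
  trace k := by
    rw [Equiv.sum_comp σ (fun i => τ i i (σ k))]
    exact h.trace _
  mixed i j k := by
    have := h.mixed (σ i) (σ j) (σ k)
    rw [← Equiv.sum_comp σ (fun l => τ l (σ k) l),
      ← Equiv.sum_comp σ (fun l => τ l (σ j) l)] at this
    simpa only [σ.injective.eq_iff] using this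

theorem PotIntegrable.perm (σ : Equiv.Perm (Fin 3)) {τ : Fin 3 → Fin 3 → Fin 3 → 𝕜}
    {dτ : Fin 3 → Fin 3 → Fin 3 → Fin 3 → 𝕜} (h : PotIntegrable τ dτ) :
    PotIntegrable (fun i j k => τ (σ i) (σ j) (σ k))
      (fun l i j k => dτ (σ l) (σ i) (σ j) (σ k)) := by
  intro i j k m
  have := h (σ i) (σ j) (σ k) (σ m)
  simp only [σ.injective.eq_iff] at this
  have hn (a b c d : Fin 3) : ∑ n, τ a b (σ n) * τ (σ n) c d = ∑ n, τ a b n * τ n c d :=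
    Equiv.sum_comp σ (fun n => τ a b n * τ n c d)
  have hl (k m : Fin 3) : ∑ l, (dτ (σ l) (σ l) k m + ∑ n, τ (σ l) k n * τ n (σ l) m) =
      ∑ l, (dτ l l k m + ∑ n, τ l k n * τ n l m) :=
    Equiv.sum_comp σ (fun l => dτ l l k m + ∑ n, τ l k n * τ n l m)
  simpa only [hn, hl] using this

theorem exists_perm_of_ne {x y z : Fin 3} (hxy : x ≠ y) (hxz : x ≠ z) (hyz : y ≠ z) :
    ∃ σ : Equiv.Perm (Fin 3), σ 0 = x ∧ σ 1 = y ∧ σ 2 = z := by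
  revert x y z
  decide

/-- The curvature of the total system of second order constants satisfies the linear relations, as a
consequence of the integrability conditions of the potential equations. -/
theorem curvRelations {τ : Fin 3 → Fin 3 → Fin 3 → 𝕜} (L : Fin 3 → 𝕜)
    {dτ : Fin 3 → Fin 3 → Fin 3 → Fin 3 → 𝕜} {dL : Fin 3 → Fin 3 → 𝕜} (hτ : IsPotentialTensor τ)
    (hdτ : ∀ l, IsPotentialTensor (dτ l)) (hdL : ∀ i j, dL i j = dL j i)
    (hE : PotIntegrable τ dτ) {x y z : Fin 3} (hxy : x ≠ y) (hxz : x ≠ z) (hyz : y ≠ z) :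
    CurvRelations (fun b c => curv τ L dτ dL (symUnit b c)) x y z := by
  obtain ⟨σ, rfl, rfl, rfl⟩ := exists_perm_of_ne hxy hxz hyz
  obtain ⟨s, u, hs⟩ := (hτ.perm σ).exists_eq
  choose ds du hd using fun l => ((hdτ (σ l)).perm σ).exists_eq
  have hE' := hE.perm σ
  have key := curvRelations_structT (s := s) (u := u) (L := fun i => L (σ i)) (ds := ds) (du := du)
    (dL := fun l i => dL (σ l) (σ i)) (fun i j => hdL _ _)
    (by rw [← hs]; simpa only [← hd] using hE')
  have hR : (fun b c => curv (structT s u) (fun i => L (σ i)) (fun l => structT (ds l) (du l))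
      (fun l i => dL (σ l) (σ i)) (symUnit b c)) =
      fun b c l i j k => curv τ L dτ dL (symUnit (σ b) (σ c)) (σ l) (σ i) (σ j) (σ k) := by
    funext b c l i j k
    rw [← curv_perm, ← hs]
    simp only [← hd, symUnit_perm]
  rw [hR] at key
  exact ⟨key.1, key.2, key.3, key.4, key.5, key.6, key.7, key.8, key.9, key.10, key.11, key.12,
    key.13, key.14, key.15, key.16, key.17, key.18, key.19, key.20, key.21, key.22, key.23⟩

section

theorem connM_add (τ : Fin 3 → Fin 3 → Fin 3 → 𝕜) (L : Fin 3 → 𝕜) (b b' : Fin 3 → Fin 3 → 𝕜) :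
    connM τ L (b + b') = connM τ L b + connM τ L b' := by
  funext i j k
  simp only [connM, Pi.add_apply, Fin.sum_univ_three]
  split_ifs <;> ring

theorem connM_smul (τ : Fin 3 → Fin 3 → Fin 3 → 𝕜) (L : Fin 3 → 𝕜) (c : 𝕜)
    (b : Fin 3 → Fin 3 → 𝕜) : connM τ L (c • b) = c • connM τ L b := by
  funext i j k
  simp only [connM, Pi.smul_apply, smul_eq_mul, Fin.sum_univ_three]
  split_ifs <;> ring

theorem connM_symm (τ : Fin 3 → Fin 3 → Fin 3 → 𝕜) (L : Fin 3 → 𝕜) {b : Fin 3 → Fin 3 → 𝕜}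
    (hb : ∀ j k, b j k = b k j) (i j k : Fin 3) : connM τ L b i j k = connM τ L b i k j := by
  simp only [connM, hb k j, eq_comm (a := k) (b := j), Fin.sum_univ_three]
  split_ifs <;> ring

section

variable (τ : Fin 3 → Fin 3 → Fin 3 → 𝕜) (L : Fin 3 → 𝕜) (dτ : Fin 3 → Fin 3 → Fin 3 → Fin 3 → 𝕜)
  (dL : Fin 3 → Fin 3 → 𝕜)

theorem curv_add (b b' : Fin 3 → Fin 3 → 𝕜) :
    curv τ L dτ dL (b + b') = curv τ L dτ dL b + curv τ L dτ dL b' := by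
  funext l i j k
  simp only [curv, connM_add, Pi.add_apply]
  ring

theorem curv_smul (c : 𝕜) (b : Fin 3 → Fin 3 → 𝕜) :
    curv τ L dτ dL (c • b) = c • curv τ L dτ dL b := by
  funext l i j k
  simp only [curv, connM_smul, Pi.smul_apply, smul_eq_mul]
  ring

theorem curv_symm {b : Fin 3 → Fin 3 → 𝕜} (hb : ∀ j k, b j k = b k j) (l i j k : Fin 3) :
    curv τ L dτ dL b l i j k = curv τ L dτ dL b l i k j := by
  simp only [curv, connM_symm _ _ hb _ j k,
    connM_symm τ L (fun _ _ => connM_symm _ _ hb _ _ _) _ j k]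

theorem curv_antisymm (b : Fin 3 → Fin 3 → 𝕜) (l i j k : Fin 3) :
    curv τ L dτ dL b l i j k = -curv τ L dτ dL b i l j k := by
  simp only [curv]
  ring

end

theorem symUnit_symm (b c j k : Fin 3) : symUnit (𝕜 := 𝕜) b c j k = symUnit b c k j := by
  simp only [symUnit]
  congr 1
  simp only [and_comm, or_comm]

theorem symUnit_comm (b c : Fin 3) : symUnit (𝕜 := 𝕜) b c = symUnit c b := by
  funext j k
  simp only [symUnit, or_comm]

theorem eq_sum_symUnit {b : Fin 3 → Fin 3 → 𝕜} (hb : ∀ j k, b j k = b k j) :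
    b = b 0 0 • symUnit 0 0 + b 1 1 • symUnit 1 1 + b 2 2 • symUnit 2 2 + b 0 1 • symUnit 0 1 +
      b 0 2 • symUnit 0 2 + b 1 2 • symUnit 1 2 := by
  funext j k
  fin_cases j <;> fin_cases k <;> simp [symUnit, hb 1 0, hb 2 0, hb 2 1]

/-- If any two symmetric tensors have a nontrivial combination in the kernel of the curvature, so
that the curvature has rank at most one on symmetric tensors, then the curvature vanishes. -/
theorem curv_eq_zero {τ : Fin 3 → Fin 3 → Fin 3 → 𝕜} (L : Fin 3 → 𝕜)
    {dτ : Fin 3 → Fin 3 → Fin 3 → Fin 3 → 𝕜} {dL : Fin 3 → Fin 3 → 𝕜} (hτ : IsPotentialTensor τ)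
    (hdτ : ∀ l, IsPotentialTensor (dτ l)) (hdL : ∀ i j, dL i j = dL j i)
    (hE : PotIntegrable τ dτ)
    (hker : ∀ b b' : Fin 3 → Fin 3 → 𝕜, (∀ j k, b j k = b k j) → (∀ j k, b' j k = b' k j) →
      ∃ c c' : 𝕜, (c ≠ 0 ∨ c' ≠ 0) ∧ curv τ L dτ dL (c • b + c' • b') = 0)
    {b : Fin 3 → Fin 3 → 𝕜} (hb : ∀ j k, b j k = b k j) : curv τ L dτ dL b = 0 := by
  have h0 : ∀ b c, curv τ L dτ dL (symUnit b c) = 0 := by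
    intro b c
    funext l i j k
    refine CurvRelations.eq_zero (R := fun b c => curv τ L dτ dL (symUnit b c))
      (fun x y z => curvRelations L hτ hdτ hdL hE) (fun b c l i j k => by rw [symUnit_comm])
      (fun b c l i j k => curv_symm _ _ _ _ (symUnit_symm b c) _ _ _ _)
      (fun b c l i j k => curv_antisymm _ _ _ _ _ _ _ _ _) ?_ b c l i j k
    intro b c l i j k b' c' l' i' j' k'
    obtain ⟨e, e', he, h⟩ := hker _ _ (symUnit_symm b c) (symUnit_symm b' c')
    rw [curv_add, curv_smul, curv_smul] at h
    have h1 := congr_fun (congr_fun (congr_fun (congr_fun h l) i) j) k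
    have h2 := congr_fun (congr_fun (congr_fun (congr_fun h l') i') j') k'
    simp only [Pi.add_apply, Pi.smul_apply, smul_eq_mul, Pi.zero_apply] at h1 h2
    rcases he with he | he <;> apply mul_left_cancel₀ he
    · linear_combination curv τ L dτ dL (symUnit b' c') l' i' j' k' * h1 -
        curv τ L dτ dL (symUnit b' c') l i j k * h2
    · linear_combination curv τ L dτ dL (symUnit b c) l i j k * h2 -
        curv τ L dτ dL (symUnit b c) l' i' j' k' * h1
  rw [eq_sum_symUnit hb]
  simp only [curv_add, curv_smul, h0, smul_zero, add_zero]

/-! ### Second order constants as solutions of a total system -/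

/-- The Poisson bracket with the Hamiltonian, as a differential operator. -/
theorem System.IsConformallyFlat.poissonBracket_hamiltonian {S : System 𝕜}
    (hS : S.IsConformallyFlat) {V : Pt 𝕜 → 𝕜} (hV : AnalyticOnNhd 𝕜 V S.domain) {x : Pt 𝕜}
    (hx : x ∈ S.domain) (G : Pt 𝕜 → Pt 𝕜 → 𝕜) (p : Pt 𝕜) :
    poissonBracket (S.hamiltonian V) G x p =
      ∑ j, ((pd j V x - (∑ i, p i ^ 2) * pd j S.lam x / S.lam x ^ 2) * pd j (fun q => G x q) p -
        2 * p j / S.lam x * pd j (fun y => G y p) x) := by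
  have hl := (hS.analytic_lam x hx).differentiableAt
  have h0 := hS.lam_ne_zero x hx
  have hinv : DifferentiableAt 𝕜 (fun y => (S.lam y)⁻¹) x := hl.inv h0
  have h1 (j : Fin 3) : pd j (fun y => S.hamiltonian V y p) x =
      pd j V x - (∑ i, p i ^ 2) * pd j S.lam x / S.lam x ^ 2 := by
    simp only [System.hamiltonian, System.freeHamiltonian, div_eq_mul_inv]
    rw [pd_add j (hinv.const_mul _) (hV x hx).differentiableAt, pd_const_mul j _ hinv,
      pd_inv j hl h0]
    ring
  have h2 (j : Fin 3) : pd j (fun q => S.hamiltonian V x q) p = 2 * p j / S.lam x := by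
    have hd (i : Fin 3) : DifferentiableAt 𝕜 (fun q : Pt 𝕜 => q i ^ 2) p := by fun_prop
    have : (fun q : Pt 𝕜 => S.hamiltonian V x q) =
        fun q => (S.lam x)⁻¹ * ∑ i, q i ^ 2 + V x := by
      funext q
      simp only [System.hamiltonian, System.freeHamiltonian, div_eq_mul_inv, mul_comm]
    rw [this, pd_add j (by fun_prop) (by fun_prop), pd_const, pd_const_mul j _ (by fun_prop),
      pd_sum _ j (fun i _ => hd i)]
    have (i : Fin 3) : pd j (fun q : Pt 𝕜 => q i ^ 2) p = 2 * p i * if i = j then 1 else 0 := by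
      rw [pd_pow j 2 (by fun_prop), pd_coord]
      simp
    simp only [this, mul_ite, mul_one, mul_zero, Finset.sum_ite_eq', Finset.mem_univ, if_true,
      add_zero]
    ring
  simp only [poissonBracket, h1, h2]

theorem pd_quadForm_right (j : Fin 3) (a : Pt 𝕜 → Fin 3 → Fin 3 → 𝕜) (x p : Pt 𝕜) (w : 𝕜) :
    pd j (fun q => quadForm a x q + w) p = ∑ k, (a x j k + a x k j) * p k := by
  have hd (k l : Fin 3) : DifferentiableAt 𝕜 (fun q : Pt 𝕜 => a x k l * q k * q l) p := by fun_prop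
  have hq (k l : Fin 3) : pd j (fun q : Pt 𝕜 => a x k l * q k * q l) p =
      a x k l * ((if k = j then 1 else 0) * p l + p k * if l = j then 1 else 0) := by
    simp only [mul_assoc]
    rw [pd_const_mul j _ (by fun_prop), pd_mul j (by fun_prop) (by fun_prop), pd_coord, pd_coord]
  have hs (k : Fin 3) : DifferentiableAt 𝕜 (fun q : Pt 𝕜 => ∑ l, a x k l * q k * q l) p := by
    fun_prop
  unfold quadForm
  rw [pd_add j (by fun_prop) (by fun_prop), pd_const, pd_sum _ j (fun k _ => hs k)]
  simp only [pd_sum _ j (fun l _ => hd _ l), hq]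
  fin_cases j <;> simp [Fin.sum_univ_three] <;> ring

theorem pd_quadForm_left (j : Fin 3) {a : Pt 𝕜 → Fin 3 → Fin 3 → 𝕜} {W : Pt 𝕜 → 𝕜} {x : Pt 𝕜}
    (ha : ∀ k l, DifferentiableAt 𝕜 (fun y => a y k l) x) (hW : DifferentiableAt 𝕜 W x)
    (p : Pt 𝕜) :
    pd j (fun y => quadForm a y p + W y) x =
      (∑ k, ∑ l, pd j (fun y => a y k l) x * p k * p l) + pd j W x := by
  have hd (k l : Fin 3) : DifferentiableAt 𝕜 (fun y => p k * p l * a y k l) x :=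
    (ha k l).const_mul _
  have hs (k : Fin 3) : DifferentiableAt 𝕜 (fun y => ∑ l, p k * p l * a y k l) x := by
    fun_prop
  have : (fun y => quadForm a y p + W y) = fun y => (∑ k, ∑ l, p k * p l * a y k l) + W y := by
    funext y
    simp only [quadForm]
    congr 1
    exact Finset.sum_congr rfl fun k _ => Finset.sum_congr rfl fun l _ => by ring
  rw [this, pd_add j (by fun_prop) hW, pd_sum _ j (fun k _ => hs k)]
  simp only [pd_sum _ j (fun l _ => hd _ l), pd_const_mul j _ (ha _ _)]
  congr 1
  exact Finset.sum_congr rfl fun k _ => Finset.sum_congr rfl fun l _ => by ring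

/-- The symmetric coefficients of a vanishing cubic form vanish. -/
theorem cubicForm_coeff_eq_zero {c : Fin 3 → Fin 3 → Fin 3 → 𝕜}
    (h : ∀ p : Fin 3 → 𝕜, ∑ i, ∑ j, ∑ k, c i j k * p i * p j * p k = 0) (i j k : Fin 3) :
    c i j k + c i k j + c j i k + c j k i + c k i j + c k j i = 0 := by
  let e : Fin 3 → Fin 3 → 𝕜 := fun i => Pi.single i 1
  have key (p q r : Fin 3 → 𝕜) : ∑ i, ∑ j, ∑ k, c i j k * (p i * q j * r k + p i * r j * q k +
      q i * p j * r k + q i * r j * p k + r i * p j * q k + r i * q j * p k) = 0 := by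
    have h1 := h (p + q + r)
    have h2 := h (p + q)
    have h3 := h (p + r)
    have h4 := h (q + r)
    have h5 := h p
    have h6 := h q
    have h7 := h r
    simp only [Pi.add_apply] at h1 h2 h3 h4
    calc _ = (∑ i, ∑ j, ∑ k, c i j k * (p i + q i + r i) * (p j + q j + r j) * (p k + q k + r k)) -
        (∑ i, ∑ j, ∑ k, c i j k * (p i + q i) * (p j + q j) * (p k + q k)) -
        (∑ i, ∑ j, ∑ k, c i j k * (p i + r i) * (p j + r j) * (p k + r k)) -
        (∑ i, ∑ j, ∑ k, c i j k * (q i + r i) * (q j + r j) * (q k + r k)) +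
        (∑ i, ∑ j, ∑ k, c i j k * p i * p j * p k) + (∑ i, ∑ j, ∑ k, c i j k * q i * q j * q k) +
        (∑ i, ∑ j, ∑ k, c i j k * r i * r j * r k) := by
          simp only [← Finset.sum_sub_distrib, ← Finset.sum_add_distrib]
          exact Finset.sum_congr rfl fun i _ => Finset.sum_congr rfl fun j _ =>
            Finset.sum_congr rfl fun k _ => by ring
      _ = 0 := by rw [h1, h2, h3, h4, h5, h6, h7]; ring
  have := key (e i) (e j) (e k)
  simp only [e, mul_add, Finset.sum_add_distrib, Pi.single_apply, mul_ite, mul_one, mul_zero,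
    Finset.sum_ite_eq', Finset.mem_univ, if_true] at this
  rw [← this]

end

section

theorem IsPotentialTensor.sub_eq {τ : Fin 3 → Fin 3 → Fin 3 → 𝕜} (hτ : IsPotentialTensor τ)
    (i j k : Fin 3) : τ i j k = τ i k j + ((if i = k then (∑ l, τ l j l) / 2 else 0) -
      if i = j then (∑ l, τ l k l) / 2 else 0) := by
  linear_combination hτ.mixed i j k

/-- The part of `M(b)` antisymmetric in the first two indices. It makes the one-form
`∑ bⱼₖ ∂ₖV` closed for every potential `V`. -/
theorem connM_sub {τ : Fin 3 → Fin 3 → Fin 3 → 𝕜} (hτ : IsPotentialTensor τ) (L : Fin 3 → 𝕜)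
    {b : Fin 3 → Fin 3 → 𝕜} (hb : ∀ j k, b j k = b k j) (i j m : Fin 3) :
    connM τ L b i j m - connM τ L b j i m = ∑ k, (b i k * τ k j m - b j k * τ k i m) := by
  have hc (a i j : Fin 3) : ∑ k, b a k * τ k i j = ∑ k, b a k * τ k j i +
      (b a j * ((∑ l, τ l i l) / 2) - b a i * ((∑ l, τ l j l) / 2)) := by
    simp only [hτ.sub_eq _ i j, mul_add, mul_sub, Finset.sum_add_distrib, Finset.sum_sub_distrib,
      mul_ite, mul_zero, Finset.sum_ite_eq', Finset.mem_univ, if_true]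
  have e1 := hc i m j
  have e2 := hc j m i
  have e3 := hc m i j
  simp only [connM, Finset.sum_sub_distrib, Finset.sum_add_distrib, mul_add, hb j i,
    eq_comm (a := j) (b := i)]
  simp only [hb j i, hb m i, hb m j] at e1 e2 e3
  linear_combination (1 / 3) * (e1 - e2 - e3)

/-- The totally symmetric part of `M(b)`. It expresses that `b / λ` is a Killing tensor of the
metric with conformal factor `λ`. -/
theorem connM_cyclic (τ : Fin 3 → Fin 3 → Fin 3 → 𝕜) (L : Fin 3 → 𝕜) {b : Fin 3 → Fin 3 → 𝕜}
    (hb : ∀ j k, b j k = b k j) (i j k : Fin 3) :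
    connM τ L b i j k + connM τ L b j k i + connM τ L b k i j =
      L i * b j k + L j * b i k + L k * b i j - (if j = k then ∑ m, b i m * L m else 0) -
        (if i = k then ∑ m, b j m * L m else 0) - (if i = j then ∑ m, b k m * L m else 0) := by
  simp only [connM, Finset.sum_sub_distrib, Finset.sum_add_distrib, mul_add, hb j i, hb k i, hb k j,
    eq_comm (a := j) (b := i), eq_comm (a := k) (b := i), eq_comm (a := k) (b := j)]
  ring

theorem System.IsStructureTensor.isPotentialTensor {S : System 𝕜}
    {T : Fin 3 → Fin 3 → Fin 3 → Pt 𝕜 → 𝕜} (hT : S.IsStructureTensor T) (hD : IsOpen S.domain)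
    {x : Pt 𝕜} (hx : x ∈ S.domain) : IsPotentialTensor (fun i j k => T i j k x) where
  symm i j k := hT.symm i j k x
  trace k := hT.trace k x
  mixed i j k := (hT.integrability hD hx i j k).1

theorem System.IsStructureTensor.isPotentialTensor_pd {S : System 𝕜}
    {T : Fin 3 → Fin 3 → Fin 3 → Pt 𝕜 → 𝕜} (hT : S.IsStructureTensor T) (hD : IsOpen S.domain)
    {x : Pt 𝕜} (hx : x ∈ S.domain) (l : Fin 3) :
    IsPotentialTensor (fun i j k => pd l (T i j k) x) where
  symm i j k := pd_congr l hD (fun y _ => hT.symm i j k y) hx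
  trace k := by
    rw [← pd_sum _ l fun i _ => (hT.analytic i i k x hx).differentiableAt,
      pd_congr l hD (fun y _ => hT.trace k y) hx, pd_const]
  mixed i j k := by
    have hd (i j k : Fin 3) := (hT.analytic i j k x hx).differentiableAt
    have h2 (j k : Fin 3) : pd l (fun y => ∑ m, T m j m y) x = ∑ m, pd l (T m j m) x :=
      pd_sum _ l fun i _ => hd _ _ _
    have hs (j : Fin 3) : DifferentiableAt 𝕜 (fun y => 2⁻¹ * ∑ m, T m j m y) x := by fun_prop
    have key (i j k : Fin 3) :
        pd l (fun y => (if i = j then (∑ m, T m k m y) / 2 else 0) + T i j k y) x =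
          (if i = j then (∑ m, pd l (T m k m) x) / 2 else 0) + pd l (T i j k) x := by
      split_ifs with h
      · simp only [div_eq_inv_mul]
        rw [pd_add l (hs k) (hd i j k), pd_const_mul l _ (by fun_prop),
          pd_sum _ l fun i _ => hd _ _ _]
      · simp only [zero_add]
    rw [← key i j k, ← key i k j]
    exact pd_congr l hD (fun y hy => (hT.integrability hD hy i j k).1) hx

theorem System.IsStructureTensor.potIntegrable {S : System 𝕜}
    {T : Fin 3 → Fin 3 → Fin 3 → Pt 𝕜 → 𝕜} (hT : S.IsStructureTensor T) (hD : IsOpen S.domain)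
    {x : Pt 𝕜} (hx : x ∈ S.domain) :
    PotIntegrable (fun i j k => T i j k x) (fun l i j k => pd l (T i j k) x) := fun i j k m =>
  (hT.integrability hD hx i j k).2 m

/-- The logarithmic gradient of the conformal factor. -/
def System.logGrad (S : System 𝕜) (x : Pt 𝕜) (i : Fin 3) : 𝕜 := pd i S.lam x / S.lam x

/-- The symmetric tensor fields `b` that solve `∂ᵢ bⱼₖ = M(b)ᵢⱼₖ`. They are the tensors `λ a` for
the second order constants `∑ aʲᵏ pⱼ pₖ + W`. -/
structure System.IsTensorSolution (S : System 𝕜) (T : Fin 3 → Fin 3 → Fin 3 → Pt 𝕜 → 𝕜)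
    (b : Pt 𝕜 → Fin 3 → Fin 3 → 𝕜) : Prop where
  analytic : ∀ j k, AnalyticOnNhd 𝕜 (fun x => b x j k) S.domain
  symm : ∀ x ∈ S.domain, ∀ j k, b x j k = b x k j
  pd_eq : ∀ x ∈ S.domain, ∀ i j k, pd i (fun y => b y j k) x =
    connM (fun i j k => T i j k x) (S.logGrad x) (b x) i j k

variable {S : System 𝕜} {T : Fin 3 → Fin 3 → Fin 3 → Pt 𝕜 → 𝕜}

theorem System.poissonBracket_hamiltonian_quadForm (hS : S.IsConformallyFlat)
    {a : Pt 𝕜 → Fin 3 → Fin 3 → 𝕜} {W V : Pt 𝕜 → 𝕜}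
    (ha : ∀ k j, AnalyticOnNhd 𝕜 (fun x => a x k j) S.domain)
    (hs : ∀ x ∈ S.domain, ∀ k j, a x k j = a x j k) (hW : AnalyticOnNhd 𝕜 W S.domain)
    (hV : AnalyticOnNhd 𝕜 V S.domain) {x : Pt 𝕜} (hx : x ∈ S.domain) (p : Pt 𝕜) :
    poissonBracket (S.hamiltonian V) (fun y q => quadForm a y q + W y) x p =
      2 * ∑ m, (∑ j, pd j V x * a x j m - pd m W x / S.lam x) * p m -
      2 / S.lam x * ∑ i, ∑ j, ∑ k, (pd i (fun y => a y j k) x +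
        if i = j then (∑ m, S.logGrad x m * a x m k) else 0) * p i * p j * p k := by
  have h0 := hS.lam_ne_zero x hx
  rw [hS.poissonBracket_hamiltonian hV hx]
  simp only [pd_quadForm_right, pd_quadForm_left _ (fun k l => (ha k l x hx).differentiableAt)
    (hW x hx).differentiableAt, System.logGrad, hs x hx 1 0, hs x hx 2 0, hs x hx 2 1,
    Fin.sum_univ_three]
  simp
  field_simp
  ring

/-- The equations for the coefficients of a second order constant: `∂W` is determined by the tensor
`a`, and `a` is a Killing tensor. -/
theorem System.IsSecondOrderConstant.coeff_eqs (hS : S.IsConformallyFlat)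
    {a : Pt 𝕜 → Fin 3 → Fin 3 → 𝕜} {W : S.pot → Pt 𝕜 → 𝕜} (h : S.IsSecondOrderConstant a W)
    {x : Pt 𝕜} (hx : x ∈ S.domain) (V : S.pot) :
    (∀ m, pd m (W V) x = S.lam x * ∑ j, a x m j * pd j V.1 x) ∧
    ∀ i j k, pd i (fun y => a y j k) x + pd j (fun y => a y i k) x + pd k (fun y => a y i j) x +
      ((if i = j then (∑ m, S.logGrad x m * a x m k) else 0) +
        (if i = k then (∑ m, S.logGrad x m * a x m j) else 0) +
        (if j = k then (∑ m, S.logGrad x m * a x m i) else 0)) = 0 := by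
  have h0 := hS.lam_ne_zero x hx
  have key := fun p => (System.poissonBracket_hamiltonian_quadForm hS h.analytic_a h.symm
    (h.analytic_W V) (S.analytic_pot V V.2) hx p).symm.trans (h.bracket_eq_zero V x hx p)
  set ω := fun m => ∑ j, pd j V.1 x * a x j m - pd m (W V) x / S.lam x with hω
  set c := fun i j k => pd i (fun y => a y j k) x +
        if i = j then (∑ m, S.logGrad x m * a x m k) else 0 with hc
  have key' : ∀ p : Pt 𝕜, 2 * ∑ m, ω m * p m -
      2 / S.lam x * ∑ i, ∑ j, ∑ k, c i j k * p i * p j * p k = 0 := key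
  -- the two homogeneous parts are separated by rescaling the momentum
  have hlin : ∀ p : Pt 𝕜, ∑ m, ω m * p m = 0 := by
    intro p
    have h1 := key' p
    have h2 := key' (fun i => 2 * p i)
    have e1 : ∑ m, ω m * (2 * p m) = 2 * ∑ m, ω m * p m := by
      rw [Finset.mul_sum]
      exact Finset.sum_congr rfl fun m _ => by ring
    have e2 : ∑ i, ∑ j, ∑ k, c i j k * (2 * p i) * (2 * p j) * (2 * p k) =
        8 * ∑ i, ∑ j, ∑ k, c i j k * p i * p j * p k := by
      simp only [Finset.mul_sum]
      exact Finset.sum_congr rfl fun i _ => Finset.sum_congr rfl fun j _ =>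
        Finset.sum_congr rfl fun k _ => by ring
    simp only [e1, e2] at h2
    linear_combination (8 * h1 - h2) / 12
  have hcub : ∀ p : Pt 𝕜, ∑ i, ∑ j, ∑ k, c i j k * p i * p j * p k = 0 := by
    intro p
    have h1 := key' p
    rw [hlin p, mul_zero, zero_sub, neg_eq_zero] at h1
    exact (mul_eq_zero.1 h1).resolve_left (div_ne_zero two_ne_zero h0)
  refine ⟨fun m => ?_, fun i j k => ?_⟩
  · have := hlin (Pi.single m 1)
    simp only [Pi.single_apply, mul_ite, mul_one, mul_zero, Finset.sum_ite_eq', Finset.mem_univ,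
      if_true, hω, sub_eq_zero] at this
    rw [eq_div_iff h0] at this
    rw [← this, mul_comm]
    congr 1
    exact Finset.sum_congr rfl fun j _ => by rw [h.symm x hx m j, mul_comm]
  · have := cubicForm_coeff_eq_zero hcub i j k
    have hpa (i j k : Fin 3) : pd i (fun y => a y j k) x = pd i (fun y => a y k j) x :=
      pd_congr i hS.isOpen (fun y hy => h.symm y hy j k) hx
    simp only [hc, eq_comm (a := j) (b := i), eq_comm (a := k) (b := i),
      eq_comm (a := k) (b := j)] at this
    rw [hpa i k j, hpa j k i, hpa k j i] at this
    linear_combination this / 2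

/-- The Killing equations give the totally symmetric part of `∂b`, `b = λ a`. The rest is given by
the closedness of `dW` for the potentials, whose gradients are arbitrary at a point. -/
theorem System.IsSecondOrderConstant.isTensorSolution (hS : S.IsConformallyFlat)
    (hT : S.IsStructureTensor T) {a : Pt 𝕜 → Fin 3 → Fin 3 → 𝕜} {W : S.pot → Pt 𝕜 → 𝕜}
    (h : S.IsSecondOrderConstant a W) :
    S.IsTensorSolution T (fun x j k => S.lam x * a x j k) where
  analytic j k x hx := (hS.analytic_lam x hx).fun_mul (h.analytic_a j k x hx)
  symm x hx j k := by rw [h.symm x hx]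
  pd_eq x hx := by
    have h0 := hS.lam_ne_zero x hx
    have hb (j k : Fin 3) : AnalyticAt 𝕜 (fun y => S.lam y * a y j k) x :=
      (hS.analytic_lam x hx).fun_mul (h.analytic_a j k x hx)
    have hbs (j k : Fin 3) : S.lam x * a x j k = S.lam x * a x k j := by rw [h.symm x hx]
    set X := fun i j k => pd i (fun y => S.lam y * a y j k) x with hX
    set M := connM (fun i j k => T i j k x) (S.logGrad x) (fun j k => S.lam x * a x j k) with hM
    have hXs (i j k : Fin 3) : X i j k = X i k j :=
      pd_congr i hS.isOpen (fun y hy => by rw [h.symm y hy]) hx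
    have hXa (i j k : Fin 3) : X i j k = pd i S.lam x * a x j k +
        S.lam x * pd i (fun y => a y j k) x :=
      pd_mul i (hS.analytic_lam x hx).differentiableAt (h.analytic_a j k x hx).differentiableAt
    -- the closedness of `dW` for a potential with the gradient `e_m` and `h = 0`
    have hclosed (i j m : Fin 3) : X i j m - X j i m =
        ∑ k, (S.lam x * a x i k * T k j m x - S.lam x * a x j k * T k i m x) := by
      obtain ⟨V, hV, -, hg, hh⟩ := hT.exists_jet x hx 0 (Pi.single m 1) 0
      have hVa := S.analytic_pot V hV
      have hd (i j : Fin 3) : pd i (pd j (W ⟨V, hV⟩)) x =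
          X i j m + ∑ k, S.lam x * a x j k * T i k m x := by
        rw [pd_congr i hS.isOpen (fun y hy => ((h.coeff_eqs hS hy ⟨V, hV⟩).1 j).trans
          (Finset.mul_sum _ _ _)) hx]
        have : (fun y => ∑ k, S.lam y * (a y j k * pd k V y)) =
          fun y => ∑ k, (S.lam y * a y j k) * pd k V y := by
            funext y; exact Finset.sum_congr rfl fun k _ => by ring
        rw [this, pd_sum _ i fun k _ =>
          ((hb j k).fun_mul (analyticAt_pd k (hVa x hx))).differentiableAt]
        simp only [pd_mul i (hb j _).differentiableAt
          (analyticAt_pd _ (hVa x hx)).differentiableAt, hg, hh, Finset.sum_add_distrib]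
        simp [Pi.single_apply, hX]
      have := pd_comm i j (h.analytic_W ⟨V, hV⟩ x hx)
      rw [hd, hd] at this
      rw [Finset.sum_sub_distrib]
      simp only [hT.symm _ j, hT.symm _ i]
      linear_combination this
    have hMs := connM_sub (hT.isPotentialTensor hS.isOpen hx) (S.logGrad x) hbs
    have hMj := connM_symm (fun i j k => T i j k x) (S.logGrad x) hbs
    have hMc := connM_cyclic (fun i j k => T i j k x) (S.logGrad x) hbs
    have hXc (i j k : Fin 3) : X i j k + X j k i + X k i j = M i j k + M j k i + M k i j := by
      obtain ⟨V, hV, -⟩ := hT.exists_jet x hx 0 0 0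
      have h1 := (h.coeff_eqs hS hx ⟨V, hV⟩).2 i j k
      have hL (i : Fin 3) : pd i S.lam x = S.lam x * S.logGrad x i := by
        rw [System.logGrad]; field_simp
      have hv (i : Fin 3) : ∑ m, S.lam x * a x i m * S.logGrad x m =
          S.lam x * ∑ m, S.logGrad x m * a x m i := by
        rw [Finset.mul_sum]
        exact Finset.sum_congr rfl fun m _ => by rw [h.symm x hx]; ring
      have hpa (i j k : Fin 3) : pd i (fun y => a y j k) x = pd i (fun y => a y k j) x :=
        pd_congr i hS.isOpen (fun y hy => h.symm y hy j k) hx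
      rw [hMc, hXa, hXa, hXa, hpa j k i, h.symm x hx k i]
      simp only [hv, hL]
      have hite (c d : 𝕜) (q : Prop) [Decidable q] :
        (if q then c * d else 0) = c * if q then d else 0 := by split_ifs <;> simp
      simp only [hite]
      linear_combination S.lam x * h1
    intro i j k
    show X i j k = M i j k
    have e1 := hclosed i j k
    have e2 := hclosed i k j
    rw [← hMs i j k] at e1
    rw [← hMs i k j] at e2
    have e3 := hXc i j k
    linear_combination (1 / 3) * (e3 + e1 + e2 + hXs j i k - hMj j i k + hXs i j k - hMj i j k)

end

section

variable {S : System 𝕜} {T : Fin 3 → Fin 3 → Fin 3 → Pt 𝕜 → 𝕜}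

theorem cubicForm_eq_zero_of_cyclic {c : Fin 3 → Fin 3 → Fin 3 → 𝕜}
    (h : ∀ i j k, c i j k + c j k i + c k i j = 0) (p : Fin 3 → 𝕜) :
    ∑ i, ∑ j, ∑ k, c i j k * p i * p j * p k = 0 := by
  have h3 : 3 * ∑ i, ∑ j, ∑ k, c i j k * p i * p j * p k =
      ∑ i, ∑ j, ∑ k, (c i j k + c j k i + c k i j) * p i * p j * p k := by
    simp only [Fin.sum_univ_three]
    ring
  simp only [h, zero_mul, Finset.sum_const_zero] at h3
  exact (mul_eq_zero.1 h3).resolve_left three_ne_zero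

/-- Every solution `b` of the total system gives a second order constant: the one-form `∑ bⱼₖ ∂ₖV`
is closed, and `W` is a primitive. -/
theorem System.IsTensorSolution.exists_isSecondOrderConstant (hS : S.IsConformallyFlat)
    (hT : S.IsStructureTensor T) {b : Pt 𝕜 → Fin 3 → Fin 3 → 𝕜} (hb : S.IsTensorSolution T b) :
    ∃ W, S.IsSecondOrderConstant (fun x j k => (S.lam x)⁻¹ * b x j k) W := by
  have hω (V : S.pot) (j : Fin 3) :
      AnalyticOnNhd 𝕜 (fun y => ∑ k, b y j k * pd k V.1 y) S.domain := fun x hx =>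
    Finset.analyticAt_fun_sum _ fun k _ =>
      (hb.analytic j k x hx).fun_mul (analyticAt_pd k (S.analytic_pot V V.2 x hx))
  have hex (V : S.pot) : ∃ W : Pt 𝕜 → 𝕜, AnalyticOnNhd 𝕜 W S.domain ∧
      ∀ x ∈ S.domain, ∀ i, pd i W x = ∑ k, b x i k * pd k V.1 x := by
    refine exists_analytic_primitive hS.isOpen hS.convex (hω V) fun x hx i j => ?_
    obtain ⟨h, hh⟩ := ((hT.mem_pot_iff V.1).1 V.2).2 x hx
    have hd (i j : Fin 3) : pd i (fun y => ∑ k, b y j k * pd k V.1 y) x =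
        b x j i * h + ∑ m, (connM (fun i j k => T i j k x) (S.logGrad x) (b x) i j m +
          ∑ k, b x j k * T k i m x) * pd m V.1 x := by
      have hVa (k : Fin 3) := analyticAt_pd k (S.analytic_pot V V.2 x hx)
      rw [pd_sum _ i fun k _ => ((hb.analytic j k x hx).fun_mul (hVa k)).differentiableAt]
      simp only [pd_mul i (hb.analytic j _ x hx).differentiableAt (hVa _).differentiableAt,
        hb.pd_eq x hx, hh, hT.symm _ i, mul_add, Finset.sum_add_distrib, add_mul, mul_ite, mul_zero,
        Finset.sum_ite_eq, Finset.mem_univ, if_true, Finset.mul_sum, Finset.sum_mul]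
      rw [Finset.sum_comm (f := fun k m => b x j k * (T i k m x * pd m V.1 x))]
      simp only [mul_assoc]
      ring
    rw [hd, hd, hb.symm x hx j i]
    congr 1
    refine Finset.sum_congr rfl fun m _ => ?_
    congr 1
    have := connM_sub (hT.isPotentialTensor hS.isOpen hx) (S.logGrad x) (hb.symm x hx) i j m
    rw [Finset.sum_sub_distrib] at this
    linear_combination this
  choose W hWa hW using hex
  have ha (j k : Fin 3) : AnalyticOnNhd 𝕜 (fun x => (S.lam x)⁻¹ * b x j k) S.domain := fun x hx =>
    ((hS.analytic_lam x hx).fun_inv (hS.lam_ne_zero x hx)).fun_mul (hb.analytic j k x hx)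
  have hs : ∀ x ∈ S.domain, ∀ j k, (S.lam x)⁻¹ * b x j k = (S.lam x)⁻¹ * b x k j :=
    fun x hx j k => by rw [hb.symm x hx]
  refine ⟨W, ha, hs, hWa, fun V x hx p => ?_⟩
  have h0 := hS.lam_ne_zero x hx
  rw [System.poissonBracket_hamiltonian_quadForm hS ha hs (hWa V) (S.analytic_pot V V.2) hx]
  have h1 (m : Fin 3) : ∑ j, pd j V.1 x * ((S.lam x)⁻¹ * b x j m) - pd m (W V) x / S.lam x = 0 := by
    rw [hW V x hx, sub_eq_zero, Finset.sum_div]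
    exact Finset.sum_congr rfl fun j _ => by rw [hb.symm x hx j m]; ring
  have h2 (i j k : Fin 3) : pd i (fun y => (S.lam y)⁻¹ * b y j k) x = (S.lam x)⁻¹ *
      (connM (fun i j k => T i j k x) (S.logGrad x) (b x) i j k - S.logGrad x i * b x j k) := by
    have hl := (hS.analytic_lam x hx).differentiableAt
    rw [pd_mul i (hl.fun_inv h0) (hb.analytic j k x hx).differentiableAt, pd_inv i hl h0,
      hb.pd_eq x hx, System.logGrad]
    field_simp
    ring
  rw [cubicForm_eq_zero_of_cyclic]
  · simp [h1]
  intro i j k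
  have hc := connM_cyclic (fun i j k => T i j k x) (S.logGrad x) (hb.symm x hx) i j k
  have hv (k : Fin 3) : ∑ m, S.logGrad x m * ((S.lam x)⁻¹ * b x m k) =
      (S.lam x)⁻¹ * ∑ m, b x k m * S.logGrad x m := by
    rw [Finset.mul_sum]
    exact Finset.sum_congr rfl fun m _ => by rw [hb.symm x hx m k]; ring
  have hite (c d : 𝕜) (q : Prop) [Decidable q] :
    (if q then c * d else 0) = c * if q then d else 0 := by split_ifs <;> simp
  simp only [h2, hv, hite, hb.symm x hx k i, eq_comm (a := k) (b := i)]
  linear_combination (S.lam x)⁻¹ * hc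

theorem System.IsConformallyFlat.analyticOnNhd_logGrad (hS : S.IsConformallyFlat) (i : Fin 3) :
    AnalyticOnNhd 𝕜 (fun x => S.logGrad x i) S.domain := fun x hx =>
  (analyticAt_pd i (hS.analytic_lam x hx)).fun_div (hS.analytic_lam x hx) (hS.lam_ne_zero x hx)

theorem System.IsConformallyFlat.pd_logGrad (hS : S.IsConformallyFlat) {x : Pt 𝕜}
    (hx : x ∈ S.domain) (i j : Fin 3) : pd i (fun y => S.logGrad y j) x =
      pd i (pd j S.lam) x / S.lam x - S.logGrad x i * S.logGrad x j := by
  have h0 := hS.lam_ne_zero x hx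
  have hl := hS.analytic_lam x hx
  simp only [System.logGrad, div_eq_mul_inv]
  rw [pd_mul i (analyticAt_pd j hl).differentiableAt (hl.differentiableAt.fun_inv h0),
    pd_inv i hl.differentiableAt h0]
  field_simp
  ring

theorem System.IsConformallyFlat.pd_logGrad_comm (hS : S.IsConformallyFlat) {x : Pt 𝕜}
    (hx : x ∈ S.domain) (i j : Fin 3) : pd i (fun y => S.logGrad y j) x =
      pd j (fun y => S.logGrad y i) x := by
  rw [hS.pd_logGrad hx, hS.pd_logGrad hx, pd_comm i j (hS.analytic_lam x hx)]
  ring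

theorem pd_connM {T : Fin 3 → Fin 3 → Fin 3 → Pt 𝕜 → 𝕜} {L : Pt 𝕜 → Fin 3 → 𝕜}
    {b : Pt 𝕜 → Fin 3 → Fin 3 → 𝕜} {x : Pt 𝕜} (hT : ∀ i j k, DifferentiableAt 𝕜 (T i j k) x)
    (hL : ∀ i, DifferentiableAt 𝕜 (fun y => L y i) x)
    (hb : ∀ j k, DifferentiableAt 𝕜 (fun y => b y j k) x) (l i j k : Fin 3) :
    pd l (fun y => connM (fun i j k => T i j k y) (L y) (b y) i j k) x =
      connM (fun i j k => pd l (T i j k) x) (fun i => pd l (fun y => L y i) x) (b x) i j k +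
        connM (fun i j k => T i j k x) (L x) (fun j k => pd l (fun y => b y j k) x) i j k := by
  have hite (f : Fin 3 → 𝕜) (q : Prop) [Decidable q] :
    (if q then ∑ m, f m else 0) = (if q then 1 else 0) * ∑ m, f m := by split_ifs <;> simp
  simp only [connM, hite]
  simp only [Fin.sum_univ_three, div_eq_mul_inv]
  simp (disch := fun_prop) only [pd_add, pd_sub, pd_mul, pd_const]
  ring

theorem analyticAt_connM {T : Fin 3 → Fin 3 → Fin 3 → Pt 𝕜 → 𝕜} {L : Pt 𝕜 → Fin 3 → 𝕜}
    {x : Pt 𝕜} (hT : ∀ i j k, AnalyticAt 𝕜 (T i j k) x)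
    (hL : ∀ i, AnalyticAt 𝕜 (fun y => L y i) x) (b : Fin 3 → Fin 3 → 𝕜) (i j k : Fin 3) :
    AnalyticAt 𝕜 (fun y => connM (fun i j k => T i j k y) (L y) b i j k) x := by
  have hite (f : Fin 3 → 𝕜) (q : Prop) [Decidable q] :
    (if q then ∑ m, f m else 0) = (if q then 1 else 0) * ∑ m, f m := by split_ifs <;> simp
  simp only [connM, hite]
  simp only [Fin.sum_univ_three, div_eq_mul_inv]
  fun_prop

/-- The values of solutions are annihilated by the curvature, since second derivatives commute. -/
theorem System.IsTensorSolution.curv_eq_zero (hS : S.IsConformallyFlat)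
    (hT : S.IsStructureTensor T) {b : Pt 𝕜 → Fin 3 → Fin 3 → 𝕜} (hb : S.IsTensorSolution T b)
    {x : Pt 𝕜} (hx : x ∈ S.domain) :
    curv (fun i j k => T i j k x) (S.logGrad x) (fun l i j k => pd l (T i j k) x)
      (fun l i => pd l (fun y => S.logGrad y i) x) (b x) = 0 := by
  have key (l i j k : Fin 3) : pd l (pd i (fun y => b y j k)) x =
      connM (fun i j k => pd l (T i j k) x) (fun i => pd l (fun y => S.logGrad y i) x) (b x) i j k +
        connM (fun i j k => T i j k x) (S.logGrad x)
          (connM (fun i j k => T i j k x) (S.logGrad x) (b x) l) i j k := by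
    rw [pd_congr l hS.isOpen (fun y hy => hb.pd_eq y hy i j k) hx,
      pd_connM (fun i j k => (hT.analytic i j k x hx).differentiableAt)
        (fun i => (hS.analyticOnNhd_logGrad i x hx).differentiableAt)
        (fun j k => (hb.analytic j k x hx).differentiableAt)]
    simp only [hb.pd_eq x hx]
  funext l i j k
  have := pd_comm l i (hb.analytic j k x hx)
  rw [key, key] at this
  simp only [curv, Pi.zero_apply]
  linear_combination this

end

section

variable {S : System 𝕜} {T : Fin 3 → Fin 3 → Fin 3 → Pt 𝕜 → 𝕜}

/-! ### Existence of second order constants -/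

/-- The right hand sides of the total system `∂ᵢ bⱼₖ = M(b)ᵢⱼₖ`, for symmetric tensors regarded as
functions on unordered pairs of indices. -/
def System.tensorSystem (S : System 𝕜) (T : Fin 3 → Fin 3 → Fin 3 → Pt 𝕜 → 𝕜) (i : Fin 3)
    (x : Pt 𝕜) : (Sym2 (Fin 3) → 𝕜) →ₗ[𝕜] (Sym2 (Fin 3) → 𝕜) where
  toFun v := Sym2.lift ⟨fun j k =>
    connM (fun i j k => T i j k x) (S.logGrad x) (fun j k => v s(j, k)) i j k,
    fun _ _ => connM_symm _ _ (fun _ _ => by rw [Sym2.eq_swap]) _ _ _⟩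
  map_add' v w := by
    funext s
    induction s with
    | _ j k =>
      have := connM_add (fun i j k => T i j k x) (S.logGrad x) (fun j k => v s(j, k))
        (fun j k => w s(j, k))
      exact congr_fun (congr_fun (congr_fun this i) j) k
  map_smul' c v := by
    funext s
    induction s with
    | _ j k =>
      have := connM_smul (fun i j k => T i j k x) (S.logGrad x) c (fun j k => v s(j, k))
      exact congr_fun (congr_fun (congr_fun this i) j) k

theorem System.tensorSystem_apply (i : Fin 3) (x : Pt 𝕜) (v : Sym2 (Fin 3) → 𝕜) (j k : Fin 3) :
    S.tensorSystem T i x v s(j, k) =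
      connM (fun i j k => T i j k x) (S.logGrad x) (fun j k => v s(j, k)) i j k := rfl

/-- The function on unordered pairs of indices given by the symmetric part of a tensor. -/
def symPart (B : Fin 3 → Fin 3 → 𝕜) : Sym2 (Fin 3) → 𝕜 :=
  Sym2.lift ⟨fun j k => (B j k + B k j) / 2, fun j k => by simp only [add_comm]⟩

theorem symPart_apply {B : Fin 3 → Fin 3 → 𝕜} (hB : ∀ j k, B j k = B k j) (j k : Fin 3) :
    symPart B s(j, k) = B j k := by
  simp [symPart, hB k j]

theorem System.IsTensorSolution.isSolution (hD : IsOpen S.domain)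
    {b : Pt 𝕜 → Fin 3 → Fin 3 → 𝕜}
    (hb : S.IsTensorSolution T b) :
    IsSolution (S.tensorSystem T) S.domain (fun x => symPart (b x)) := by
  refine ⟨fun s x hx => ?_, fun x hx i s => ?_⟩
  · induction s with
    | _ j k =>
      exact ((hb.analytic j k x hx).fun_add (hb.analytic k j x hx)).fun_div analyticAt_const
        two_ne_zero
  · induction s with
    | _ j k =>
      rw [pd_congr i hD (fun y hy => symPart_apply (hb.symm y hy) j k) hx, hb.pd_eq x hx,
        System.tensorSystem_apply]
      simp only [symPart_apply (hb.symm x hx)]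

theorem System.isTensorSolution_of_isSolution {y : Pt 𝕜 → Sym2 (Fin 3) → 𝕜}
    (hy : IsSolution (S.tensorSystem T) S.domain y) :
    S.IsTensorSolution T (fun x j k => y x s(j, k)) where
  analytic j k := hy.1 s(j, k)
  symm x _ j k := by rw [Sym2.eq_swap]
  pd_eq x hx i j k := by rw [hy.2 x hx, System.tensorSystem_apply]

theorem System.IsStructureTensor.analyticOnNhd_tensorSystem (hT : S.IsStructureTensor T)
    (hS : S.IsConformallyFlat) (i : Fin 3) (v : Sym2 (Fin 3) → 𝕜) (s : Sym2 (Fin 3)) :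
    AnalyticOnNhd 𝕜 (fun x => S.tensorSystem T i x v s) S.domain := by
  induction s with
  | _ j k =>
    simp only [System.tensorSystem_apply]
    exact fun x hx => analyticAt_connM (fun i j k => hT.analytic i j k x hx)
      (fun i => hS.analyticOnNhd_logGrad i x hx) (fun j k => v s(j, k)) i j k

theorem connM_sum {ι : Type*} [Fintype ι] (τ : Fin 3 → Fin 3 → Fin 3 → 𝕜) (L : Fin 3 → 𝕜)
    (c : ι → 𝕜) (b : ι → Fin 3 → Fin 3 → 𝕜) (i j k : Fin 3) :
    connM τ L (fun j k => ∑ h, c h * b h j k) i j k = ∑ h, c h * connM τ L (b h) i j k := by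
  have h1 : (fun j k => ∑ h, c h * b h j k) = ∑ h, c h • b h := by
    funext j k
    simp
  have h2 := map_sum (AddMonoidHom.mk' (connM τ L) (connM_add τ L)) (fun h => c h • b h)
    Finset.univ
  simp only [AddMonoidHom.mk'_apply, connM_smul] at h2
  rw [h1, h2]
  simp

theorem System.IsTensorSolution.sum {ι : Type*} [Fintype ι] (c : ι → 𝕜)
    {b : ι → Pt 𝕜 → Fin 3 → Fin 3 → 𝕜} (hb : ∀ h, S.IsTensorSolution T (b h)) :
    S.IsTensorSolution T (fun x j k => ∑ h, c h * b h x j k) where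
  analytic j k x hx := Finset.analyticAt_fun_sum _ fun h _ =>
    analyticAt_const.fun_mul ((hb h).analytic j k x hx)
  symm x hx j k := Finset.sum_congr rfl fun h _ => by rw [(hb h).symm x hx]
  pd_eq x hx i j k := by
    have hd (h : ι) := ((hb h).analytic j k x hx).differentiableAt
    rw [pd_sum _ i fun h _ => (hd h).const_mul (c h), connM_sum _ _ c (fun h => b h x)]
    exact Finset.sum_congr rfl fun h _ => by rw [pd_const_mul i _ (hd h), (hb h).pd_eq x hx]

theorem System.isTensorSolution_one (hT : S.IsStructureTensor T) :
    S.IsTensorSolution T (fun _ j k => if j = k then 1 else 0) where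
  analytic _ _ _ _ := analyticAt_const
  symm _ _ j k := by simp only [eq_comm]
  pd_eq x _ i j k := by
    simp only [pd_const, connM, Finset.sum_add_distrib, Finset.sum_sub_distrib, ite_mul, one_mul,
      zero_mul, Finset.sum_ite_eq, Finset.mem_univ, if_true, mul_ite, mul_one, mul_zero]
    rw [hT.symm j i k, hT.symm k i j]
    ring

theorem System.IsTensorSolution.eq_zero (hS : S.IsConformallyFlat) (hT : S.IsStructureTensor T)
    {b : Pt 𝕜 → Fin 3 → Fin 3 → 𝕜} (hb : S.IsTensorSolution T b) {x₀ : Pt 𝕜}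
    (hx₀ : x₀ ∈ S.domain) (h0 : ∀ j k, b x₀ j k = 0) : ∀ x ∈ S.domain, ∀ j k, b x j k = 0 := by
  intro x hx j k
  have := (hb.isSolution hS.isOpen).eqOn hS.isOpen hS.convex
    (fun i v s => (hT.analyticOnNhd_tensorSystem hS i v s).continuousOn) isSolution_zero hx₀
    (by
      funext s
      induction s with
      | _ j k => rw [symPart_apply (hb.symm x₀ hx₀), h0, Pi.zero_apply]) x hx
  rw [← symPart_apply (hb.symm x hx), this, Pi.zero_apply]

/-- In a superintegrable system the metric and the four given second order constants have linearly
independent tensors at every point: a linear relation at one point would hold identically, and so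
would be a relation between the differentials of the quadratic forms. -/
theorem System.IsSuperintegrable.exists_tensorSolutions (hsuper : S.IsSuperintegrable)
    (hS : S.IsConformallyFlat) (hT : S.IsStructureTensor T) :
    ∃ b : Fin 5 → Pt 𝕜 → Fin 3 → Fin 3 → 𝕜, (∀ h, S.IsTensorSolution T (b h)) ∧
      ∀ x ∈ S.domain, LinearIndependent 𝕜 (fun h => symPart (b h x)) := by
  obtain ⟨a, W, haW, x₁, hx₁, p, hind⟩ := hsuper
  set b : Fin 5 → Pt 𝕜 → Fin 3 → Fin 3 → 𝕜 :=
    Fin.cons (fun _ j k => if j = k then 1 else 0) (fun h x j k => S.lam x * a h x j k) with hb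
  have hsol : ∀ h, S.IsTensorSolution T (b h) := by
    intro h
    refine Fin.cases ?_ (fun h => ?_) h
    · exact System.isTensorSolution_one hT
    · exact (haW h).isTensorSolution hS hT
  refine ⟨b, hsol, fun x hx => ?_⟩
  set F : Fin 5 → Pt 𝕜 → Pt 𝕜 → 𝕜 := Fin.cons S.freeHamiltonian (fun h => quadForm (a h)) with hF
  have hFb : ∀ h, ∀ y ∈ S.domain, ∀ q, S.lam y * F h y q = quadForm (b h) y q := by
    intro h y hy q
    have h0 := hS.lam_ne_zero y hy
    refine Fin.cases ?_ (fun h => ?_) h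
    · simp only [hF, hb, Fin.cons_zero, System.freeHamiltonian, quadForm]
      rw [mul_div_cancel₀ _ h0]
      simp [sq]
    · simp only [hF, hb, Fin.cons_succ, quadForm, Finset.mul_sum, mul_assoc]
  have hFd : ∀ h, DifferentiableAt 𝕜 (fun z : Pt 𝕜 × Pt 𝕜 => F h z.1 z.2) (x₁, p) := by
    intro h
    have h0 := hS.lam_ne_zero x₁ hx₁
    have hl : DifferentiableAt 𝕜 (fun z : Pt 𝕜 × Pt 𝕜 => S.lam z.1) (x₁, p) :=
      DifferentiableAt.comp (x₁, p) (hS.analytic_lam x₁ hx₁).differentiableAt differentiableAt_fst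
    refine Fin.cases ?_ (fun h => ?_) h
    · simp only [hF, Fin.cons_zero, System.freeHamiltonian]
      simp only [div_eq_mul_inv]
      have hp : DifferentiableAt 𝕜 (fun z : Pt 𝕜 × Pt 𝕜 => ∑ i, z.2 i ^ 2) (x₁, p) := by fun_prop
      exact hp.fun_mul (hl.fun_inv h0)
    · have ha (j k : Fin 3) : DifferentiableAt 𝕜 (fun z : Pt 𝕜 × Pt 𝕜 => a h z.1 j k) (x₁, p) :=
        DifferentiableAt.comp (g := fun y => a h y j k) (x₁, p)
          ((haW h).analytic_a j k x₁ hx₁).differentiableAt differentiableAt_fst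
      simp only [hF, Fin.cons_succ, quadForm]
      have hp (j : Fin 3) : DifferentiableAt 𝕜 (fun z : Pt 𝕜 × Pt 𝕜 => z.2 j) (x₁, p) := by
        fun_prop
      exact DifferentiableAt.fun_sum fun j _ => DifferentiableAt.fun_sum fun k _ =>
        ((ha j k).fun_mul (hp j)).fun_mul (hp k)
  rw [Fintype.linearIndependent_iff] at hind ⊢
  intro c hc
  refine hind c ?_
  have h0 : ∀ j k, ∑ h, c h * b h x j k = 0 := by
    intro j k
    have := congr_fun hc s(j, k)
    simp only [Finset.sum_apply, Pi.smul_apply, smul_eq_mul, Pi.zero_apply] at this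
    rw [← this]
    exact Finset.sum_congr rfl fun h _ => by rw [symPart_apply ((hsol h).symm x hx)]
  have hz := (System.IsTensorSolution.sum c hsol).eq_zero hS hT hx h0
  have hFz : (fun z : Pt 𝕜 × Pt 𝕜 => ∑ h, c h * F h z.1 z.2) =ᶠ[nhds (x₁, p)] fun _ => 0 := by
    have : Prod.fst ⁻¹' S.domain ∈ nhds (x₁, p) :=
      (hS.isOpen.preimage continuous_fst).mem_nhds hx₁
    filter_upwards [this] with z hz'
    have h1 : S.lam z.1 * ∑ h, c h * F h z.1 z.2 = 0 := by
      calc _ = ∑ h, c h * quadForm (b h) z.1 z.2 := by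
            rw [Finset.mul_sum]
            exact Finset.sum_congr rfl fun h _ => by rw [← hFb h z.1 hz' z.2]; ring
        _ = ∑ j, ∑ k, (∑ h, c h * b h z.1 j k) * z.2 j * z.2 k := by
            simp only [quadForm, Finset.mul_sum, Finset.sum_mul]
            rw [Finset.sum_comm]
            refine Finset.sum_congr rfl fun j _ => ?_
            rw [Finset.sum_comm]
            exact Finset.sum_congr rfl fun k _ => Finset.sum_congr rfl fun h _ => by ring
        _ = 0 := by simp only [hz z.1 hz', zero_mul, Finset.sum_const_zero]
    exact (mul_eq_zero.1 h1).resolve_left (hS.lam_ne_zero z.1 hz')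
  have hd := hFz.fderiv_eq (𝕜 := 𝕜)
  rw [fderiv_fun_sum fun h _ => (hFd h).const_mul (c h)] at hd
  simpa only [fderiv_const_mul (hFd _), fderiv_fun_const, Pi.zero_apply] using hd

/-- The curvature of the total system vanishes on symmetric tensors: the values of solutions span a
hyperplane in the space of symmetric tensors, so that the curvature has rank at most one. -/
theorem System.IsSuperintegrable.curv_eq_zero (hsuper : S.IsSuperintegrable)
    (hS : S.IsConformallyFlat) (hT : S.IsStructureTensor T) {x : Pt 𝕜} (hx : x ∈ S.domain)
    {B : Fin 3 → Fin 3 → 𝕜} (hB : ∀ j k, B j k = B k j) :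
    curv (fun i j k => T i j k x) (S.logGrad x) (fun l i j k => pd l (T i j k) x)
      (fun l i => pd l (fun y => S.logGrad y i) x) B = 0 := by
  obtain ⟨b, hb, hind⟩ := hsuper.exists_tensorSolutions hS hT
  have hcard : Module.finrank 𝕜 (Sym2 (Fin 3) → 𝕜) = 6 := by
    rw [Module.finrank_pi, Sym2.card]
    rfl
  set E := Submodule.span 𝕜 (Set.range fun h => symPart (b h x)) with hE
  have hE5 : Module.finrank 𝕜 E = 5 := by
    rw [finrank_span_eq_card (hind x hx), Fintype.card_fin]
  obtain ⟨f, hf0, hEf⟩ := E.exists_le_ker_of_lt_top (lt_top_iff_ne_top.2 fun h => by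
    rw [h, finrank_top, hcard] at hE5
    omega)
  have hker : LinearMap.ker f = E := by
    refine (Submodule.eq_of_le_of_finrank_le hEf ?_).symm
    have h1 := f.finrank_range_add_finrank_ker
    have h2 : LinearMap.range f = ⊤ := LinearMap.range_eq_top.2 (LinearMap.surjective hf0)
    rw [h2, finrank_top, Module.finrank_self, hcard] at h1
    omega
  refine Superintegrable.curv_eq_zero _ (hT.isPotentialTensor hS.isOpen hx)
    (hT.isPotentialTensor_pd hS.isOpen hx) (fun i j => hS.pd_logGrad_comm hx i j)
    (hT.potIntegrable hS.isOpen hx) (fun B B' hB hB' => ?_) hB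
  have hmem : ∀ B : Fin 3 → Fin 3 → 𝕜, (∀ j k, B j k = B k j) → symPart B ∈ E →
      curv (fun i j k => T i j k x) (S.logGrad x) (fun l i j k => pd l (T i j k) x)
      (fun l i => pd l (fun y => S.logGrad y i) x) B = 0 := by
    intro B hB h
    rw [hE, Submodule.mem_span_range_iff_exists_fun] at h
    obtain ⟨c, hc⟩ := h
    have h1 : B = fun j k => ∑ h, c h * b h x j k := by
      funext j k
      rw [← symPart_apply hB, ← hc]
      simp only [Finset.sum_apply, Pi.smul_apply, smul_eq_mul]
      exact Finset.sum_congr rfl fun h _ => by rw [symPart_apply ((hb h).symm x hx)]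
    rw [h1]
    exact (System.IsTensorSolution.sum c hb).curv_eq_zero hS hT hx
  have hadd : ∀ c c' : 𝕜, symPart (c • B + c' • B') = c • symPart B + c' • symPart B' := by
    intro c c'
    funext s
    induction s with
    | _ j k =>
      rw [symPart_apply (fun j k => by simp [hB j k, hB' j k])]
      simp [symPart_apply hB, symPart_apply hB']
  by_cases hfB : f (symPart B) = 0
  · refine ⟨1, 0, Or.inl one_ne_zero, hmem _ (fun j k => by simp [hB j k]) ?_⟩
    rw [← hker, LinearMap.mem_ker, hadd]
    simp [hfB]
  · refine ⟨f (symPart B'), -f (symPart B), Or.inr (neg_ne_zero.2 hfB),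
      hmem _ (fun j k => by simp [hB j k, hB' j k]) ?_⟩
    rw [← hker, LinearMap.mem_ker, hadd]
    simp [mul_comm]

/-- Every symmetric tensor at a point is the value of a solution on the whole domain, that is, of a
second order constant: the five given solutions and the vanishing of the curvature allow reduction
of order. -/
theorem System.IsSuperintegrable.exists_isTensorSolution (hsuper : S.IsSuperintegrable)
    (hS : S.IsConformallyFlat) (hT : S.IsStructureTensor T) {x : Pt 𝕜} (hx : x ∈ S.domain)
    {B : Fin 3 → Fin 3 → 𝕜} (hB : ∀ j k, B j k = B k j) :
    ∃ b, S.IsTensorSolution T b ∧ ∀ j k, b x j k = B j k := by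
  obtain ⟨b, hb, hind⟩ := hsuper.exists_tensorSolutions hS hT
  have e : Option (Fin 5) ≃ Sym2 (Fin 3) := Fintype.equivOfCardEq (by rw [Sym2.card]; rfl)
  have hΦ := hT.analyticOnNhd_tensorSystem hS
  have hfull : IsFull (S.tensorSystem T) S.domain := by
    refine isFull_of_local hS.isOpen hS.convex (fun i v s => (hΦ i v s).continuousOn) fun y hy =>
      exists_isFull_of_hyperplane e hS.isOpen hΦ ?_ (fun h => (hb h).isSolution hS.isOpen) hy
        (hind y hy)
    intro z hz i l v s
    induction s with
    | _ j k =>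
      have hv (j k : Fin 3) : v s(j, k) = v s(k, j) := by rw [Sym2.eq_swap]
      have hcurv := hsuper.curv_eq_zero hS hT hz hv
      have hc := congr_fun (congr_fun (congr_fun (congr_fun hcurv l) i) j) k
      have hpd (l i : Fin 3) : pd l (fun z => S.tensorSystem T i z v s(j, k)) z =
          connM (fun i j k => pd l (T i j k) z) (fun i => pd l (fun y => S.logGrad y i) z)
            (fun j k => v s(j, k)) i j k := by
        simp only [System.tensorSystem_apply]
        rw [pd_connM (b := fun _ j k => v s(j, k))
          (fun i j k => (hT.analytic i j k z hz).differentiableAt)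
          (fun i => (hS.analyticOnNhd_logGrad i z hz).differentiableAt)
          (fun j k => differentiableAt_const _)]
        simp only [pd_const]
        have := connM_smul (fun i j k => T i j k z) (S.logGrad z) 0 0
        rw [zero_smul, zero_smul] at this
        rw [show (fun _ _ : Fin 3 => (0 : 𝕜)) = 0 from rfl, this]
        simp
      rw [hpd, hpd]
      simp only [System.tensorSystem_apply]
      simp only [curv, Pi.zero_apply] at hc
      linear_combination hc
  obtain ⟨y, hy, hyx⟩ := hfull x hx (symPart B)
  exact ⟨_, System.isTensorSolution_of_isSolution hy, fun j k => by
    rw [hyx, symPart_apply hB]⟩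

end

section

variable {S : System 𝕜} {T : Fin 3 → Fin 3 → Fin 3 → Pt 𝕜 → 𝕜}

/-! ### The total system of the truly third order constants -/

/-- One third of the Levi-Civita symbol. -/
def thirdEps (k l m : Fin 3) : 𝕜 :=
  if l = k + 1 ∧ m = k + 2 then 3⁻¹ else if l = k + 2 ∧ m = k + 1 then -3⁻¹ else 0

/-- The right hand sides of the total system for `(f, δ)` that prolongs the equations
`∂ₖ fₗₘ = εₖₗₘ δ / 3 + ∑ qₖₗₘₙᵣ fₙᵣ`: the derivatives of the additional unknown `δ` follow from the
symmetry of the second derivatives of `f`. -/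
def epsSystem (q : Fin 3 → Fin 3 → Fin 3 → Fin 3 → Fin 3 → Pt 𝕜 → 𝕜) (j : Fin 3) (x : Pt 𝕜) :
    (Option (Fin 3 × Fin 3) → 𝕜) →ₗ[𝕜] (Option (Fin 3 × Fin 3) → 𝕜) where
  toFun v s :=
    let P : Fin 3 → Fin 3 → Fin 3 → Fin 3 → 𝕜 := fun j k l m => ∑ n, ∑ r,
      (pd j (q k l m n r) x * v (some (n, r)) + q k l m n r x *
        (thirdEps j n r * v none + ∑ s, ∑ t, q j n r s t x * v (some (s, t))))
    s.elim (3 * (P (j + 2) j j (j + 1) - P j (j + 2) j (j + 1))) fun s =>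
      thirdEps j s.1 s.2 * v none + ∑ n, ∑ r, q j s.1 s.2 n r x * v (some (n, r))
  map_add' v w := by
    funext s
    cases s <;> simp only [Option.elim, Pi.add_apply, mul_add, Finset.sum_add_distrib] <;> ring
  map_smul' c v := by
    funext s
    have h1 (a b : 𝕜) : a * (c * b) = c * (a * b) := by ring
    cases s <;> simp only [Option.elim, Pi.smul_apply, smul_eq_mul, RingHom.id_apply, h1,
      ← Finset.mul_sum, ← mul_add, ← mul_sub]

/-- A solution `(f, δ)` of the equations `∂ₖ fₗₘ = εₖₗₘ δ / 3 + ∑ qₖₗₘₙᵣ fₙᵣ` is determined by its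
value at a point. -/
theorem eq_zero_of_thirdEps_system {D : Set (Pt 𝕜)} (hD : IsOpen D) (hc : Convex ℝ D)
    {q : Fin 3 → Fin 3 → Fin 3 → Fin 3 → Fin 3 → Pt 𝕜 → 𝕜}
    (hq : ∀ k l m n r, AnalyticOnNhd 𝕜 (q k l m n r) D) {f : Fin 3 → Fin 3 → Pt 𝕜 → 𝕜}
    (hf : ∀ l m, AnalyticOnNhd 𝕜 (f l m) D) {δ : Pt 𝕜 → 𝕜} (hδ : AnalyticOnNhd 𝕜 δ D)
    (h : ∀ x ∈ D, ∀ k l m, pd k (f l m) x =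
      thirdEps k l m * δ x + ∑ n, ∑ r, q k l m n r x * f n r x) {x₀ : Pt 𝕜} (hx₀ : x₀ ∈ D)
    (hf0 : ∀ l m, f l m x₀ = 0) (hδ0 : δ x₀ = 0) : ∀ x ∈ D, ∀ l m, f l m x = 0 := by
  have hfd (l m) {x} (hx : x ∈ D) := (hf l m x hx).differentiableAt
  have hqd (k l m n r) {x} (hx : x ∈ D) := (hq k l m n r x hx).differentiableAt
  let y : Pt 𝕜 → Option (Fin 3 × Fin 3) → 𝕜 := fun x s => s.elim (δ x) fun s => f s.1 s.2 x
  have key := eq_zero_of_linear_system hD hc (epsSystem q) (y := y) ?_ ?_ ?_ hx₀ ?_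
  · intro x hx l m
    exact congr_fun (key x hx) (some (l, m))
  · intro i v s
    have hqc (k l m n r) : ContinuousOn (q k l m n r) D := (hq k l m n r).continuousOn
    have hqp (j k l m n r) : ContinuousOn (fun x => pd j (q k l m n r) x) D :=
      (analyticOnNhd_pd j (hq k l m n r)).continuousOn
    cases s <;> simp only [epsSystem, LinearMap.coe_mk, AddHom.coe_mk, Option.elim] <;> fun_prop
  · intro s
    cases s
    · exact hδ.differentiableOn
    · exact (hf _ _).differentiableOn
  · intro x hx i s
    cases s with
    | some s => exact h x hx i s.1 s.2
    | none =>
      have hP (j k l m : Fin 3) : pd j (fun x => ∑ n, ∑ r, q k l m n r x * f n r x) x =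
          ∑ n, ∑ r, (pd j (q k l m n r) x * f n r x + q k l m n r x *
            (thirdEps j n r * δ x + ∑ s, ∑ t, q j n r s t x * f s t x)) := by
        rw [pd_sum _ j fun n _ => DifferentiableAt.fun_sum fun r _ =>
          (hqd k l m n r hx).fun_mul (hfd n r hx)]
        refine Finset.sum_congr rfl fun n _ => ?_
        rw [pd_sum _ j fun r _ => (hqd k l m n r hx).fun_mul (hfd n r hx)]
        refine Finset.sum_congr rfl fun r _ => ?_
        rw [pd_mul j (hqd k l m n r hx) (hfd n r hx), h x hx]
      have hs (k l m : Fin 3) : DifferentiableAt 𝕜 (fun x => ∑ n, ∑ r, q k l m n r x * f n r x) x :=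
        DifferentiableAt.fun_sum fun n _ => DifferentiableAt.fun_sum fun r _ =>
          (hqd k l m n r hx).fun_mul (hfd n r hx)
      have e1 : pd i (pd (i + 2) (f i (i + 1))) x = 3⁻¹ * pd i δ x +
          pd i (fun x => ∑ n, ∑ r, q (i + 2) i (i + 1) n r x * f n r x) x := by
        rw [← pd_const_mul i _ (hδ x hx).differentiableAt,
          ← pd_add i ((hδ x hx).differentiableAt.const_mul _) (hs _ _ _)]
        refine pd_congr i hD (fun z hz => ?_) hx
        have : (thirdEps (i + 2) i (i + 1) : 𝕜) = 3⁻¹ := by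
          fin_cases i <;> simp [thirdEps]
        rw [h z hz, this]
      have e2 : pd (i + 2) (pd i (f i (i + 1))) x =
          pd (i + 2) (fun x => ∑ n, ∑ r, q i i (i + 1) n r x * f n r x) x := by
        refine pd_congr (i + 2) hD (fun z hz => ?_) hx
        have : (thirdEps i i (i + 1) : 𝕜) = 0 := by
          fin_cases i <;> simp [thirdEps]
        rw [h z hz, this, zero_mul, zero_add]
      have e3 := pd_comm i (i + 2) (hf i (i + 1) x hx)
      rw [e1, e2, hP, hP] at e3
      show pd i δ x = 3 * (_ - _)
      simp only [y, Option.elim]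
      linear_combination 3 * e3
  · funext s
    cases s
    · exact hδ0
    · exact hf0 _ _

theorem pd_cubic_right (j : Fin 3) {a : Pt 𝕜 → Fin 3 → Fin 3 → Fin 3 → 𝕜}
    (f : Pt 𝕜 → Fin 3 → Fin 3 → 𝕜) (V : Pt 𝕜 → 𝕜) {x : Pt 𝕜}
    (ha : ∀ k j i, a x k j i = a x j k i ∧ a x k j i = a x k i j) (p : Pt 𝕜) :
    pd j (fun q => cubic a f V x q) p =
      3 * ∑ k, ∑ l, a x j k l * p k * p l + ∑ m, f x j m * pd m V x := by
  have hd (k l m : Fin 3) : DifferentiableAt 𝕜 (fun q : Pt 𝕜 => q k * q l * q m) p := by fun_prop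
  have hq (k l m : Fin 3) : pd j (fun q : Pt 𝕜 => a x k l m * q k * q l * q m) p =
      a x k l m * (((if k = j then 1 else 0) * p l + p k * if l = j then 1 else 0) * p m +
        p k * p l * if m = j then 1 else 0) := by
    have : (fun q : Pt 𝕜 => a x k l m * q k * q l * q m) =
      fun q => a x k l m * (q k * q l * q m) := by funext q; ring
    rw [this, pd_const_mul j _ (by fun_prop), pd_mul j (by fun_prop) (by fun_prop),
      pd_mul j (by fun_prop) (by fun_prop), pd_coord, pd_coord, pd_coord]
  have hl (l : Fin 3) : pd j (fun q : Pt 𝕜 => (∑ m, f x l m * pd m V x) * q l) p =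
      (∑ m, f x l m * pd m V x) * if l = j then 1 else 0 := by
    rw [pd_const_mul j _ (by fun_prop), pd_coord]
  unfold cubic
  rw [pd_add j (by fun_prop) (by fun_prop), pd_sum _ j (fun k _ => by fun_prop),
    pd_sum _ j (fun k _ => by fun_prop)]
  simp only [hl, mul_ite, mul_one, mul_zero, Finset.sum_ite_eq', Finset.mem_univ, if_true]
  congr 1
  have e (k : Fin 3) : pd j (fun q : Pt 𝕜 => ∑ l, ∑ m, a x k l m * q k * q l * q m) p =
      ∑ l, ∑ m, pd j (fun q : Pt 𝕜 => a x k l m * q k * q l * q m) p := by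
    rw [pd_sum _ j (fun k _ => by fun_prop)]
    exact Finset.sum_congr rfl fun l _ => pd_sum _ j (fun k _ => by fun_prop)
  simp only [e, hq, mul_add, add_mul, Finset.sum_add_distrib, ite_mul, mul_ite, one_mul, zero_mul,
    mul_one, mul_zero, Finset.sum_ite_eq', Finset.mem_univ, if_true, Finset.sum_ite_irrel,
    Finset.sum_const_zero]
  have e1 : ∑ k, ∑ m, a x k j m * (p k * p m) = ∑ k, ∑ l, a x j k l * p k * p l :=
    Finset.sum_congr rfl fun k _ => Finset.sum_congr rfl fun l _ => by rw [(ha k j l).1]; ring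
  have e2 : ∑ k, ∑ l, a x k l j * (p k * p l) = ∑ k, ∑ l, a x j k l * p k * p l :=
    Finset.sum_congr rfl fun k _ => Finset.sum_congr rfl fun l _ => by
      rw [(ha k l j).2, (ha k j l).1]; ring
  rw [e1, e2]
  have e3 : ∑ l, ∑ m, a x j l m * (p l * p m) = ∑ k, ∑ l, a x j k l * p k * p l :=
    Finset.sum_congr rfl fun k _ => Finset.sum_congr rfl fun l _ => by ring
  rw [e3]
  ring

theorem pd_cubic_left (j : Fin 3) {a : Pt 𝕜 → Fin 3 → Fin 3 → Fin 3 → 𝕜}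
    {f : Pt 𝕜 → Fin 3 → Fin 3 → 𝕜} {V : Pt 𝕜 → 𝕜} {x : Pt 𝕜}
    (ha : ∀ k l m, DifferentiableAt 𝕜 (fun y => a y k l m) x)
    (hf : ∀ l m, DifferentiableAt 𝕜 (fun y => f y l m) x)
    (hV : ∀ m, DifferentiableAt 𝕜 (pd m V) x) (p : Pt 𝕜) :
    pd j (fun y => cubic a f V y p) x =
      (∑ k, ∑ l, ∑ m, pd j (fun y => a y k l m) x * p k * p l * p m) +
        ∑ l, (∑ m, (pd j (fun y => f y l m) x * pd m V x + f x l m * pd j (pd m V) x)) * p l := by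
  have h1 (k l m : Fin 3) : pd j (fun y => a y k l m * p k * p l * p m) x =
      pd j (fun y => a y k l m) x * p k * p l * p m := by
    have : (fun y => a y k l m * p k * p l * p m) = fun y => (p k * p l * p m) * a y k l m := by
      funext y; ring
    rw [this, pd_const_mul j _ (ha k l m)]
    ring
  have h2 (l : Fin 3) : pd j (fun y => (∑ m, f y l m * pd m V y) * p l) x =
      (∑ m, (pd j (fun y => f y l m) x * pd m V x + f x l m * pd j (pd m V) x)) * p l := by
    have : (fun y => (∑ m, f y l m * pd m V y) * p l) =
      fun y => p l * ∑ m, f y l m * pd m V y := by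
      funext y; ring
    rw [this, pd_const_mul j _ (by fun_prop), pd_sum _ j (fun m _ => by fun_prop), mul_comm]
    simp only [pd_mul j (hf _ _) (hV _)]
  unfold cubic
  rw [pd_add j (by fun_prop) (by fun_prop), pd_sum _ j (fun k _ => by fun_prop),
    pd_sum _ j (fun k _ => by fun_prop)]
  simp only [h2]
  congr 1
  refine Finset.sum_congr rfl fun k _ => ?_
  rw [pd_sum _ j (fun k _ => by fun_prop)]
  refine Finset.sum_congr rfl fun l _ => ?_
  rw [pd_sum _ j (fun k _ => by fun_prop)]
  exact Finset.sum_congr rfl fun m _ => h1 k l m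

/-- The parts of degree zero and two in the momenta of the bracket of a truly third order constant
with the Hamiltonian. -/
theorem System.IsThirdOrderConstant.homogeneous (hS : S.IsConformallyFlat)
    {a : Pt 𝕜 → Fin 3 → Fin 3 → Fin 3 → 𝕜} {f : Pt 𝕜 → Fin 3 → Fin 3 → 𝕜}
    (h : S.IsThirdOrderConstant a f) (V : S.pot) {x : Pt 𝕜} (hx : x ∈ S.domain) (p : Pt 𝕜) :
    (∑ j, pd j V.1 x * ∑ m, f x j m * pd m V.1 x) = 0 ∧
    3 * ∑ j, pd j V.1 x * ∑ k, ∑ l, a x j k l * p k * p l -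
      (∑ i, p i ^ 2) / S.lam x * (∑ j, S.logGrad x j * ∑ m, f x j m * pd m V.1 x) -
      2 / S.lam x * ∑ j, ∑ l, (∑ m, (pd j (fun y => f y l m) x * pd m V.1 x +
        f x l m * pd j (pd m V.1) x)) * p j * p l = 0 := by
  have h0 := hS.lam_ne_zero x hx
  have hVa := S.analytic_pot V V.2
  have key (p : Pt 𝕜) := (hS.poissonBracket_hamiltonian hVa hx (cubic a f V) p).symm.trans
    (h.bracket_eq_zero V x hx p)
  simp only [pd_cubic_right _ _ _ (h.symm x hx), pd_cubic_left _
    (fun k l m => (h.analytic_a k l m x hx).differentiableAt)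
    (fun l m => (h.analytic_f l m x hx).differentiableAt)
    (fun m => (analyticAt_pd m (hVa x hx)).differentiableAt)] at key
  set A := fun (p : Pt 𝕜) j => ∑ k, ∑ l, a x j k l * p k * p l with hA
  set F := fun j => ∑ m, f x j m * pd m V.1 x with hF
  set B := fun (p : Pt 𝕜) j => ∑ k, ∑ l, ∑ m, pd j (fun y => a y k l m) x * p k * p l * p m with hB
  set G := fun (p : Pt 𝕜) j => ∑ l, (∑ m, (pd j (fun y => f y l m) x * pd m V.1 x +
        f x l m * pd j (pd m V.1) x)) * p l with hG
  have hA2 (p : Pt 𝕜) (c : 𝕜) (j) : A (c • p) j = c ^ 2 * A p j := by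
    simp only [hA, Pi.smul_apply, smul_eq_mul, Finset.mul_sum]
    exact Finset.sum_congr rfl fun _ _ => Finset.sum_congr rfl fun _ _ => by ring
  have hB2 (p : Pt 𝕜) (c : 𝕜) (j) : B (c • p) j = c ^ 3 * B p j := by
    simp only [hB, Pi.smul_apply, smul_eq_mul, Finset.mul_sum]
    exact Finset.sum_congr rfl fun _ _ => Finset.sum_congr rfl fun _ _ =>
      Finset.sum_congr rfl fun _ _ => by ring
  have hG2 (p : Pt 𝕜) (c : 𝕜) (j) : G (c • p) j = c * G p j := by
    simp only [hG, Pi.smul_apply, smul_eq_mul, Finset.mul_sum]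
    exact Finset.sum_congr rfl fun _ _ => by ring
  have hG3 : ∑ j, ∑ l, (∑ m, (pd j (fun y => f y l m) x * pd m V.1 x +
        f x l m * pd j (pd m V.1) x)) * p j * p l = ∑ j, G p j * p j := by
    refine Finset.sum_congr rfl fun _ _ => ?_
    simp only [hG]
    rw [Finset.sum_mul]
    exact Finset.sum_congr rfl fun _ _ => by rw [mul_right_comm]
  rw [hG3]
  have key' (p : Pt 𝕜) : ∑ j, ((pd j V.1 x - (∑ i, p i ^ 2) * pd j S.lam x / S.lam x ^ 2) *
      (3 * A p j + F j) - 2 * p j / S.lam x * (B p j + G p j)) = 0 := key p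
  -- the homogeneous parts are separated by rescaling the momentum
  have k0 := key' ((0 : 𝕜) • p)
  have k1 := key' p
  have k2 := key' ((2 : 𝕜) • p)
  rw [Fin.sum_univ_three] at k0 k1 k2
  simp only [hA2, hB2, hG2, Pi.smul_apply, smul_eq_mul, mul_pow, ← Finset.mul_sum] at k0 k2
  set P := ∑ i, p i ^ 2 with hP
  change ∑ j, pd j V.1 x * F j = 0 ∧ 3 * ∑ j, pd j V.1 x * A p j -
    P / S.lam x * (∑ j, S.logGrad x j * F j) - 2 / S.lam x * ∑ j, G p j * p j = 0
  clear_value A F B G P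
  simp only [Fin.sum_univ_three, System.logGrad]
  have e0 : pd 0 V.1 x * F 0 + pd 1 V.1 x * F 1 + pd 2 V.1 x * F 2 = 0 := by
    linear_combination k0
  refine ⟨e0, ?_⟩
  field_simp at k1 k2 ⊢
  linear_combination (16 * k1 - k2) / 12 - 15 / 12 * S.lam x ^ 2 * e0

end

section

variable {S : System 𝕜} {T : Fin 3 → Fin 3 → Fin 3 → Pt 𝕜 → 𝕜}

theorem quadForm_coeff_eq_zero {c : Fin 3 → Fin 3 → 𝕜}
    (h : ∀ p : Fin 3 → 𝕜, ∑ i, ∑ j, c i j * p i * p j = 0) (i j : Fin 3) : c i j + c j i = 0 := by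
  have h1 := h (Pi.single i 1 + Pi.single j 1)
  have h2 := h (Pi.single i 1)
  have h3 := h (Pi.single j 1)
  simp only [Pi.add_apply, mul_add, Finset.sum_add_distrib, Pi.single_apply, mul_ite,
    mul_one, mul_zero, Finset.sum_ite_eq', Finset.mem_univ, if_true] at h1 h2 h3
  linear_combination h1 - h2 - h3

/-- The divergence of the vector dual to the skew tensor `f`, that is, the exterior derivative of
`f` as a two-form. -/
def skewDiv (f : Pt 𝕜 → Fin 3 → Fin 3 → 𝕜) (x : Pt 𝕜) : 𝕜 :=
  pd 2 (fun y => f y 0 1) x + pd 0 (fun y => f y 1 2) x + pd 1 (fun y => f y 2 0) x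

namespace System.IsThirdOrderConstant

variable {a : Pt 𝕜 → Fin 3 → Fin 3 → Fin 3 → 𝕜} {f : Pt 𝕜 → Fin 3 → Fin 3 → 𝕜}

/-- The part of degree zero of the bracket with the Hamiltonian is `∑ fₗₘ ∂ₗV ∂ₘV`, and the gradient
of `V` is arbitrary. -/
theorem skew (h : S.IsThirdOrderConstant a f) (hS : S.IsConformallyFlat)
    (hT : S.IsStructureTensor T) {x : Pt 𝕜} (hx : x ∈ S.domain) (l m : Fin 3) :
    f x l m = -f x m l := by
  refine eq_neg_of_add_eq_zero_left (quadForm_coeff_eq_zero (c := f x) (fun g => ?_) l m)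
  obtain ⟨V, hV, -, hg, -⟩ := hT.exists_jet x hx 0 g 0
  have := (h.homogeneous hS ⟨V, hV⟩ hx 0).1
  simp only [hg, Finset.mul_sum] at this
  rw [← this]
  exact Finset.sum_congr rfl fun i _ => Finset.sum_congr rfl fun j _ => by ring

/-- The cubic part of a truly third order constant is determined by `f`. -/
theorem cubic_part_eq (h : S.IsThirdOrderConstant a f) (hS : S.IsConformallyFlat)
    (hT : S.IsStructureTensor T) {x : Pt 𝕜} (hx : x ∈ S.domain) (m k l : Fin 3) :
    3 * S.lam x * a x m k l = pd k (fun y => f y l m) x + pd l (fun y => f y k m) x +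
      ∑ n, (f x l n * T n k m x + f x k n * T n l m x) +
      if k = l then ∑ j, S.logGrad x j * f x j m else 0 := by
  have h0 := hS.lam_ne_zero x hx
  obtain ⟨V, hV, -, hg, hh⟩ := hT.exists_jet x hx 0 (Pi.single m 1) 0
  have key := quadForm_coeff_eq_zero (c := fun k l => 3 * a x m k l -
    (if k = l then (∑ j, S.logGrad x j * f x j m) / S.lam x else 0) -
    2 / S.lam x * (pd k (fun y => f y l m) x + ∑ n, f x l n * T n k m x)) (fun p => ?_) k l
  · rw [(h.symm x hx m l k).2] at key
    rw [Finset.sum_add_distrib]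
    by_cases hkl : k = l
    · rw [if_pos hkl] at key ⊢
      rw [if_pos hkl.symm] at key
      field_simp at key
      linear_combination key / 2
    · rw [if_neg hkl] at key ⊢
      rw [if_neg (Ne.symm hkl)] at key
      field_simp at key
      linear_combination key / 2
  · have := (h.homogeneous hS ⟨V, hV⟩ hx p).2
    simp only [hg, hh, Pi.single_apply, ite_self, zero_add, mul_ite, mul_one, mul_zero, ite_mul,
      one_mul, zero_mul, Finset.sum_ite_eq', Finset.mem_univ, if_true, Finset.sum_add_distrib]
      at this
    refine Eq.trans ?_ this
    simp only [Fin.sum_univ_three, hT.symm 1 0, hT.symm 2 0, hT.symm 2 1]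
    simp
    ring

/-- The coefficients of `∑ₙ (fₗₙ Tₙₖₘ + fₖₙ Tₙₗₘ) + δₖₗ ∑ⱼ Lⱼ fⱼₘ` as a linear function of `f`. -/
def thirdCoeff (S : System 𝕜) (T : Fin 3 → Fin 3 → Fin 3 → Pt 𝕜 → 𝕜) (k l m n r : Fin 3)
    (x : Pt 𝕜) : 𝕜 :=
  (if l = n then 1 else 0) * T r k m x + (if k = n then 1 else 0) * T r l m x +
    (if k = l ∧ r = m then 1 else 0) * S.logGrad x n

theorem sum_thirdCoeff (k l m : Fin 3) (x : Pt 𝕜) (F : Fin 3 → Fin 3 → 𝕜) :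
    ∑ n, ∑ r, thirdCoeff S T k l m n r x * F n r =
      ∑ n, (F l n * T n k m x + F k n * T n l m x) +
        if k = l then ∑ j, S.logGrad x j * F j m else 0 := by
  have h1 : (if k = l then ∑ j, S.logGrad x j * F j m else 0) =
      ∑ n, ∑ r, (if k = l ∧ r = m then 1 else 0) * S.logGrad x n * F n r := by
    split_ifs with h <;> simp [h]
  rw [h1]
  simp only [thirdCoeff, add_mul, Finset.sum_add_distrib, ite_mul, one_mul, zero_mul,
    Finset.sum_ite_irrel, Finset.sum_const_zero, Finset.sum_ite_eq, Finset.mem_univ, if_true]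
  simp only [mul_comm]

/-- The derivatives of `f` are determined by `f` and `skewDiv f`, since the cubic part is totally
symmetric. -/
theorem pd_eq (h : S.IsThirdOrderConstant a f) (hS : S.IsConformallyFlat)
    (hT : S.IsStructureTensor T) {x : Pt 𝕜} (hx : x ∈ S.domain) (k l m : Fin 3) :
    pd k (fun y => f y l m) x = thirdEps k l m * skewDiv f x +
      ∑ n, ∑ r, (thirdCoeff S T k m l n r x - thirdCoeff S T k l m n r x) / 3 * f x n r := by
  have hn (k l m : Fin 3) : pd k (fun y => f y l m) x = -pd k (fun y => f y m l) x := by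
    rw [pd_congr k hS.isOpen (fun y hy => h.skew hS hT hy l m) hx, pd_neg]
  have e1 := h.cubic_part_eq hS hT hx m k l
  have e2 := h.cubic_part_eq hS hT hx l k m
  rw [(h.symm x hx l k m).1, (h.symm x hx k l m).2, (h.symm x hx k m l).1, e1, add_assoc,
    add_assoc _ (∑ n, _), ← sum_thirdCoeff (S := S) (T := T) k l m x (f x),
    ← sum_thirdCoeff (S := S) (T := T) k m l x (f x)] at e2
  have e3 : ∑ n, ∑ r, (thirdCoeff S T k m l n r x - thirdCoeff S T k l m n r x) / 3 * f x n r =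
      (∑ n, ∑ r, thirdCoeff S T k m l n r x * f x n r -
        ∑ n, ∑ r, thirdCoeff S T k l m n r x * f x n r) / 3 := by
    simp only [← Finset.sum_sub_distrib, Finset.sum_div]
    exact Finset.sum_congr rfl fun _ _ => Finset.sum_congr rfl fun _ _ => by ring
  rw [e3]
  -- `3 ∂ₖ fₗₘ` differs from the cyclic sum of the derivatives of `f` by the terms without
  -- derivatives
  have e4 : 3 * thirdEps k l m * skewDiv f x = pd k (fun y => f y l m) x +
      pd l (fun y => f y m k) x + pd m (fun y => f y k l) x := by
    have d (k l) : pd k (fun y => f y l l) x = 0 := by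
      have := hn k l l
      linear_combination this / 2
    have n10 := fun k => hn k 1 0
    have n02 := fun k => hn k 0 2
    have n21 := fun k => hn k 2 1
    fin_cases k <;> fin_cases l <;> fin_cases m <;>
      simp [thirdEps, skewDiv, d, n10, n02, n21] <;> ring
  rw [hn k m l, hn m k l] at e2
  rw [hn l m k] at e4
  linear_combination (e2 - e4 - hn m l k) / 3

/-- A truly third order constant vanishes if `f` and `skewDiv f` vanish at a point. -/
theorem eq_zero (h : S.IsThirdOrderConstant a f) (hS : S.IsConformallyFlat)
    (hT : S.IsStructureTensor T) {x₀ : Pt 𝕜} (hx₀ : x₀ ∈ S.domain) (hf0 : ∀ l m, f x₀ l m = 0)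
    (hδ0 : skewDiv f x₀ = 0) {x : Pt 𝕜} (hx : x ∈ S.domain) :
    (∀ k l m, a x k l m = 0) ∧ ∀ l m, f x l m = 0 := by
  have hq (k l m n r : Fin 3) : AnalyticOnNhd 𝕜 (fun x =>
      (thirdCoeff S T k m l n r x - thirdCoeff S T k l m n r x) / 3) S.domain := fun x hx => by
    have hν (k l m : Fin 3) : AnalyticAt 𝕜 (thirdCoeff S T k l m n r) x :=
      ((analyticAt_const.fun_mul (hT.analytic _ _ _ x hx)).fun_add
        (analyticAt_const.fun_mul (hT.analytic _ _ _ x hx))).fun_add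
        (analyticAt_const.fun_mul (hS.analyticOnNhd_logGrad n x hx))
    exact ((hν k m l).fun_sub (hν k l m)).fun_div analyticAt_const three_ne_zero
  have hf : ∀ x ∈ S.domain, ∀ l m, f x l m = 0 :=
    eq_zero_of_thirdEps_system hS.isOpen hS.convex hq (f := fun l m y => f y l m)
      h.analytic_f (δ := skewDiv f)
      (fun x hx => ((analyticAt_pd 2 (h.analytic_f 0 1 x hx)).add
        (analyticAt_pd 0 (h.analytic_f 1 2 x hx))).add (analyticAt_pd 1 (h.analytic_f 2 0 x hx)))
      (fun x hx k l m => h.pd_eq hS hT hx k l m) hx₀ hf0 hδ0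
  refine ⟨fun k l m => ?_, hf x hx⟩
  have e := h.cubic_part_eq hS hT hx k l m
  have hd (j l m : Fin 3) : pd j (fun y => f y l m) x = 0 := by
    rw [pd_congr j hS.isOpen (fun y hy => hf y hy l m) hx, pd_const]
  simp only [hd, hf x hx, zero_mul, mul_zero, add_zero, Finset.sum_const_zero, ite_self] at e
  exact (mul_eq_zero.1 e).resolve_left (mul_ne_zero three_ne_zero (hS.lam_ne_zero x hx))

end System.IsThirdOrderConstant

/-- The coefficients `f` of a truly third order constant are determined by its values. -/
theorem System.IsStructureTensor.eq_zero_of_cubic_eq_zero (hT : S.IsStructureTensor T)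
    {a : Pt 𝕜 → Fin 3 → Fin 3 → Fin 3 → 𝕜} {f : Pt 𝕜 → Fin 3 → Fin 3 → 𝕜}
    (h0 : ∀ V : S.pot, ∀ x ∈ S.domain, ∀ p, cubic a f V x p = 0) {x : Pt 𝕜} (hx : x ∈ S.domain)
    (l m : Fin 3) : f x l m = 0 := by
  obtain ⟨V, hV, -, hg, -⟩ := hT.exists_jet x hx 0 (Pi.single m 1) 0
  have h1 := h0 ⟨V, hV⟩ x hx (Pi.single l 1)
  have h2 := h0 ⟨V, hV⟩ x hx (Pi.single l 2)
  simp only [cubic, hg, Pi.single_apply, mul_ite, mul_one, mul_zero, Finset.sum_ite_eq',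
    Finset.mem_univ, if_true, ite_mul, zero_mul]
    at h1 h2
  linear_combination (8 * h1 - h2) / 6

end

section

variable {S : System 𝕜} {T : Fin 3 → Fin 3 → Fin 3 → Pt 𝕜 → 𝕜}

/-! ### Brackets of second order constants -/

theorem phaseAnalytic_hamiltonian (hS : S.IsConformallyFlat) {V : Pt 𝕜 → 𝕜}
    (hV : AnalyticOnNhd 𝕜 V S.domain) : PhaseAnalytic S.domain (S.hamiltonian V) := by
  intro x hx p
  have hl : AnalyticAt 𝕜 (fun z : Pt 𝕜 × Pt 𝕜 => S.lam z.1) (x, p) :=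
    AnalyticAt.fun_comp (g := S.lam) (hS.analytic_lam x hx) analyticAt_fst
  have hv : AnalyticAt 𝕜 (fun z : Pt 𝕜 × Pt 𝕜 => V z.1) (x, p) :=
    AnalyticAt.fun_comp (g := V) (hV x hx) analyticAt_fst
  have hp (i : Fin 3) : AnalyticAt 𝕜 (fun z : Pt 𝕜 × Pt 𝕜 => z.2 i) (x, p) :=
    ((ContinuousLinearMap.proj i).comp (ContinuousLinearMap.snd 𝕜 (Pt 𝕜) (Pt 𝕜))).analyticAt _
  exact ((Finset.analyticAt_fun_sum _ fun i _ => (hp i).fun_pow 2).fun_div hl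
    (hS.lam_ne_zero x hx)).fun_add hv

theorem phaseAnalytic_quadForm {D : Set (Pt 𝕜)} {a : Pt 𝕜 → Fin 3 → Fin 3 → 𝕜} {W : Pt 𝕜 → 𝕜}
    (ha : ∀ k j, AnalyticOnNhd 𝕜 (fun x => a x k j) D) (hW : AnalyticOnNhd 𝕜 W D) :
    PhaseAnalytic D (fun y q => quadForm a y q + W y) := by
  intro x hx p
  have hl (k j : Fin 3) : AnalyticAt 𝕜 (fun z : Pt 𝕜 × Pt 𝕜 => a z.1 k j) (x, p) :=
    AnalyticAt.fun_comp (g := fun y => a y k j) (ha k j x hx) analyticAt_fst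
  have hv : AnalyticAt 𝕜 (fun z : Pt 𝕜 × Pt 𝕜 => W z.1) (x, p) :=
    AnalyticAt.fun_comp (g := W) (hW x hx) analyticAt_fst
  have hp (i : Fin 3) : AnalyticAt 𝕜 (fun z : Pt 𝕜 × Pt 𝕜 => z.2 i) (x, p) :=
    ((ContinuousLinearMap.proj i).comp (ContinuousLinearMap.snd 𝕜 (Pt 𝕜) (Pt 𝕜))).analyticAt _
  exact (Finset.analyticAt_fun_sum _ fun k _ => Finset.analyticAt_fun_sum _ fun j _ =>
    ((hl k j).fun_mul (hp k)).fun_mul (hp j)).fun_add hv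

theorem poissonBracket_congr {D : Set (Pt 𝕜)} (hD : IsOpen D) (F : Pt 𝕜 → Pt 𝕜 → 𝕜)
    {G G' : Pt 𝕜 → Pt 𝕜 → 𝕜} (h : ∀ x ∈ D, ∀ p, G x p = G' x p) {x : Pt 𝕜} (hx : x ∈ D)
    (p : Pt 𝕜) : poissonBracket F G x p = poissonBracket F G' x p := by
  simp only [poissonBracket, show G x = G' x from funext (h x hx),
    pd_congr _ hD (fun y hy => h y hy p) hx]

/-- The tensor `fⁿᵐ` of the bracket of two second order constants. -/
def bracketLin (S : System 𝕜) (a a' : Pt 𝕜 → Fin 3 → Fin 3 → 𝕜) (x : Pt 𝕜) (n m : Fin 3) : 𝕜 :=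
  2 * S.lam x * ∑ j, (a x j m * a' x j n - a x j n * a' x j m)

/-- The coefficients of the cubic part of the bracket of two quadratic forms, before
symmetrization. -/
def bracketCub (a a' : Pt 𝕜 → Fin 3 → Fin 3 → 𝕜) (x : Pt 𝕜) (k l n : Fin 3) : 𝕜 :=
  2 * ∑ j, (pd j (fun y => a y k l) x * a' x j n - a x j n * pd j (fun y => a' y k l) x)

/-- The symmetric coefficients of the cubic part of the bracket of two quadratic forms. -/
def bracketCubSymm (a a' : Pt 𝕜 → Fin 3 → Fin 3 → 𝕜) (x : Pt 𝕜) (k l n : Fin 3) : 𝕜 :=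
  (bracketCub a a' x k l n + bracketCub a a' x l n k + bracketCub a a' x n k l) / 3

theorem sum_cyclic_div_three (c : Fin 3 → Fin 3 → Fin 3 → 𝕜) (p : Fin 3 → 𝕜) :
    ∑ i, ∑ j, ∑ k, (c i j k + c j k i + c k i j) / 3 * p i * p j * p k =
      ∑ i, ∑ j, ∑ k, c i j k * p i * p j * p k := by
  simp only [Fin.sum_univ_three]
  ring

variable {a a' : Pt 𝕜 → Fin 3 → Fin 3 → 𝕜} {W W' : S.pot → Pt 𝕜 → 𝕜}

/-- The bracket of two second order constants depends on `V` only through its gradient, since `∂W`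
is linear in it. -/
theorem System.IsSecondOrderConstant.poissonBracket_eq_cubic (hS : S.IsConformallyFlat)
    (h : S.IsSecondOrderConstant a W) (h' : S.IsSecondOrderConstant a' W') (V : S.pot) {x : Pt 𝕜}
    (hx : x ∈ S.domain) (p : Pt 𝕜) :
    poissonBracket (fun y q => quadForm a y q + W V y) (fun y q => quadForm a' y q + W' V y) x p =
      cubic (bracketCubSymm a a') (bracketLin S a a') V x p := by
  have e1 := (h.coeff_eqs hS hx V).1
  have e2 := (h'.coeff_eqs hS hx V).1
  simp only [poissonBracket, pd_quadForm_right,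
    pd_quadForm_left _ (fun k l => (h.analytic_a k l x hx).differentiableAt)
    (h.analytic_W V x hx).differentiableAt,
    pd_quadForm_left _ (fun k l => (h'.analytic_a k l x hx).differentiableAt)
    (h'.analytic_W V x hx).differentiableAt, e1, e2, cubic, bracketCubSymm]
  rw [sum_cyclic_div_three (bracketCub a a' x) p]
  simp only [bracketCub, bracketLin, Fin.sum_univ_three, h.symm x hx 1 0, h.symm x hx 2 0,
    h.symm x hx 2 1, h'.symm x hx 1 0, h'.symm x hx 2 0, h'.symm x hx 2 1]
  ring

/-- The bracket of two second order constants is a truly third order constant, by Poisson's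
theorem. -/
theorem System.IsSecondOrderConstant.isThirdOrderConstant (hS : S.IsConformallyFlat)
    (h : S.IsSecondOrderConstant a W) (h' : S.IsSecondOrderConstant a' W') :
    S.IsThirdOrderConstant (bracketCubSymm a a') (bracketLin S a a') where
  analytic_a k l n x hx := by
    have hc (k l n : Fin 3) : AnalyticAt 𝕜 (fun x => bracketCub a a' x k l n) x :=
      analyticAt_const.fun_mul (Finset.analyticAt_fun_sum _ fun j _ =>
        ((analyticAt_pd j (h.analytic_a k l x hx)).fun_mul (h'.analytic_a j n x hx)).fun_sub
        ((h.analytic_a j n x hx).fun_mul (analyticAt_pd j (h'.analytic_a k l x hx))))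
    exact (((hc k l n).fun_add (hc l n k)).fun_add (hc n k l)).fun_div analyticAt_const
      three_ne_zero
  analytic_f n m x hx := (analyticAt_const.fun_mul (hS.analytic_lam x hx)).fun_mul
    (Finset.analyticAt_fun_sum _ fun j _ =>
      ((h.analytic_a j m x hx).fun_mul (h'.analytic_a j n x hx)).fun_sub
        ((h.analytic_a j n x hx).fun_mul (h'.analytic_a j m x hx)))
  symm x hx := by
    have hs (k l n : Fin 3) : bracketCub a a' x k l n = bracketCub a a' x l k n := by
      simp only [bracketCub, pd_congr _ hS.isOpen (fun y hy => h.symm y hy k l) hx,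
        pd_congr _ hS.isOpen (fun y hy => h'.symm y hy k l) hx]
    intro k l n
    simp only [bracketCubSymm]
    constructor
    · linear_combination (hs k l n + hs l n k + hs n k l) / 3
    · linear_combination (hs k l n + hs l n k + hs n k l) / 3
  bracket_eq_zero V x hx p := by
    rw [← poissonBracket_congr hS.isOpen _ (fun y hy q => h.poissonBracket_eq_cubic hS h' V hy q)
      hx p]
    exact poissonBracket_poissonBracket_eq_zero hS.isOpen
      (phaseAnalytic_hamiltonian hS (S.analytic_pot V V.2))
      (phaseAnalytic_quadForm h.analytic_a (h.analytic_W V))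
      (phaseAnalytic_quadForm h'.analytic_a (h'.analytic_W V))
      (fun y hy q => h.bracket_eq_zero V y hy q) (fun y hy q => h'.bracket_eq_zero V y hy q) hx p

/-- The commutator of two symmetric matrices, `b' b - b b'`. -/
def symComm (b b' : Fin 3 → Fin 3 → 𝕜) (n m : Fin 3) : 𝕜 :=
  ∑ j, (b j m * b' j n - b j n * b' j m)

/-- The derivative of `λ⁻¹ symComm b b'`, up to the factor `λ⁻¹`, for two solutions of the system
`∂ᵢ bⱼₖ = M(b)ᵢⱼₖ`. -/
def symCommDeriv (τ : Fin 3 → Fin 3 → Fin 3 → 𝕜) (L : Fin 3 → 𝕜) (b b' : Fin 3 → Fin 3 → 𝕜)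
    (k n m : Fin 3) : 𝕜 :=
  symComm (connM τ L b k) b' n m + symComm b (connM τ L b' k) n m - L k * symComm b b' n m

/-- The divergence of the vector dual to `λ⁻¹ symComm b b'`, up to the factor `λ⁻¹`. -/
def symCommDiv (τ : Fin 3 → Fin 3 → Fin 3 → 𝕜) (L : Fin 3 → 𝕜) (b b' : Fin 3 → Fin 3 → 𝕜) : 𝕜 :=
  symCommDeriv τ L b b' 2 0 1 + symCommDeriv τ L b b' 0 1 2 + symCommDeriv τ L b b' 1 2 0

section

/-! The divergences of the commutators of matrices `symUnit` needed below. -/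

variable (s : Fin 7 → 𝕜) (u L : Fin 3 → 𝕜)

theorem symCommDiv_00_11 :
    symCommDiv (structT s u) L (symUnit 0 0) (symUnit 1 1) =
    2 * s 6 := by
  simp only [symCommDiv, symCommDeriv, symComm, Fin.sum_univ_three, connM_structT_001,
    connM_structT_002, connM_structT_011, connM_structT_012, connM_structT_021, connM_structT_022,
    connM_structT_100, connM_structT_102, connM_structT_110, connM_structT_112, connM_structT_120,
    connM_structT_122, connM_structT_200, connM_structT_201, connM_structT_210, connM_structT_211,
    connM_structT_220, connM_structT_221]
  simp [symUnit]
  ring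

theorem symCommDiv_22_01 :
    symCommDiv (structT s u) L (symUnit 2 2) (symUnit 0 1) =
    -2 * s 1 + 2 * s 3 := by
  simp only [symCommDiv, symCommDeriv, symComm, Fin.sum_univ_three, connM_structT_001,
    connM_structT_002, connM_structT_011, connM_structT_012, connM_structT_021, connM_structT_022,
    connM_structT_100, connM_structT_102, connM_structT_110, connM_structT_112, connM_structT_120,
    connM_structT_122, connM_structT_200, connM_structT_201, connM_structT_210, connM_structT_211,
    connM_structT_220, connM_structT_221]
  simp [symUnit]
  ring

theorem symCommDiv_11_02 :
    symCommDiv (structT s u) L (symUnit 1 1) (symUnit 0 2) =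
    -2 * s 5 + 2 * s 0 := by
  simp only [symCommDiv, symCommDeriv, symComm, Fin.sum_univ_three, connM_structT_001,
    connM_structT_002, connM_structT_011, connM_structT_012, connM_structT_021, connM_structT_022,
    connM_structT_100, connM_structT_102, connM_structT_110, connM_structT_112, connM_structT_120,
    connM_structT_122, connM_structT_200, connM_structT_201, connM_structT_210, connM_structT_211,
    connM_structT_220, connM_structT_221]
  simp [symUnit]
  ring

theorem symCommDiv_00_12 :
    symCommDiv (structT s u) L (symUnit 0 0) (symUnit 1 2) =
    -2 * s 2 + 2 * s 4 := by
  simp only [symCommDiv, symCommDeriv, symComm, Fin.sum_univ_three, connM_structT_001,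
    connM_structT_002, connM_structT_011, connM_structT_012, connM_structT_021, connM_structT_022,
    connM_structT_100, connM_structT_102, connM_structT_110, connM_structT_112, connM_structT_120,
    connM_structT_122, connM_structT_200, connM_structT_201, connM_structT_210, connM_structT_211,
    connM_structT_220, connM_structT_221]
  simp [symUnit]
  ring

theorem symCommDiv_00_01 :
    symCommDiv (structT s u) L (symUnit 0 0) (symUnit 0 1) =
    2 * s 1 + 6 * u 2 + L 2 := by
  simp only [symCommDiv, symCommDeriv, symComm, Fin.sum_univ_three, connM_structT_001,
    connM_structT_002, connM_structT_011, connM_structT_012, connM_structT_021, connM_structT_022,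
    connM_structT_100, connM_structT_102, connM_structT_110, connM_structT_112, connM_structT_120,
    connM_structT_122, connM_structT_200, connM_structT_201, connM_structT_210, connM_structT_211,
    connM_structT_220, connM_structT_221]
  simp [symUnit]
  ring

theorem symCommDiv_02_12 :
    symCommDiv (structT s u) L (symUnit 0 2) (symUnit 1 2) =
    -4 * s 1 - 4 * s 3 + 6 * u 2 + L 2 := by
  simp only [symCommDiv, symCommDeriv, symComm, Fin.sum_univ_three, connM_structT_001,
    connM_structT_002, connM_structT_011, connM_structT_012, connM_structT_021, connM_structT_022,
    connM_structT_100, connM_structT_102, connM_structT_110, connM_structT_112, connM_structT_120,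
    connM_structT_122, connM_structT_200, connM_structT_201, connM_structT_210, connM_structT_211,
    connM_structT_220, connM_structT_221]
  simp [symUnit]
  ring

theorem symCommDiv_00_02 :
    symCommDiv (structT s u) L (symUnit 0 0) (symUnit 0 2) =
    -2 * s 0 - 6 * u 1 - L 1 := by
  simp only [symCommDiv, symCommDeriv, symComm, Fin.sum_univ_three, connM_structT_001,
    connM_structT_002, connM_structT_011, connM_structT_012, connM_structT_021, connM_structT_022,
    connM_structT_100, connM_structT_102, connM_structT_110, connM_structT_112, connM_structT_120,
    connM_structT_122, connM_structT_200, connM_structT_201, connM_structT_210, connM_structT_211,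
    connM_structT_220, connM_structT_221]
  simp [symUnit]
  ring

theorem symCommDiv_01_12 :
    symCommDiv (structT s u) L (symUnit 0 1) (symUnit 1 2) =
    4 * s 0 + 4 * s 5 - 6 * u 1 - L 1 := by
  simp only [symCommDiv, symCommDeriv, symComm, Fin.sum_univ_three, connM_structT_001,
    connM_structT_002, connM_structT_011, connM_structT_012, connM_structT_021, connM_structT_022,
    connM_structT_100, connM_structT_102, connM_structT_110, connM_structT_112, connM_structT_120,
    connM_structT_122, connM_structT_200, connM_structT_201, connM_structT_210, connM_structT_211,
    connM_structT_220, connM_structT_221]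
  simp [symUnit]
  ring

theorem symCommDiv_11_12 :
    symCommDiv (structT s u) L (symUnit 1 1) (symUnit 1 2) =
    2 * s 2 + 6 * u 0 + L 0 := by
  simp only [symCommDiv, symCommDeriv, symComm, Fin.sum_univ_three, connM_structT_001,
    connM_structT_002, connM_structT_011, connM_structT_012, connM_structT_021, connM_structT_022,
    connM_structT_100, connM_structT_102, connM_structT_110, connM_structT_112, connM_structT_120,
    connM_structT_122, connM_structT_200, connM_structT_201, connM_structT_210, connM_structT_211,
    connM_structT_220, connM_structT_221]
  simp [symUnit]
  ring

theorem symCommDiv_01_02 :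
    symCommDiv (structT s u) L (symUnit 0 1) (symUnit 0 2) =
    -4 * s 2 - 4 * s 4 + 6 * u 0 + L 0 := by
  simp only [symCommDiv, symCommDeriv, symComm, Fin.sum_univ_three, connM_structT_001,
    connM_structT_002, connM_structT_011, connM_structT_012, connM_structT_021, connM_structT_022,
    connM_structT_100, connM_structT_102, connM_structT_110, connM_structT_112, connM_structT_120,
    connM_structT_122, connM_structT_200, connM_structT_201, connM_structT_210, connM_structT_211,
    connM_structT_220, connM_structT_221]
  simp [symUnit]
  ring

end

/-- If the totally symmetric part of the structure tensor does not vanish, then the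
pairs of commutators and their divergences span a space of dimension four. Pairs of matrices
`symUnit` with proportional commutators show that the divergence is not a function of the
commutator, since their divergences involve different components of the totally symmetric part. -/
theorem eq_zero_of_symComm {s : Fin 7 → 𝕜} (hs : s ≠ 0) (u L : Fin 3 → 𝕜) {c : Fin 4 → 𝕜}
    (h : ∀ b b' : Fin 3 → Fin 3 → 𝕜, (∀ j k, b j k = b k j) → (∀ j k, b' j k = b' k j) →
      c 0 * symComm b b' 0 1 + c 1 * symComm b b' 0 2 + c 2 * symComm b b' 1 2 +
        c 3 * symCommDiv (structT s u) L b b' = 0) : c = 0 := by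
  have key (i j k l : Fin 3) := h (symUnit i j) (symUnit k l) (symUnit_symm i j) (symUnit_symm k l)
  have k1 := key 0 0 1 1
  have k2 := key 2 2 0 1
  have k3 := key 1 1 0 2
  have k4 := key 0 0 1 2
  have k5 := key 0 0 0 1
  have k6 := key 0 2 1 2
  have k7 := key 0 0 0 2
  have k8 := key 0 1 1 2
  have k9 := key 1 1 1 2
  have k10 := key 0 1 0 2
  simp only [symCommDiv_00_11, symCommDiv_22_01, symCommDiv_11_02, symCommDiv_00_12,
    symCommDiv_00_01, symCommDiv_02_12, symCommDiv_00_02, symCommDiv_01_12, symCommDiv_11_12,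
    symCommDiv_01_02] at k1 k2 k3 k4 k5 k6 k7 k8 k9 k10
  simp [symComm, symUnit] at k1 k2 k3 k4 k5 k6 k7 k8 k9 k10
  have h3 : c 3 = 0 := by
    by_contra h3
    refine hs ?_
    have e6 : c 3 * s 6 = 0 := by grind
    have e1 : c 3 * s 1 = 0 := by grind
    have e3 : c 3 * s 3 = 0 := by grind
    have e0 : c 3 * s 0 = 0 := by grind
    have e5 : c 3 * s 5 = 0 := by grind
    have e2 : c 3 * s 2 = 0 := by grind
    have e4 : c 3 * s 4 = 0 := by grind
    funext i
    fin_cases i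
    exacts [(mul_eq_zero.1 e0).resolve_left h3, (mul_eq_zero.1 e1).resolve_left h3,
      (mul_eq_zero.1 e2).resolve_left h3, (mul_eq_zero.1 e3).resolve_left h3,
      (mul_eq_zero.1 e4).resolve_left h3, (mul_eq_zero.1 e5).resolve_left h3,
      (mul_eq_zero.1 e6).resolve_left h3]
  simp only [h3, zero_mul, add_zero] at k5 k7 k9
  funext i
  fin_cases i
  exacts [by simpa using k5, by simpa using k7, by simpa using k9, h3]

end

section

variable {S : System 𝕜} {T : Fin 3 → Fin 3 → Fin 3 → Pt 𝕜 → 𝕜}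

/-! ### The space of truly third order constants -/

/-- The space of the coefficients of truly third order constants. -/
def System.thirdOrderPairs (S : System 𝕜) :
    Submodule 𝕜 ((Pt 𝕜 → Fin 3 → Fin 3 → Fin 3 → 𝕜) × (Pt 𝕜 → Fin 3 → Fin 3 → 𝕜)) where
  carrier := {z | S.IsThirdOrderConstant z.1 z.2}
  zero_mem' := isThirdOrderConstant_zero S
  add_mem' h h' := System.IsThirdOrderConstant.add h h'
  smul_mem' c _ h := System.IsThirdOrderConstant.smul c h

/-- The phase space functions given by coefficients of truly third order constants. -/
def System.cubicMap (S : System 𝕜) : S.thirdOrderPairs →ₗ[𝕜] S.Family where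
  toFun z V x p := cubic z.1.1 z.1.2 V x p
  map_add' z w := by
    funext V x p
    simp [cubic_add]
  map_smul' c z := by
    funext V x p
    simp [cubic_smul]

theorem System.range_cubicMap (S : System 𝕜) :
    LinearMap.range S.cubicMap = S.thirdOrderConstants := by
  ext K
  constructor
  · rintro ⟨z, rfl⟩
    exact ⟨z.1.1, z.1.2, z.2, rfl⟩
  · rintro ⟨a, f, h, rfl⟩
    exact ⟨⟨(a, f), h⟩, rfl⟩

theorem skewDiv_add {f f' : Pt 𝕜 → Fin 3 → Fin 3 → 𝕜} {x : Pt 𝕜}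
    (hf : ∀ l m, DifferentiableAt 𝕜 (fun y => f y l m) x)
    (hf' : ∀ l m, DifferentiableAt 𝕜 (fun y => f' y l m) x) :
    skewDiv (f + f') x = skewDiv f x + skewDiv f' x := by
  simp only [skewDiv, Pi.add_apply, pd_add _ (hf _ _) (hf' _ _)]
  ring

theorem skewDiv_smul (c : 𝕜) {f : Pt 𝕜 → Fin 3 → Fin 3 → 𝕜} {x : Pt 𝕜}
    (hf : ∀ l m, DifferentiableAt 𝕜 (fun y => f y l m) x) :
    skewDiv (c • f) x = c * skewDiv f x := by
  simp only [skewDiv, Pi.smul_apply, smul_eq_mul, pd_const_mul _ c (hf _ _)]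
  ring

/-- The values of `f` and `skewDiv f` at a point, which determine a truly third order constant. -/
def System.thirdOrderJet (S : System 𝕜) {x : Pt 𝕜} (hx : x ∈ S.domain) :
    S.thirdOrderPairs →ₗ[𝕜] (Fin 4 → 𝕜) where
  toFun z := ![z.1.2 x 0 1, z.1.2 x 0 2, z.1.2 x 1 2, skewDiv z.1.2 x]
  map_add' z w := by
    have h := skewDiv_add (fun l m => (z.2.analytic_f l m x hx).differentiableAt)
      (fun l m => (w.2.analytic_f l m x hx).differentiableAt)
    simp [h]
  map_smul' c z := by
    have h := skewDiv_smul c (fun l m => (z.2.analytic_f l m x hx).differentiableAt)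
    simp [h]

/-- A truly third order constant is given by its four initial values at a point, and conversely
determines them. -/
theorem System.ker_thirdOrderJet (hS : S.IsConformallyFlat) (hT : S.IsStructureTensor T)
    {x : Pt 𝕜} (hx : x ∈ S.domain) :
    LinearMap.ker (S.thirdOrderJet hx) = LinearMap.ker S.cubicMap := by
  ext z
  simp only [LinearMap.mem_ker]
  constructor
  · intro h
    have h01 : z.1.2 x 0 1 = 0 := congr_fun h 0
    have h02 : z.1.2 x 0 2 = 0 := congr_fun h 1
    have h12 : z.1.2 x 1 2 = 0 := congr_fun h 2
    have hs := z.2.skew hS hT hx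
    have h0 : ∀ l m, z.1.2 x l m = 0 := by
      have hd (l : Fin 3) : z.1.2 x l l = 0 := self_eq_neg.1 (hs l l)
      intro l m
      fin_cases l <;> fin_cases m <;> simp [hd, h01, h02, h12, hs 1 0, hs 2 0, hs 2 1]
    have hz := fun y (hy : y ∈ S.domain) => z.2.eq_zero hS hT hx h0 (congr_fun h 3) hy
    funext V y p
    simp [System.cubicMap, cubic, hz y y.2]
  · intro h
    have hf : ∀ y ∈ S.domain, ∀ l m, z.1.2 y l m = 0 := fun y hy =>
      hT.eq_zero_of_cubic_eq_zero
        (fun V x hx p => congr_fun (congr_fun (congr_fun h V) ⟨x, hx⟩) p) hy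
    have hd (j l m : Fin 3) : pd j (fun y => z.1.2 y l m) x = 0 := by
      rw [pd_congr j hS.isOpen (fun y hy => hf y hy l m) hx, pd_const]
    funext i
    fin_cases i <;> simp [System.thirdOrderJet, hf x hx, skewDiv, hd]

/-- The coefficients of the brackets of second order constants. -/
def System.bracketPairs (S : System 𝕜) : Set S.thirdOrderPairs :=
  {z | ∃ a W a' W', S.IsSecondOrderConstant a W ∧ S.IsSecondOrderConstant a' W' ∧
    z.1 = (bracketCubSymm a a', bracketLin S a a')}

theorem System.cubicMap_image_bracketPairs (hS : S.IsConformallyFlat) :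
    S.cubicMap '' S.bracketPairs = S.secondOrderBrackets := by
  ext K
  constructor
  · rintro ⟨z, ⟨a, W, a', W', h, h', hz⟩, rfl⟩
    refine ⟨a, W, a', W', h, h', ?_⟩
    funext V x p
    simp only [System.cubicMap, LinearMap.coe_mk, AddHom.coe_mk, hz]
    exact (h.poissonBracket_eq_cubic hS h' V x.2 p).symm
  · rintro ⟨a, W, a', W', h, h', rfl⟩
    refine ⟨⟨(bracketCubSymm a a', bracketLin S a a'), h.isThirdOrderConstant hS h'⟩,
      ⟨a, W, a', W', h, h', rfl⟩, ?_⟩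
    funext V x p
    exact (h.poissonBracket_eq_cubic hS h' V x.2 p).symm

theorem System.bracketLin_eq (hS : S.IsConformallyFlat) {b b' : Pt 𝕜 → Fin 3 → Fin 3 → 𝕜}
    {x : Pt 𝕜} (hx : x ∈ S.domain) (n m : Fin 3) :
    bracketLin S (fun x j k => (S.lam x)⁻¹ * b x j k) (fun x j k => (S.lam x)⁻¹ * b' x j k) x n m =
      2 * (S.lam x)⁻¹ * symComm (b x) (b' x) n m := by
  have h0 := hS.lam_ne_zero x hx
  simp only [bracketLin, symComm, Fin.sum_univ_three]
  field_simp

theorem System.IsTensorSolution.pd_bracketLin (hS : S.IsConformallyFlat)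
    {b b' : Pt 𝕜 → Fin 3 → Fin 3 → 𝕜} (hb : S.IsTensorSolution T b)
    (hb' : S.IsTensorSolution T b') {x : Pt 𝕜} (hx : x ∈ S.domain) (k n m : Fin 3) :
    pd k (fun x => bracketLin S (fun x j k => (S.lam x)⁻¹ * b x j k)
        (fun x j k => (S.lam x)⁻¹ * b' x j k) x n m) x =
      2 * (S.lam x)⁻¹ * symCommDeriv (fun i j k => T i j k x) (S.logGrad x) (b x) (b' x) k n m := by
  have h0 := hS.lam_ne_zero x hx
  have hl := (hS.analytic_lam x hx).differentiableAt
  have hi : DifferentiableAt 𝕜 (fun y => (S.lam y)⁻¹) x := hl.fun_inv h0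
  have hd (j k) := (hb.analytic j k x hx).differentiableAt
  have hd' (j k) := (hb'.analytic j k x hx).differentiableAt
  have hc : DifferentiableAt 𝕜 (fun y => symComm (b y) (b' y) n m) x := by
    unfold symComm
    fun_prop
  have hp : pd k (fun y => symComm (b y) (b' y) n m) x =
      symComm (connM (fun i j k => T i j k x) (S.logGrad x) (b x) k) (b' x) n m +
        symComm (b x) (connM (fun i j k => T i j k x) (S.logGrad x) (b' x) k) n m := by
    simp only [symComm]
    rw [pd_sum _ k (fun j _ => by fun_prop), ← Finset.sum_add_distrib]
    refine Finset.sum_congr rfl fun j _ => ?_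
    simp (disch := fun_prop) only [pd_sub, pd_mul, hb.pd_eq x hx, hb'.pd_eq x hx]
    ring
  rw [pd_congr k hS.isOpen (fun y hy => System.bracketLin_eq hS hy n m) hx]
  simp only [mul_assoc]
  rw [pd_const_mul k _ (hi.fun_mul hc), pd_mul k hi hc, hp, pd_inv k hl h0]
  simp only [symCommDeriv, System.logGrad]
  field_simp
  ring

/-- If the totally symmetric part of the structure tensor does not vanish at a point, then there
are linear combinations of brackets with arbitrary values of `f` and `skewDiv f` there. -/
theorem System.IsSuperintegrable.span_thirdOrderJet (hsuper : S.IsSuperintegrable)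
    (hS : S.IsConformallyFlat) (hT : S.IsStructureTensor T) {x : Pt 𝕜} (hx : x ∈ S.domain)
    {s : Fin 7 → 𝕜} {u : Fin 3 → 𝕜} (hsu : (fun i j k => T i j k x) = structT s u) (hs : s ≠ 0) :
    Submodule.span 𝕜 (S.thirdOrderJet hx '' S.bracketPairs) = ⊤ := by
  by_contra hne
  obtain ⟨ℓ, hℓ0, hℓ⟩ := Submodule.exists_le_ker_of_lt_top _ (lt_top_iff_ne_top.2 hne)
  refine hℓ0 (LinearMap.pi_ext' fun i => LinearMap.ext_ring ?_)
  have h0 := hS.lam_ne_zero x hx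
  have hsum (v : Fin 4 → 𝕜) : ℓ v = ∑ i, ℓ (Pi.single i 1) * v i := by
    conv_lhs => rw [pi_eq_sum_univ' v]
    simp [map_sum, mul_comm]
  refine congr_fun (eq_zero_of_symComm hs u (S.logGrad x) (c := fun i => ℓ (Pi.single i 1))
    fun B B' hB hB' => ?_) i
  obtain ⟨b, hb, hbx⟩ := hsuper.exists_isTensorSolution hS hT hx hB
  obtain ⟨b', hb', hbx'⟩ := hsuper.exists_isTensorSolution hS hT hx hB'
  obtain ⟨W, hW⟩ := hb.exists_isSecondOrderConstant hS hT
  obtain ⟨W', hW'⟩ := hb'.exists_isSecondOrderConstant hS hT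
  have hmem : S.thirdOrderJet hx ⟨_, hW.isThirdOrderConstant hS hW'⟩ ∈ LinearMap.ker ℓ :=
    hℓ (Submodule.subset_span ⟨_, ⟨_, W, _, W', hW, hW', rfl⟩, rfl⟩)
  have e1 : b x = B := funext fun j => funext fun k => hbx j k
  have e2 : b' x = B' := funext fun j => funext fun k => hbx' j k
  rw [LinearMap.mem_ker, hsum] at hmem
  simp only [System.thirdOrderJet, LinearMap.coe_mk, AddHom.coe_mk, skewDiv,
    hb.pd_bracketLin hS hb' hx, System.bracketLin_eq hS hx, Fin.sum_univ_four, e1, e2, hsu] at hmem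
  simp at hmem
  refine (mul_eq_zero.1 ?_).resolve_left (mul_ne_zero two_ne_zero (inv_ne_zero h0))
  rw [← hmem]
  simp only [symCommDiv]
  ring

/-- If the totally symmetric part of the structure tensor does not vanish at a point, then the four
initial values there identify the truly third order constants with `𝕜⁴`, and they are spanned by
brackets. -/
theorem System.IsSuperintegrable.thirdOrderConstants_of_ne_zero (hsuper : S.IsSuperintegrable)
    (hS : S.IsConformallyFlat) (hT : S.IsStructureTensor T) {x : Pt 𝕜} (hx : x ∈ S.domain)
    {s : Fin 7 → 𝕜} {u : Fin 3 → 𝕜} (hsu : (fun i j k => T i j k x) = structT s u) (hs : s ≠ 0) :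
    Module.finrank 𝕜 S.thirdOrderConstants = 4 ∧
      Submodule.span 𝕜 S.secondOrderBrackets = S.thirdOrderConstants := by
  have hker := System.ker_thirdOrderJet hS hT hx
  have hspan := hsuper.span_thirdOrderJet hS hT hx hsu hs
  rw [Submodule.span_image] at hspan
  have hsurj : Function.Surjective (S.thirdOrderJet hx) := by
    rw [← LinearMap.range_eq_top, ← top_le_iff, ← hspan]
    exact LinearMap.map_le_range
  constructor
  · rw [← System.range_cubicMap, ← S.cubicMap.quotKerEquivRange.finrank_eq, ← hker,
      ((S.thirdOrderJet hx).quotKerEquivOfSurjective hsurj).finrank_eq]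
    simp
  · rw [← System.cubicMap_image_bracketPairs hS, Submodule.span_image, ← System.range_cubicMap]
    refine le_antisymm LinearMap.map_le_range ?_
    rintro _ ⟨z, rfl⟩
    obtain ⟨w, hw, hwz⟩ : S.thirdOrderJet hx z ∈
        Submodule.map (S.thirdOrderJet hx) (Submodule.span 𝕜 S.bracketPairs) := by
      rw [hspan]
      trivial
    refine ⟨w, hw, ?_⟩
    have : w - z ∈ LinearMap.ker S.cubicMap := by
      rw [← hker, LinearMap.mem_ker, map_sub, hwz, sub_self]
    rwa [LinearMap.mem_ker, map_sub, sub_eq_zero] at this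

end

section

variable {S : System 𝕜} {T : Fin 3 → Fin 3 → Fin 3 → Pt 𝕜 → 𝕜}

/-! ### Vanishing of the totally symmetric part -/

/-- The integrability conditions of the potential equations when the totally symmetric part of the
structure tensor vanishes. -/
theorem PotIntegrable.riccati {u : Fin 3 → 𝕜} {du : Fin 3 → Fin 3 → 𝕜}
    (h : PotIntegrable (structT 0 u) (fun l => structT 0 (du l))) :
    ∃ ν : 𝕜, ∀ i j, du j i = 3 * u i * u j + if i = j then ν else 0 := by
  refine ⟨du 0 0 - 3 * u 0 * u 0, fun i j => ?_⟩
  have e (i j k m : Fin 3) := h i j k m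
  simp only [Fin.sum_univ_three, structT, harmonicCubic] at e
  have e1 := e 0 0 1 0
  have e2 := e 0 0 1 1
  have e3 := e 0 0 1 2
  have e4 := e 0 0 2 0
  have e5 := e 0 0 2 1
  have e6 := e 0 0 2 2
  have e7 := e 1 1 0 0
  have e8 := e 1 1 0 1
  have e9 := e 1 1 0 2
  have e10 := e 1 1 2 1
  have e11 := e 2 2 0 2
  have e12 := e 1 1 2 2
  have e13 := e 1 1 2 0
  have e14 := e 0 1 2 0
  have e15 := e 0 1 2 1
  have e16 := e 0 1 2 2
  simp at e1 e2 e3 e4 e5 e6 e7 e8 e9 e10 e11 e12 e13 e14 e15 e16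
  fin_cases i <;> fin_cases j <;> simp <;> grind

/-- Flatness of the system for second order constants when the totally symmetric part of the
structure tensor vanishes: `-L / 3 - u` satisfies the Riccati equations of the logarithmic gradient
of a quadratic function of zero discriminant. -/
theorem riccati_of_curv_eq_zero {u L : Fin 3 → 𝕜} {du dL : Fin 3 → Fin 3 → 𝕜} {ν : 𝕜}
    (hu : ∀ i j, du j i = 3 * u i * u j + if i = j then ν else 0) (hdL : ∀ i j, dL i j = dL j i)
    (hc : ∀ b : Fin 3 → Fin 3 → 𝕜, (∀ j k, b j k = b k j) →
      curv (structT 0 u) L (fun l => structT 0 (du l)) dL b = 0) (i j : Fin 3) :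
    -dL j i / 3 - du j i = -(-L i / 3 - u i) * (-L j / 3 - u j) +
      if i = j then (∑ k, (-L k / 3 - u k) ^ 2) / 2 else 0 := by
  have key (b c l i j k : Fin 3) := congr_fun (congr_fun (congr_fun (congr_fun
    (hc (symUnit b c) (symUnit_symm b c)) l) i) j) k
  have e1 := key 0 0 0 1 0 0
  have e2 := key 0 0 0 2 0 0
  have e3 := key 0 0 0 1 0 2
  have e4 := key 0 0 0 1 0 1
  have e5 := key 0 0 0 2 0 2
  have e6 := key 1 1 1 2 1 2
  simp only [curv, connM_structT_000, connM_structT_001, connM_structT_002, connM_structT_010,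
    connM_structT_011, connM_structT_012, connM_structT_020, connM_structT_021, connM_structT_022,
    connM_structT_100, connM_structT_101, connM_structT_102, connM_structT_110, connM_structT_111,
    connM_structT_112, connM_structT_120, connM_structT_121, connM_structT_122, connM_structT_200,
    connM_structT_201, connM_structT_202, connM_structT_210, connM_structT_211, connM_structT_212,
    connM_structT_220, connM_structT_221, connM_structT_222] at e1 e2 e3 e4 e5 e6
  simp [symUnit, hu] at e1 e2 e3 e4 e5 e6
  rw [hu]
  fin_cases i <;> fin_cases j <;> simp [Fin.sum_univ_three, hdL 1 0, hdL 2 0, hdL 2 1]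
  · linear_combination (e4 + e5 - e6) / 2
  · linear_combination -e1
  · linear_combination -e2
  · linear_combination -e1
  · linear_combination (e4 + e6 - e5) / 2
  · linear_combination e3
  · linear_combination -e2
  · linear_combination e3
  · linear_combination (e5 + e6 - e4) / 2

end

/-! ### Quadratic functions and Riccati equations -/

/-- A function with a logarithmic gradient vanishes identically if it vanishes at a point. -/
theorem eq_zero_of_pd_eq_mul {D : Set (Pt 𝕜)} (hD : IsOpen D) (hc : Convex ℝ D)
    {s : Fin 3 → Pt 𝕜 → 𝕜} (hs : ∀ i, ContinuousOn (s i) D) {F : Pt 𝕜 → 𝕜}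
    (hF : DifferentiableOn 𝕜 F D) (h : ∀ x ∈ D, ∀ i, pd i F x = s i x * F x) {x₀ : Pt 𝕜}
    (hx₀ : x₀ ∈ D) (h0 : F x₀ = 0) : ∀ x ∈ D, F x = 0 := by
  intro x hx
  have := eq_zero_of_linear_system hD hc (fun i x => s i x • LinearMap.id (M := Unit → 𝕜))
    (fun i v a => by
      show ContinuousOn (fun x => s i x * v a) D
      exact (hs i).fun_mul continuousOn_const) (fun x _ => F x)
    (fun _ => hF) (fun x hx i _ => h x hx i) hx₀ (funext fun _ => h0) x hx
  exact congr_fun this ()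

/-- A total system for `∂F`, `w` and `z` whose solutions vanish identically if they vanish at a
point. -/
theorem eq_zero_of_gradient_system {D : Set (Pt 𝕜)} (hD : IsOpen D) (hc : Convex ℝ D)
    {σ : Fin 3 → Pt 𝕜 → 𝕜} (hσ : ∀ i, ContinuousOn (σ i) D) {μ : Pt 𝕜 → 𝕜} (hμ : ContinuousOn μ D)
    (c : 𝕜) {F z : Pt 𝕜 → 𝕜} {w : Fin 3 → Pt 𝕜 → 𝕜} (hF : DifferentiableOn 𝕜 F D)
    (hw : ∀ i, DifferentiableOn 𝕜 (w i) D) (hz : DifferentiableOn 𝕜 z D)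
    (h : ∀ x ∈ D, ∀ j, pd j F x = c * w j x ∧
      (∀ i, pd j (w i) x = (if i = j then z x else 0) - σ i x * w j x) ∧
      pd j z x = -μ x * w j x)
    {x₀ : Pt 𝕜} (hx₀ : x₀ ∈ D) (hF0 : F x₀ = 0) (hw0 : ∀ i, w i x₀ = 0) (hz0 : z x₀ = 0) :
    ∀ x ∈ D, F x = 0 ∧ (∀ i, w i x = 0) ∧ z x = 0 := by
  let y : Pt 𝕜 → Option (Option (Fin 3)) → 𝕜 := fun x s =>
    s.elim (F x) fun s => s.elim (z x) fun i => w i x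
  let Φ : Fin 3 → Pt 𝕜 → (Option (Option (Fin 3)) → 𝕜) →ₗ[𝕜] (Option (Option (Fin 3)) → 𝕜) :=
    fun j x =>
    { toFun := fun v s => s.elim (c * v (some (some j))) fun s =>
        s.elim (-μ x * v (some (some j))) fun i =>
          (if i = j then 1 else 0) * v (some none) - σ i x * v (some (some j))
      map_add' := fun v w => by
        funext s
        rcases s with _ | _ | s <;> simp only [Option.elim, Pi.add_apply] <;> ring
      map_smul' := fun e v => by
        funext s
        rcases s with _ | _ | s <;>
          simp only [Option.elim, Pi.smul_apply, smul_eq_mul, RingHom.id_apply] <;> ring }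
  have key := eq_zero_of_linear_system hD hc Φ (y := y) ?_ ?_ ?_ hx₀ ?_
  · intro x hx
    exact ⟨congr_fun (key x hx) none, fun i => congr_fun (key x hx) (some (some i)),
      congr_fun (key x hx) (some none)⟩
  · intro i v s
    rcases s with _ | _ | s <;>
      simp only [Φ, LinearMap.coe_mk, AddHom.coe_mk, Option.elim] <;> fun_prop
  · intro s
    rcases s with _ | _ | s
    exacts [hF, hz, hw s]
  · intro x hx j s
    rcases s with _ | _ | s
    · exact (h x hx j).1
    · exact (h x hx j).2.2
    · simp only [y, Φ, LinearMap.coe_mk, AddHom.coe_mk, Option.elim]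
      rw [(h x hx j).2.1 s]
      simp
  · funext s
    rcases s with _ | _ | s
    exacts [hF0, hz0, hw0 s]

/-- The inhomogeneous quadratic function with isotropic quadratic part and the given `1`-jet at
`x₀`. -/
def isoQuad (x₀ : Pt 𝕜) (α : 𝕜) (β : Fin 3 → 𝕜) (γ : 𝕜) (x : Pt 𝕜) : 𝕜 :=
  α * ∑ i, (x i - x₀ i) ^ 2 + ∑ i, β i * (x i - x₀ i) + γ

theorem analyticAt_isoQuad (x₀ : Pt 𝕜) (α : 𝕜) (β : Fin 3 → 𝕜) (γ : 𝕜) (x : Pt 𝕜) :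
    AnalyticAt 𝕜 (isoQuad x₀ α β γ) x := by
  have h (i : Fin 3) : AnalyticAt 𝕜 (fun y : Pt 𝕜 => y i - x₀ i) x :=
    ((ContinuousLinearMap.proj (R := 𝕜) (φ := fun _ : Fin 3 => 𝕜) i).analyticAt x).fun_sub
      analyticAt_const
  exact ((analyticAt_const.fun_mul (Finset.analyticAt_fun_sum _ fun i _ => (h i).fun_pow 2)).fun_add
    (Finset.analyticAt_fun_sum _ fun i _ => analyticAt_const.fun_mul (h i))).fun_add
    analyticAt_const

theorem pd_isoQuad (j : Fin 3) (x₀ : Pt 𝕜) (α : 𝕜) (β : Fin 3 → 𝕜) (γ : 𝕜) (x : Pt 𝕜) :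
    pd j (isoQuad x₀ α β γ) x = 2 * α * (x j - x₀ j) + β j := by
  have h1 (i : Fin 3) : pd j (fun y : Pt 𝕜 => (y i - x₀ i) ^ 2) x =
      2 * (x i - x₀ i) * if i = j then 1 else 0 := by
    rw [pd_pow j 2 (by fun_prop), pd_sub j (by fun_prop) (by fun_prop), pd_coord, pd_const]
    simp
  have h2 (i : Fin 3) : pd j (fun y : Pt 𝕜 => β i * (y i - x₀ i)) x =
      β i * if i = j then 1 else 0 := by
    rw [pd_const_mul j _ (by fun_prop), pd_sub j (by fun_prop) (by fun_prop), pd_coord, pd_const,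
      sub_zero]
  unfold isoQuad
  rw [pd_add j (by fun_prop) (by fun_prop), pd_add j (by fun_prop) (by fun_prop), pd_const,
    pd_const_mul j _ (by fun_prop), pd_sum _ j (fun i _ => by fun_prop),
    pd_sum _ j (fun i _ => by fun_prop)]
  simp only [h1, h2, mul_ite, mul_one, mul_zero, Finset.sum_ite_eq', Finset.mem_univ, if_true]
  ring

theorem pd_pd_isoQuad (i j : Fin 3) (x₀ : Pt 𝕜) (α : 𝕜) (β : Fin 3 → 𝕜) (γ : 𝕜) (x : Pt 𝕜) :
    pd i (pd j (isoQuad x₀ α β γ)) x = if j = i then 2 * α else 0 := by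
  rw [show pd j (isoQuad x₀ α β γ) = fun x => 2 * α * (x j - x₀ j) + β j from
    funext fun x => pd_isoQuad j x₀ α β γ x, pd_add i (by fun_prop) (by fun_prop),
    pd_const_mul i _ (by fun_prop), pd_sub i (by fun_prop) (by fun_prop), pd_coord, pd_const,
    pd_const]
  simp

/-- A function whose Hessian is a multiple of the identity is quadratic with isotropic quadratic
part. -/
theorem exists_eq_isoQuad {D : Set (Pt 𝕜)} (hD : IsOpen D) (hc : Convex ℝ D) {G g : Pt 𝕜 → 𝕜}
    (hG : AnalyticOnNhd 𝕜 G D)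
    (h : ∀ x ∈ D, ∀ i j, pd i (pd j G) x = if i = j then g x else 0) {x₀ : Pt 𝕜} (hx₀ : x₀ ∈ D) :
    ∃ α β γ, ∀ x ∈ D, G x = isoQuad x₀ α β γ x := by
  refine ⟨g x₀ / 2, fun i => pd i G x₀, G x₀, ?_⟩
  set Q := isoQuad x₀ (g x₀ / 2) (fun i => pd i G x₀) (G x₀) with hQ
  have hQa (x : Pt 𝕜) : AnalyticAt 𝕜 Q x := analyticAt_isoQuad _ _ _ _ x
  have hgi : ∀ x ∈ D, ∀ i, g x = pd i (pd i G) x := fun x hx i => by rw [h x hx, if_pos rfl]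
  have hga : AnalyticOnNhd 𝕜 g D := fun x hx =>
    (analyticAt_pd 0 (analyticAt_pd 0 (hG x hx))).congr (by
      filter_upwards [hD.mem_nhds hx] with y hy using (hgi y hy 0).symm)
  -- `∂ⱼ g = ∂ⱼ ∂ᵢ ∂ᵢ G = ∂ᵢ ∂ⱼ ∂ᵢ G = 0` for `i ≠ j`
  have hg : ∀ x ∈ D, ∀ j, pd j g x = 0 := by
    intro x hx j
    obtain ⟨i, hij⟩ : ∃ i : Fin 3, j ≠ i := exists_ne j |>.imp fun _ h => h.symm
    rw [pd_congr j hD (fun y hy => hgi y hy i) hx, pd_comm j i (analyticAt_pd i (hG x hx)),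
      pd_congr i hD (g := fun _ => 0) (fun y hy => by rw [h y hy, if_neg hij]) hx, pd_const]
  have key := eq_zero_of_gradient_system hD hc (σ := fun _ _ => 0) (μ := fun _ => 0)
    (fun _ => continuousOn_const) continuousOn_const 1 (F := fun x => G x - Q x)
    (w := fun i x => pd i G x - pd i Q x) (z := fun x => g x - g x₀)
    (fun x hx => ((hG x hx).fun_sub (hQa x)).differentiableAt.differentiableWithinAt)
    (fun i x hx => ((analyticAt_pd i (hG x hx)).fun_sub
      (analyticAt_pd i (hQa x))).differentiableAt.differentiableWithinAt)
    (fun x hx => ((hga x hx).fun_sub analyticAt_const).differentiableAt.differentiableWithinAt)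
    (fun x hx j => ⟨?_, fun i => ?_, ?_⟩) hx₀ ?_ (fun i => ?_) (sub_self _)
  · exact fun x hx => sub_eq_zero.1 (key x hx).1
  · rw [pd_sub j (hG x hx).differentiableAt (hQa x).differentiableAt, one_mul]
  · rw [pd_sub j (analyticAt_pd i (hG x hx)).differentiableAt
      (analyticAt_pd i (hQa x)).differentiableAt, h x hx, hQ, pd_pd_isoQuad]
    simp only [eq_comm (a := j)]
    split_ifs <;> ring
  · rw [pd_sub j (hga x hx).differentiableAt (by fun_prop), hg x hx, pd_const]
    ring
  · simp [hQ, isoQuad]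
  · simp [hQ, pd_isoQuad]

/-- A gradient that satisfies the Riccati equations `∂ⱼ sᵢ = -sᵢ sⱼ + δᵢⱼ μ` is the logarithmic
gradient of a quadratic function with isotropic quadratic part. -/
theorem exists_isoQuad_of_riccati {D : Set (Pt 𝕜)} (hD : IsOpen D) (hc : Convex ℝ D)
    {s : Fin 3 → Pt 𝕜 → 𝕜} (hs : ∀ i, AnalyticOnNhd 𝕜 (s i) D) {μ : Pt 𝕜 → 𝕜}
    (h : ∀ x ∈ D, ∀ i j, pd j (s i) x = -s i x * s j x + if i = j then μ x else 0) {x₀ : Pt 𝕜}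
    (hx₀ : x₀ ∈ D) {σ : Pt 𝕜 → 𝕜} (hσ : σ = isoQuad x₀ (μ x₀ / 2) (fun i => s i x₀) 1) :
    ∀ x ∈ D, (∀ i, pd i σ x = s i x * σ x) ∧ σ x ≠ 0 := by
  have hμi : ∀ x ∈ D, ∀ i, μ x = pd i (s i) x + s i x * s i x := fun x hx i => by
    rw [h x hx, if_pos rfl]; ring
  have hμa : AnalyticOnNhd 𝕜 μ D := fun x hx =>
    ((analyticAt_pd 0 (hs 0 x hx)).fun_add ((hs 0 x hx).fun_mul (hs 0 x hx))).congr (by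
      filter_upwards [hD.mem_nhds hx] with y hy using (hμi y hy 0).symm)
  have hsd (i) {x} (hx : x ∈ D) := (hs i x hx).differentiableAt
  have hμ : ∀ x ∈ D, ∀ j, pd j μ x = -μ x * s j x := by
    intro x hx j
    obtain ⟨i, hij⟩ : ∃ i : Fin 3, j ≠ i := exists_ne j |>.imp fun _ h => h.symm
    have e1 : pd i (pd j (s i)) x = pd i (fun y => -s i y * s j y) x :=
      pd_congr i hD (fun y hy => by rw [h y hy, if_neg hij.symm, add_zero]) hx
    rw [pd_congr j hD (fun y hy => hμi y hy i) hx,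
      pd_add j (analyticAt_pd i (hs i x hx)).differentiableAt ((hsd i hx).fun_mul (hsd i hx)),
      pd_comm j i (hs i x hx), e1, pd_mul i (hsd i hx).fun_neg (hsd j hx),
      pd_mul j (hsd i hx) (hsd i hx), pd_neg, h x hx, h x hx, h x hx]
    simp only [if_neg hij, if_neg hij.symm, if_true]
    ring
  have hσa (x : Pt 𝕜) : AnalyticAt 𝕜 σ x := hσ ▸ analyticAt_isoQuad _ _ _ _ x
  have hσd (x : Pt 𝕜) := (hσa x).differentiableAt
  have hσ2 (i j x) : pd j (pd i σ) x = if i = j then μ x₀ else 0 := by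
    rw [hσ, pd_pd_isoQuad]
    split_ifs <;> ring
  have hσ0 : σ x₀ = 1 := by simp [hσ, isoQuad]
  have key := eq_zero_of_gradient_system hD hc (σ := s) (μ := μ)
    (fun i => (hs i).continuousOn) hμa.continuousOn 0 (F := fun x => 0)
    (w := fun i x => pd i σ x - s i x * σ x) (z := fun x => μ x₀ - μ x * σ x)
    (differentiableOn_const _)
    (fun i x hx => ((analyticAt_pd i (hσa x)).fun_sub
      ((hs i x hx).fun_mul (hσa x))).differentiableAt.differentiableWithinAt)
    (fun x hx => (analyticAt_const.fun_sub
      ((hμa x hx).fun_mul (hσa x))).differentiableAt.differentiableWithinAt)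
    (fun x hx j => ⟨?_, fun i => ?_, ?_⟩) hx₀ rfl (fun i => ?_) ?_
  · have hgrad : ∀ x ∈ D, ∀ i, pd i σ x = s i x * σ x := fun x hx i =>
      sub_eq_zero.1 ((key x hx).2.1 i)
    refine fun x hx => ⟨hgrad x hx, fun h0 => ?_⟩
    have := eq_zero_of_pd_eq_mul hD hc (fun i => (hs i).continuousOn)
      (fun x _ => (hσd x).differentiableWithinAt) hgrad hx h0 x₀ hx₀
    simp [hσ0] at this
  · rw [pd_const, zero_mul]
  · rw [pd_sub j (analyticAt_pd i (hσa x)).differentiableAt ((hsd i hx).fun_mul (hσd x)), hσ2,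
      pd_mul j (hsd i hx) (hσd x), h x hx]
    split_ifs <;> ring
  · rw [pd_sub j (by fun_prop) ((hμa x hx).fun_mul (hσa x)).differentiableAt, pd_const,
      pd_mul j (hμa x hx).differentiableAt (hσd x), hμ x hx]
    ring
  · simp [hσ0]
    simp [hσ, pd_isoQuad]
  · simp [hσ0]

section

variable {S : System 𝕜} {T : Fin 3 → Fin 3 → Fin 3 → Pt 𝕜 → 𝕜}

theorem structT_zero_apply (u : Fin 3 → 𝕜) (i j k : Fin 3) :
    structT 0 u i j k = (if i = k then 3 else 0) * u j + (if j = k then 3 else 0) * u i -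
      (if i = j then 2 else 0) * u k := by
  have : harmonicCubic (0 : Fin 7 → 𝕜) i j k = 0 := by
    fin_cases i <;> fin_cases j <;> fin_cases k <;> simp [harmonicCubic]
  rw [structT, this]
  split_ifs <;> ring

/-- A tenth of the trace `∑ₗ Tₗₖₗ` of the structure tensor, which is the vector `u` if
`T = structT s u`. -/
def traceVec (T : Fin 3 → Fin 3 → Fin 3 → Pt 𝕜 → 𝕜) (k : Fin 3) (x : Pt 𝕜) : 𝕜 :=
  (∑ l, T l k l x) / 10

theorem eq_structT_traceVec {x : Pt 𝕜} (h : ∃ u, (fun i j k => T i j k x) = structT 0 u) :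
    (fun i j k => T i j k x) = structT 0 (fun k => traceVec T k x) := by
  obtain ⟨u, hu⟩ := h
  rw [hu]
  congr 1
  funext k
  have (l : Fin 3) : T l k l x = structT 0 u l k l := congr_fun (congr_fun (congr_fun hu l) k) l
  simp only [traceVec, this, structT_zero_apply, Fin.sum_univ_three]
  fin_cases k <;> simp <;> ring

theorem System.IsStructureTensor.analyticOnNhd_traceVec (hT : S.IsStructureTensor T) (k : Fin 3) :
    AnalyticOnNhd 𝕜 (traceVec T k) S.domain := fun x hx =>
  (Finset.analyticAt_fun_sum _ fun l _ => hT.analytic l k l x hx).fun_div analyticAt_const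
    (by norm_num)

theorem System.IsStructureTensor.pd_eq_structT (hT : S.IsStructureTensor T) (hD : IsOpen S.domain)
    (h : ∀ x ∈ S.domain, ∃ u, (fun i j k => T i j k x) = structT 0 u) {x : Pt 𝕜}
    (hx : x ∈ S.domain) : (fun l i j k => pd l (T i j k) x) =
      fun l => structT 0 (fun k => pd l (traceVec T k) x) := by
  have hd (k : Fin 3) := (hT.analyticOnNhd_traceVec k x hx).differentiableAt
  funext l i j k
  have e : ∀ y ∈ S.domain, T i j k y = (if i = k then 3 else 0) * traceVec T j y +
      (if j = k then 3 else 0) * traceVec T i y - (if i = j then 2 else 0) * traceVec T k y := by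
    intro y hy
    rw [← structT_zero_apply (fun k => traceVec T k y), ← eq_structT_traceVec (h y hy)]
  rw [pd_congr l hD e hx, structT_zero_apply, pd_sub l (by fun_prop) (by fun_prop),
    pd_add l (by fun_prop) (by fun_prop), pd_const_mul l _ (hd j), pd_const_mul l _ (hd i),
    pd_const_mul l _ (hd k)]

/-- The Riccati equations satisfied by the trace of the structure tensor. -/
theorem System.IsStructureTensor.exists_riccati (hT : S.IsStructureTensor T)
    (hD : IsOpen S.domain)
    (h : ∀ x ∈ S.domain, ∃ u, (fun i j k => T i j k x) = structT 0 u) {x : Pt 𝕜}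
    (hx : x ∈ S.domain) : ∃ ν : 𝕜, ∀ i j, pd j (traceVec T i) x =
      3 * traceVec T i x * traceVec T j x + if i = j then ν else 0 := by
  have hE := hT.potIntegrable hD hx
  rw [eq_structT_traceVec (h x hx), hT.pd_eq_structT hD h hx] at hE
  exact hE.riccati

/-- The Hessian of `σ V`, where `σ` is a solution of `∂σ = s σ` and `s` satisfies the Riccati
equations. -/
theorem pd_pd_mul_of_riccati {D : Set (Pt 𝕜)} (hD : IsOpen D) {s : Fin 3 → Pt 𝕜 → 𝕜}
    (hs : ∀ i, AnalyticOnNhd 𝕜 (s i) D) {μ σ V : Pt 𝕜 → 𝕜}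
    (h : ∀ x ∈ D, ∀ i j, pd j (s i) x = -s i x * s j x + if i = j then μ x else 0)
    (hσ : AnalyticOnNhd 𝕜 σ D) (hσs : ∀ x ∈ D, ∀ i, pd i σ x = s i x * σ x)
    (hV : AnalyticOnNhd 𝕜 V D) {x : Pt 𝕜} (hx : x ∈ D) (i j : Fin 3) :
    pd i (pd j (fun y => σ y * V y)) x = σ x * ((if i = j then μ x * V x else 0) +
      s i x * pd j V x + s j x * pd i V x + pd i (pd j V) x) := by
  have hσd := (hσ x hx).differentiableAt
  have hsd := (hs j x hx).differentiableAt
  have hVd := (hV x hx).differentiableAt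
  have hVd' := (analyticAt_pd j (hV x hx)).differentiableAt
  have e : ∀ y ∈ D, pd j (fun y => σ y * V y) y = σ y * (s j y * V y + pd j V y) := by
    intro y hy
    rw [pd_mul j (hσ y hy).differentiableAt (hV y hy).differentiableAt, hσs y hy]
    ring
  rw [pd_congr i hD e hx, pd_mul i hσd (by fun_prop), pd_add i (by fun_prop) hVd',
    pd_mul i hsd hVd, hσs x hx, h x hx]
  simp only [eq_comm (a := j)]
  split_ifs <;> ring

/-- If the totally symmetric part of the structure tensor vanishes identically, then the potentials
are the quotients of the quadratic functions with isotropic quadratic part by one such function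
`σ`, and the conformal factor is `C σ / h³` with another such function `h`, of zero discriminant. -/
theorem System.IsSuperintegrable.exists_isoQuad (hsuper : S.IsSuperintegrable)
    (hS : S.IsConformallyFlat) (hT : S.IsStructureTensor T)
    (h : ∀ x ∈ S.domain, ∃ u, (fun i j k => T i j k x) = structT 0 u) {x₀ : Pt 𝕜}
    (hx₀ : x₀ ∈ S.domain) :
    ∃ (a : 𝕜) (β b : Fin 3 → 𝕜) (C : 𝕜), C ≠ 0 ∧
      (∀ x ∈ S.domain, isoQuad x₀ a β 1 x ≠ 0 ∧
        isoQuad x₀ (∑ i, b i ^ 2) (fun i => -2 * b i) 1 x ≠ 0 ∧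
        S.lam x * isoQuad x₀ (∑ i, b i ^ 2) (fun i => -2 * b i) 1 x ^ 3 =
          C * isoQuad x₀ a β 1 x) ∧
      ∀ V : Pt 𝕜 → 𝕜, V ∈ S.pot ↔ ∃ α' β' γ', ∀ x ∈ S.domain,
        V x = isoQuad x₀ α' β' γ' x / isoQuad x₀ a β 1 x := by
  have hD := hS.isOpen
  have hua := hT.analyticOnNhd_traceVec
  have hLa := hS.analyticOnNhd_logGrad
  have hud (i) {x} (hx : x ∈ S.domain) := (hua i x hx).differentiableAt
  have hLd (i) {x} (hx : x ∈ S.domain) := (hLa i x hx).differentiableAt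
  have hν := fun x hx => hT.exists_riccati (x := x) hD h hx
  choose! ν hν using hν
  -- the logarithmic gradients of `σ` and of `h`
  let s : Fin 3 → Pt 𝕜 → 𝕜 := fun i x => -3 * traceVec T i x
  let r : Fin 3 → Pt 𝕜 → 𝕜 := fun i x => -3⁻¹ * S.logGrad x i - traceVec T i x
  have hsa (i) : AnalyticOnNhd 𝕜 (s i) S.domain := fun x hx =>
    analyticAt_const.fun_mul (hua i x hx)
  have hra (i) : AnalyticOnNhd 𝕜 (r i) S.domain := fun x hx =>
    (analyticAt_const.fun_mul (hLa i x hx)).fun_sub (hua i x hx)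
  have hs : ∀ x ∈ S.domain, ∀ i j, pd j (s i) x = -s i x * s j x +
      if i = j then -3 * ν x else 0 := by
    intro x hx i j
    simp only [s]
    rw [pd_const_mul j _ (hud i hx), hν x hx]
    split_ifs <;> ring
  have hr : ∀ x ∈ S.domain, ∀ i j, pd j (r i) x = -r i x * r j x +
      if i = j then (∑ k, r k x ^ 2) / 2 else 0 := by
    intro x hx i j
    have hcurv := fun B hB => hsuper.curv_eq_zero hS hT hx (B := B) hB
    rw [eq_structT_traceVec (h x hx), hT.pd_eq_structT hD h hx] at hcurv
    have := riccati_of_curv_eq_zero (hν x hx) (fun i j => hS.pd_logGrad_comm hx i j) hcurv i j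
    have hi (i) : r i x = -S.logGrad x i / 3 - traceVec T i x := by simp only [r]; ring
    simp only [hi]
    rw [← this]
    simp only [r]
    rw [pd_sub j ((hLd i hx).const_mul _) (hud i hx), pd_const_mul j _ (hLd i hx)]
    ring
  obtain hσ := exists_isoQuad_of_riccati hD hS.convex hsa hs hx₀ rfl
  obtain hh := exists_isoQuad_of_riccati hD hS.convex hra hr hx₀ rfl
  set σ := isoQuad x₀ (-3 * ν x₀ / 2) (fun i => s i x₀) 1 with hσdef
  have hbh : isoQuad x₀ ((∑ k, r k x₀ ^ 2) / 2 / 2) (fun i => r i x₀) 1 =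
      isoQuad x₀ (∑ i, (-r i x₀ / 2) ^ 2) (fun i => -2 * (-r i x₀ / 2)) 1 := by
    congr 1
    · rw [Finset.sum_div, Finset.sum_div]
      exact Finset.sum_congr rfl fun i _ => by ring
    · funext i
      ring
  rw [hbh] at hh
  set H := isoQuad x₀ (∑ i, (-r i x₀ / 2) ^ 2) (fun i => -2 * (-r i x₀ / 2)) 1 with hH
  have hσa : AnalyticOnNhd 𝕜 σ S.domain := fun x _ => analyticAt_isoQuad _ _ _ _ x
  have hHa (x) : AnalyticAt 𝕜 H x := analyticAt_isoQuad _ _ _ _ x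
  refine ⟨_, _, fun i => -r i x₀ / 2, S.lam x₀, hS.lam_ne_zero x₀ hx₀,
    fun x hx => ⟨(hσ x hx).2, (hh x hx).2, ?_⟩, fun V => ?_⟩
  · change S.lam x * H x ^ 3 = S.lam x₀ * σ x
    -- `λ h³` and `σ` have the same logarithmic gradient
    have hla (x) (hx : x ∈ S.domain) : AnalyticAt 𝕜 (fun x => S.lam x * H x ^ 3) x :=
      (hS.analytic_lam x hx).fun_mul ((hHa x).fun_pow 3)
    have hsa' (x) (hx : x ∈ S.domain) : AnalyticAt 𝕜 (fun x => S.lam x₀ * σ x) x :=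
      analyticAt_const.fun_mul (hσa x hx)
    refine sub_eq_zero.1 (eq_zero_of_pd_eq_mul hD hS.convex (fun i => (hsa i).continuousOn)
      (F := fun x => S.lam x * H x ^ 3 - S.lam x₀ * σ x)
      (fun x hx => ((hla x hx).fun_sub (hsa' x hx)).differentiableAt.differentiableWithinAt)
      (fun x hx i => ?_) hx₀ (by simp [hH, hσdef, isoQuad]) x hx)
    have h0 := hS.lam_ne_zero x hx
    rw [pd_sub i (hla x hx).differentiableAt (hsa' x hx).differentiableAt,
      pd_mul i (hS.analytic_lam x hx).differentiableAt ((hHa x).fun_pow 3).differentiableAt,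
      pd_pow i 3 (hHa x).differentiableAt, pd_const_mul i _ (hσa x hx).differentiableAt,
      (hσ x hx).1, (hh x hx).1]
    have hl : pd i S.lam x = S.logGrad x i * S.lam x := by
      rw [System.logGrad, div_mul_cancel₀ _ h0]
    rw [hl]
    simp only [r, s]
    push_cast
    ring
  · rw [hT.mem_pot_iff]
    have hTV (x) (hx : x ∈ S.domain) (i j : Fin 3) : ∑ k, T i j k x * pd k V x =
        -s i x * pd j V x - s j x * pd i V x -
          if i = j then 2 * ∑ k, traceVec T k x * pd k V x else 0 := by
      have (k : Fin 3) : T i j k x = structT 0 (fun k => traceVec T k x) i j k :=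
        congr_fun (congr_fun (congr_fun (eq_structT_traceVec (h x hx)) i) j) k
      simp only [this, structT_zero_apply, add_mul, sub_mul, Finset.sum_add_distrib,
        Finset.sum_sub_distrib, ite_mul, zero_mul, Finset.sum_ite_eq, Finset.mem_univ, if_true,
        Finset.sum_ite_irrel, Finset.sum_const_zero, mul_assoc, ← Finset.mul_sum, s]
      ring
    constructor
    · rintro ⟨hVa, hV⟩
      choose! η hη using hV
      have hG := fun x hx i j => pd_pd_mul_of_riccati (x := x) hD hsa hs hσa
        (fun x hx => (hσ x hx).1) hVa hx i j
      obtain ⟨α, β, γ, hq⟩ := exists_eq_isoQuad hD hS.convex (G := fun y => σ y * V y)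
        (g := fun x => σ x * (-3 * ν x * V x + η x - 2 * ∑ k, traceVec T k x * pd k V x))
        (fun x hx => (hσa x hx).fun_mul (hVa x hx)) (fun x hx i j => by
          rw [hG x hx, hη x hx, hTV x hx]
          split_ifs <;> ring) hx₀
      exact ⟨α, β, γ, fun x hx => by rw [← hq x hx, mul_div_cancel_left₀ _ (hσ x hx).2]⟩
    · rintro ⟨α, β, γ, hq⟩
      have hVa : AnalyticOnNhd 𝕜 V S.domain := fun x hx =>
        ((analyticAt_isoQuad x₀ α β γ x).fun_div (hσa x hx) (hσ x hx).2).congr (by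
          filter_upwards [hD.mem_nhds hx] with y hy using (hq y hy).symm)
      refine ⟨hVa, fun x hx => ⟨2 * α / σ x + 3 * ν x * V x +
        2 * ∑ k, traceVec T k x * pd k V x, fun i j => ?_⟩⟩
      have hG := pd_pd_mul_of_riccati (x := x) hD hsa hs hσa (fun x hx => (hσ x hx).1) hVa hx i j
      have hQ : pd i (pd j (fun y => σ y * V y)) x = if j = i then 2 * α else 0 := by
        rw [← pd_pd_isoQuad i j x₀ α β γ x]
        have e : ∀ y ∈ S.domain, σ y * V y = isoQuad x₀ α β γ y := fun y hy => by
          rw [hq y hy, mul_div_cancel₀ _ (hσ y hy).2]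
        exact pd_congr i hD (fun y hy => pd_congr j hD e hy) hx
      rw [hQ] at hG
      have h0 := (hσ x hx).2
      rw [hTV x hx]
      simp only [eq_comm (a := j)] at hG
      split_ifs at hG ⊢
      · field_simp
        linear_combination -hG
      · have := (mul_eq_zero.1 hG.symm).resolve_left h0
        linear_combination this

end

section

variable {S : System 𝕜} {T : Fin 3 → Fin 3 → Fin 3 → Pt 𝕜 → 𝕜}

/-! ### Special conformal transformations -/

/-- The denominator `1 - 2 b·z + b² z²`, `z = x - x₀`, of a special conformal
transformation. -/
def confDen (x₀ : Pt 𝕜) (b : Fin 3 → 𝕜) : Pt 𝕜 → 𝕜 :=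
  isoQuad x₀ (∑ i, b i ^ 2) (fun i => -2 * b i) 1

/-- The special conformal transformation `z ↦ (z - b z²) / (1 - 2 b·z + b² z²)`, where `z` are the
coordinates centred at `x₀` in the source and at `y₀` in the target. -/
def confMap (x₀ y₀ : Pt 𝕜) (b : Fin 3 → 𝕜) (x : Pt 𝕜) (k : Fin 3) : 𝕜 :=
  y₀ k + (x k - x₀ k - b k * ∑ i, (x i - x₀ i) ^ 2) / confDen x₀ b x

/-- The square of the numerator `z - b z²` is `z² (1 - 2 b·z + b² z²)`. -/
theorem sum_sq_confMap_num (x₀ : Pt 𝕜) (b : Fin 3 → 𝕜) (x : Pt 𝕜) :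
    ∑ k, (x k - x₀ k - b k * ∑ i, (x i - x₀ i) ^ 2) ^ 2 =
      (∑ i, (x i - x₀ i) ^ 2) * confDen x₀ b x := by
  simp only [confDen, isoQuad, Fin.sum_univ_three]
  ring

/-- A special conformal transformation pulls back a quadratic function with isotropic quadratic part
to another one divided by the denominator. -/
theorem isoQuad_confMap {x₀ : Pt 𝕜} (y₀ : Pt 𝕜) {b : Fin 3 → 𝕜} {x : Pt 𝕜}
    (h : confDen x₀ b x ≠ 0) (α : 𝕜) (β : Fin 3 → 𝕜) (γ : 𝕜) :
    isoQuad y₀ α β γ (confMap x₀ y₀ b x) =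
      isoQuad x₀ (α - ∑ i, β i * b i + γ * ∑ i, b i ^ 2) (fun i => β i - 2 * γ * b i) γ x /
        confDen x₀ b x := by
  have h1 := sum_sq_confMap_num x₀ b x
  have h2 : confDen x₀ b x = isoQuad x₀ (∑ i, b i ^ 2) (fun i => -2 * b i) 1 x := rfl
  rw [isoQuad]
  simp only [confMap, add_sub_cancel_left, div_pow, ← Finset.sum_div, h1, mul_div_assoc']
  rw [eq_div_iff h]
  field_simp
  rw [h2]
  simp only [isoQuad, Fin.sum_univ_three]
  ring

/-- Every quotient of a quadratic function by the denominator of a special conformal transformation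
is the pullback of a quadratic function by that transformation. -/
theorem exists_isoQuad_confMap (x₀ y₀ : Pt 𝕜) (b : Fin 3 → 𝕜) (α : 𝕜) (β : Fin 3 → 𝕜) (γ : 𝕜) :
    ∃ α' β' γ', ∀ x, confDen x₀ b x ≠ 0 →
      isoQuad y₀ α' β' γ' (confMap x₀ y₀ b x) = isoQuad x₀ α β γ x / confDen x₀ b x := by
  refine ⟨α + ∑ i, β i * b i + γ * ∑ i, b i ^ 2, fun i => β i + 2 * γ * b i, γ, fun x h => ?_⟩
  rw [isoQuad_confMap y₀ h]
  congr 2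
  · simp only [Fin.sum_univ_three]
    ring
  · funext i
    ring

theorem confDen_confMap {x₀ : Pt 𝕜} (y₀ : Pt 𝕜) {b : Fin 3 → 𝕜} {x : Pt 𝕜}
    (h : confDen x₀ b x ≠ 0) :
    confDen y₀ (-b) (confMap x₀ y₀ b x) = (confDen x₀ b x)⁻¹ := by
  rw [confDen, isoQuad_confMap y₀ h, inv_eq_one_div]
  congr 1
  simp only [isoQuad, Pi.neg_apply, Fin.sum_univ_three]
  ring

/-- The special conformal transformation by `-b` is the inverse of the one by `b`. -/
theorem confMap_confMap {x₀ : Pt 𝕜} (y₀ : Pt 𝕜) {b : Fin 3 → 𝕜} {x : Pt 𝕜}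
    (h : confDen x₀ b x ≠ 0) : confMap y₀ x₀ (-b) (confMap x₀ y₀ b x) = x := by
  funext k
  have h1 := sum_sq_confMap_num x₀ b x
  rw [confMap, confDen_confMap y₀ h]
  simp only [confMap, add_sub_cancel_left, div_pow, ← Finset.sum_div, h1, Pi.neg_apply]
  field_simp
  ring

theorem analyticAt_confDen (x₀ : Pt 𝕜) (b : Fin 3 → 𝕜) (x : Pt 𝕜) : AnalyticAt 𝕜 (confDen x₀ b) x :=
  analyticAt_isoQuad _ _ _ _ x

theorem analyticAt_confMap {x₀ : Pt 𝕜} (y₀ : Pt 𝕜) {b : Fin 3 → 𝕜} {x : Pt 𝕜}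
    (h : confDen x₀ b x ≠ 0) : AnalyticAt 𝕜 (confMap x₀ y₀ b) x := by
  have hc (i : Fin 3) : AnalyticAt 𝕜 (fun y : Pt 𝕜 => y i - x₀ i) x :=
    ((ContinuousLinearMap.proj (R := 𝕜) (φ := fun _ : Fin 3 => 𝕜) i).analyticAt x).fun_sub
      analyticAt_const
  exact AnalyticAt.pi fun k => analyticAt_const.fun_add
    (((hc k).fun_sub (analyticAt_const.fun_mul
      (Finset.analyticAt_fun_sum _ fun i _ => (hc i).fun_pow 2))).fun_div
    (analyticAt_confDen x₀ b x) h)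

theorem pd_confMap {x₀ : Pt 𝕜} (y₀ : Pt 𝕜) {b : Fin 3 → 𝕜} {x : Pt 𝕜}
    (h : confDen x₀ b x ≠ 0) (i k : Fin 3) :
    pd i (fun y => confMap x₀ y₀ b y k) x =
      ((if k = i then 1 else 0) - b k * (2 * (x i - x₀ i))) / confDen x₀ b x -
        (x k - x₀ k - b k * ∑ i, (x i - x₀ i) ^ 2) *
          (2 * (∑ i, b i ^ 2) * (x i - x₀ i) + -2 * b i) / confDen x₀ b x ^ 2 := by
  have hd := (analyticAt_confDen x₀ b x).differentiableAt
  have hi : DifferentiableAt 𝕜 (fun y => (confDen x₀ b y)⁻¹) x := hd.fun_inv h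
  have hp : pd i (confDen x₀ b) x = 2 * (∑ i, b i ^ 2) * (x i - x₀ i) + -2 * b i :=
    pd_isoQuad i x₀ _ _ _ x
  have hq : pd i (fun y : Pt 𝕜 => ∑ i, (y i - x₀ i) ^ 2) x = 2 * (x i - x₀ i) := by
    have e : isoQuad x₀ (1 : 𝕜) 0 0 = fun y => ∑ i, (y i - x₀ i) ^ 2 := by
      funext y
      simp [isoQuad]
    rw [← e, pd_isoQuad]
    simp
  simp only [confMap, div_eq_mul_inv]
  rw [pd_add i (by fun_prop) (by fun_prop), pd_const, pd_mul i (by fun_prop) hi, pd_inv i hd h, hp,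
    pd_sub i (by fun_prop) (by fun_prop), pd_sub i (by fun_prop) (by fun_prop), pd_coord, pd_const,
    pd_const_mul i _ (by fun_prop), hq]
  field_simp
  ring

/-- A special conformal transformation is conformal. -/
theorem sum_pd_confMap {x₀ : Pt 𝕜} (y₀ : Pt 𝕜) {b : Fin 3 → 𝕜} {x : Pt 𝕜}
    (h : confDen x₀ b x ≠ 0) (i j : Fin 3) :
    ∑ k, pd i (fun y => confMap x₀ y₀ b y k) x * pd j (fun y => confMap x₀ y₀ b y k) x =
      (if i = j then 1 else 0) / confDen x₀ b x ^ 2 := by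
  simp only [pd_confMap y₀ h]
  have hN := sum_sq_confMap_num x₀ b x
  have hH : confDen x₀ b x = isoQuad x₀ (∑ i, b i ^ 2) (fun i => -2 * b i) 1 x := rfl
  have hNd (i : Fin 3) : ∑ k, (x k - x₀ k - b k * ∑ i, (x i - x₀ i) ^ 2) *
      ((if k = i then 1 else 0) - b k * (2 * (x i - x₀ i))) = (x i - x₀ i) * confDen x₀ b x +
        (∑ i, (x i - x₀ i) ^ 2) * ((∑ i, b i ^ 2) * (x i - x₀ i) - b i) := by
    rw [hH]
    fin_cases i <;> simp [isoQuad, Fin.sum_univ_three] <;> ring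
  have hdd : ∑ k, ((if k = i then 1 else 0) - b k * (2 * (x i - x₀ i))) *
      ((if k = j then 1 else 0) - b k * (2 * (x j - x₀ j))) = (if i = j then 1 else 0) -
        2 * b i * (x j - x₀ j) - 2 * b j * (x i - x₀ i) +
        4 * (∑ i, b i ^ 2) * (x i - x₀ i) * (x j - x₀ j) := by
    simp only [mul_sub, sub_mul, Finset.sum_sub_distrib, ite_mul, mul_ite, one_mul, mul_one,
      zero_mul, mul_zero, Finset.sum_ite_eq', Finset.mem_univ, if_true]
    simp only [Fin.sum_univ_three, eq_comm (a := j)]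
    ring
  generalize confDen x₀ b x = H at *
  generalize ∑ i, (x i - x₀ i) ^ 2 = Z at *
  generalize ∑ i, b i ^ 2 = B at *
  have hi := hNd i
  have hj := hNd j
  calc _ = (∑ k, ((if k = i then 1 else 0) - b k * (2 * (x i - x₀ i))) *
        ((if k = j then 1 else 0) - b k * (2 * (x j - x₀ j)))) / H ^ 2 -
      (2 * B * (x j - x₀ j) + -2 * b j) * (∑ k, (x k - x₀ k - b k * Z) *
        ((if k = i then 1 else 0) - b k * (2 * (x i - x₀ i)))) / H ^ 3 -
      (2 * B * (x i - x₀ i) + -2 * b i) * (∑ k, (x k - x₀ k - b k * Z) *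
        ((if k = j then 1 else 0) - b k * (2 * (x j - x₀ j)))) / H ^ 3 +
      (2 * B * (x i - x₀ i) + -2 * b i) * (2 * B * (x j - x₀ j) + -2 * b j) *
        (∑ k, (x k - x₀ k - b k * Z) ^ 2) / H ^ 4 := by
        simp only [Finset.mul_sum, Finset.sum_div, ← Finset.sum_sub_distrib,
          ← Finset.sum_add_distrib]
        refine Finset.sum_congr rfl fun k _ => ?_
        field_simp
        ring
    _ = _ := by
        rw [hi, hj, hN, hdd]
        field_simp
        ring

end

section

variable {S : System 𝕜} {T : Fin 3 → Fin 3 → Fin 3 → Pt 𝕜 → 𝕜}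

/-! ### Identification with the oscillator -/

theorem isoQuad_mem_pot (D : Set (Pt 𝕜)) (α : 𝕜) (β : Fin 3 → 𝕜) (γ : 𝕜) :
    isoQuad 0 α β γ ∈ (isotropicOscillator D).pot :=
  ⟨fun x _ => analyticAt_isoQuad _ _ _ _ x, α, β, γ, fun x _ => by simp [isoQuad]⟩

/-- A special conformal transformation maps an open set on which its denominator does not vanish to
an open set. -/
theorem isOpen_image_confMap {D : Set (Pt 𝕜)} (hD : IsOpen D) {x₀ : Pt 𝕜} (y₀ : Pt 𝕜)
    {b : Fin 3 → 𝕜} (h : ∀ x ∈ D, confDen x₀ b x ≠ 0) : IsOpen (confMap x₀ y₀ b '' D) := by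
  have e : confMap x₀ y₀ b '' D =
      {y | confDen y₀ (-b) y ≠ 0} ∩ confMap y₀ x₀ (-b) ⁻¹' D := by
    ext y
    constructor
    · rintro ⟨x, hx, rfl⟩
      refine ⟨?_, ?_⟩
      · rw [Set.mem_ofPred_eq, confDen_confMap y₀ (h x hx)]
        exact inv_ne_zero (h x hx)
      · rwa [Set.mem_preimage, confMap_confMap y₀ (h x hx)]
    · rintro ⟨hy, hyD⟩
      refine ⟨_, hyD, ?_⟩
      have := confMap_confMap x₀ hy
      rwa [neg_neg] at this
  have hc : Continuous (confDen y₀ (-b)) :=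
    continuous_iff_continuousAt.2 fun x => (analyticAt_confDen _ _ x).continuousAt
  rw [e]
  exact ContinuousOn.isOpen_inter_preimage
    (fun y hy => (analyticAt_confMap x₀ hy).continuousAt.continuousWithinAt)
    (isOpen_ne_fun hc continuous_const) hD

/-- If the totally symmetric part of the structure tensor vanishes identically, then a special
conformal transformation, with the denominator `h` for which `λ = C σ / h³`, identifies the system
with a Stäckel transform of the isotropic oscillator. -/
theorem System.IsSuperintegrable.isStackelTransformOfOscillator (hsuper : S.IsSuperintegrable)
    (hS : S.IsConformallyFlat) (hT : S.IsStructureTensor T)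
    (h : ∀ x ∈ S.domain, ∃ u, (fun i j k => T i j k x) = structT 0 u) :
    S.IsStackelTransformOfOscillator := by
  obtain ⟨x₀, hx₀⟩ := hS.nonempty
  obtain ⟨a, β, b, C, hC, hne, hpot⟩ := hsuper.exists_isoQuad hS hT h hx₀
  set σ := isoQuad x₀ a β 1 with hσ
  change ∀ x ∈ S.domain, σ x ≠ 0 ∧ confDen x₀ b x ≠ 0 ∧
    S.lam x * confDen x₀ b x ^ 3 = C * σ x at hne
  have hσ0 := fun x hx => (hne x hx).1
  have hH0 := fun x hx => (hne x hx).2.1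
  have hlam := fun x hx => (hne x hx).2.2
  set φ := confMap x₀ 0 b with hφ
  obtain ⟨α₁, β₁, γ₁, hU⟩ := exists_isoQuad_confMap x₀ 0 b (C * a) (fun i => C * β i) C
  set U := isoQuad 0 α₁ β₁ γ₁ with hUdef
  have hUφ : ∀ x ∈ S.domain, U (φ x) = C * σ x / confDen x₀ b x := by
    intro x hx
    rw [hφ, hU x (hH0 x hx)]
    congr 1
    simp only [hσ, isoQuad, Fin.sum_univ_three]
    ring
  have hU0 : ∀ y ∈ φ '' S.domain, U y ≠ 0 := by
    rintro _ ⟨x, hx, rfl⟩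
    rw [hUφ x hx]
    exact div_ne_zero (mul_ne_zero hC (hσ0 x hx)) (hH0 x hx)
  have hUa (y) : AnalyticAt 𝕜 U y := analyticAt_isoQuad _ _ _ _ y
  refine ⟨φ '' S.domain, U, φ, isOpen_image_confMap hS.isOpen 0 hH0, isoQuad_mem_pot _ _ _ _,
    hU0, fun x hx => analyticAt_confMap 0 (hH0 x hx), ?_, rfl, ?_, ?_⟩
  · intro x hx y hy hxy
    rw [← confMap_confMap 0 (hH0 x hx), ← confMap_confMap 0 (hH0 y hy)]
    exact congrArg _ hxy
  · intro x hx i j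
    have h0 := hH0 x hx
    simp only [System.stackelTransform, isotropicOscillator, one_mul]
    rw [sum_pd_confMap 0 h0, hUφ x hx, ← hlam x hx]
    split_ifs
    · field_simp
    · simp
  · intro V
    rw [hpot]
    constructor
    · rintro ⟨α, β', γ, hV⟩
      obtain ⟨α₂, β₂, γ₂, hQ⟩ := exists_isoQuad_confMap x₀ 0 b (C * α) (fun i => C * β' i) (C * γ)
      have hQa (y) : AnalyticAt 𝕜 (isoQuad 0 α₂ β₂ γ₂) y := analyticAt_isoQuad _ _ _ _ y
      have hVU : ∀ y ∈ φ '' S.domain,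
          isoQuad 0 α₂ β₂ γ₂ y / U y * U y = isoQuad 0 α₂ β₂ γ₂ y := fun y hy =>
        div_mul_cancel₀ _ (hU0 y hy)
      refine ⟨fun y => isoQuad 0 α₂ β₂ γ₂ y / U y,
        ⟨fun y hy => (hQa y).fun_div (hUa y) (hU0 y hy), ?_, α₂, β₂, γ₂, fun y hy => ?_⟩,
        fun x hx => ?_⟩
      · exact fun y hy => ((hQa y).fun_div (hUa y) (hU0 y hy)).fun_mul (hUa y)
      · refine (hVU y hy).trans ?_
        simp [isoQuad]
      · have h0 := hH0 x hx
        have h1 := hσ0 x hx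
        have e : isoQuad x₀ (C * α) (fun i => C * β' i) (C * γ) x = C * isoQuad x₀ α β' γ x := by
          simp only [isoQuad, Fin.sum_univ_three]
          ring
        beta_reduce
        rw [hV x hx, hUφ x hx, hφ, hQ x h0, e]
        field_simp
    · rintro ⟨V', ⟨-, -, α, β', γ, hV'⟩, hVV⟩
      refine ⟨C⁻¹ * (α - ∑ i, β' i * b i + γ * ∑ i, b i ^ 2),
        fun i => C⁻¹ * (β' i - 2 * γ * b i), C⁻¹ * γ, fun x hx => ?_⟩
      have h0 := hH0 x hx
      have h1 := hσ0 x hx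
      have e1 : V' (φ x) * U (φ x) = isoQuad 0 α β' γ (φ x) := by
        refine (hV' (φ x) (Set.mem_image_of_mem _ hx)).trans ?_
        simp [isoQuad]
      rw [hUφ x hx, hφ, isoQuad_confMap 0 h0, ← hφ, ← hVV x hx] at e1
      have e2 : isoQuad x₀ (C⁻¹ * (α - ∑ i, β' i * b i + γ * ∑ i, b i ^ 2))
          (fun i => C⁻¹ * (β' i - 2 * γ * b i)) (C⁻¹ * γ) x = C⁻¹ *
          isoQuad x₀ (α - ∑ i, β' i * b i + γ * ∑ i, b i ^ 2) (fun i => β' i - 2 * γ * b i) γ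
            x := by
        simp only [isoQuad, Fin.sum_univ_three]
        ring
      rw [e2, eq_div_iff h1]
      field_simp at e1 ⊢
      linear_combination e1

end

end Superintegrable

end

theorem mainTheorem7 {𝕜 : Type*} [RCLike 𝕜] (S : Superintegrable.System 𝕜)
    (hflat : S.IsConformallyFlat) (hnondeg : S.IsNondegenerate) (hsuper : S.IsSuperintegrable)
    (hosc : ¬ S.IsStackelTransformOfOscillator) :
    Module.finrank 𝕜 S.thirdOrderConstants = 4 ∧
      Submodule.span 𝕜 S.secondOrderBrackets = S.thirdOrderConstants := by
  obtain ⟨T, hT⟩ := hnondeg.exists_structureTensor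
  by_cases h : ∃ x ∈ S.domain, ∃ s u, (fun i j k => T i j k x) =
      Superintegrable.structT s u ∧ s ≠ 0
  · obtain ⟨x, hx, s, u, hsu, hs⟩ := h
    exact hsuper.thirdOrderConstants_of_ne_zero hflat hT hx hsu hs
  · refine absurd (hsuper.isStackelTransformOfOscillator hflat hT fun x hx => ?_) hosc
    obtain ⟨s, u, hsu⟩ := (hT.isPotentialTensor hflat.isOpen hx).exists_eq
    have hs : s = 0 := by
      by_contra hs
      exact h ⟨x, hx, s, u, hsu, hs⟩
    exact ⟨u, hs ▸ hsu⟩
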